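/- Let $N\ge 1$ be an integer and $b\in\mathbb C$ with $|b|=1$, $\mathrm{Re}\,b>0$, $\mathrm{Im}\,b>0$. Put $\bm q=e^{\frac{\pi i}{N}(1+b^2)}$, $\tilde{\bm q}=e^{\frac{\pi i}{N}(1+b^{-2})}$, and for $m\in\mathbb Z/N\mathbb Z$ $$y(\mu,m)=e^{\frac{2\pi i}{N}(-ib\mu-m)},\qquad \tilde y(\mu,m)=e^{\frac{2\pi i}{N}(-ib^{-1}\mu+m)} .$$ Let $\mathcal H=L^2(\mathbb R)\otimes\mathbb C^N$, whose elements are written $f(\mu,m)$, $\mu\in\mathbb R$, $m\in\mathbb Z/N\mathbb Z$, and let $\mathscr W\subset\mathcal H$ be the dense subspace of all $f$ such that each $f(\cdot,m)$ is a linear combination of functions $\mu^k e^{-\alpha\mu^2+\beta\mu}$ with $k\ge 0$, $\mathrm{Re}\,\alpha>0$, $\beta\in\mathbb C$. On $\mathscr W$ let $$\bm u f(\mu,m)=f(\mu+ib,m-1),\qquad \bm y f(\mu,m)=y(\mu,m)f(\mu,m),\qquad e^{\alpha \bm U+\beta \bm Y}:=\bm q^{-\alpha\beta}\bm u^\alpha\bm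 y^\beta\quad(\alpha,\beta\in\mathbb Z),$$ and for $\lambda_1,\lambda_2\in\mathbb C^\times$ let $$Q_1'=e^{\bm Y-\bm U}+e^{-\bm Y+\bm U}+(\lambda_1+\lambda_1^{-1})e^{-\bm Y}+(\lambda_2+\lambda_2^{-1})e^{-\bm U}+e^{-\bm U-\bm Y},$$ $$Q_1''=\lambda_2e^{-\bm U}+\lambda_2^{-1}e^{\bm U}+\lambda_1^{-1}e^{-\bm Y},\qquad \bm L=\bm y^{-1}+\bm y+\bm u .$$ Let $\varphi(y,\tilde y)=\Big[\prod_{j\ge0}(1+\bm q^{2j+1}y)\Big/\prod_{j\ge0}(1+\tilde{\bm q}^{-2j-1}\tilde y)\Big]^{-1}$ be the quantum dilogarithm. Let $\mathcal F$ be the unitary Fourier transformation $$\mathcal F f(\mu,m)=\frac1N\sum_{m'\in\mathbb Z/N\mathbb Z}\int d\mu'\,e^{\frac{2\pi i}{N}(\mu\mu'-mm')}f(\mu',m').$$ For $c\in\mathbb C$ and $\sigma=\pm1$ let $\varphi(c\,\bm y^{\sigma})$ be the unitary operator of multiplication by $\varphi(c\,y(\mu,m)^\sigma,\bar c\,\tilde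 y(\mu,m)^\sigma)$ (a function of modulus one almost everywhere), and let $\varphi(c\,\bm u^{\sigma})=\mathcal F^{-1}\varphi(c\,\bm y^\sigma)\mathcal F$ (recall $\mathcal F\bm u\mathcal F^{-1}=\bm y$). Define the unitary operator $C_1$ by $$C_1^{-1}=\varphi(\lambda_2^{-1}\bm y)\,\varphi(\lambda_1\bm u^{-1})\,\varphi(\lambda_1\bm u)^{-1}.$$ Fix $\mu_1,\mu_2\in\mathbb R$ and $m_1,m_2\in\mathbb Z/N\mathbb Z$. (1) Let $\lambda_a=(-1)^N\exp\big[\tfrac{2\pi i}{N}(-ib\mu_a-m_a)\big]$, $a=1,2$. Then $Q_1'$ and $Q_1''$, with domain $\mathscr W$, are closable, and their closures satisfy $$C_1\,\overline{Q_1'}\,C_1^{-1}=\overline{Q_1''},\qquad Q_1''=e^{-\bm U+L_2}+e^{\bm U-L_2}+e^{-\bm Y-L_1}\quad(e^{L_a}=\lambda_a),$$ as unbounded operators, including equality of the domains. (2) Let $\sigma\in\{1,-1\}$ and $\lambda_a=\sigma\exp\big[\tfrac{2\pi i}{N}(-ib\mu_a-m_a)\big]$, $a=1,2$, and define unitary operators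 by $$\mathcal S_{\lambda_1}f(\mu,m)=f(\mu-\mu_1,m-m_1),\qquad \mathcal D_{\lambda_2}f(\mu,m)=e^{-\frac{2\pi i}{N}(\mu_2\mu-m_2m)}f(\mu,m).$$ Then $Q_1''$ and $\bm L$, with domain $\mathscr W$, are closable, and $$\mathcal F\,\mathcal D_{\lambda_2}^{-1}\,\mathcal S_{\lambda_1}\,\overline{Q_1''}\,\mathcal S_{\lambda_1}^{-1}\,\mathcal D_{\lambda_2}\,\mathcal F^{-1}=\sigma\,\overline{\bm L},\qquad \bm L=\bm y^{-1}+\bm y+\bm u ,$$ as unbounded operators; in particular this is $\overline{\bm L}$ for $\lambda_a=\exp\big[\tfrac{2\pi i}{N}(-ib\mu_a-m_a)\big]$. -/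

import Mathlib

open MeasureTheory Complex
open scoped ENNReal ComplexConjugate

noncomputable section

namespace LevelN

/-! ### Parameters -/

/-- The standing assumptions on `b`: `|b| = 1`, `Re b > 0`, `Im b > 0`. -/
structure IsParam (b : ℂ) : Prop where
  norm_eq : ‖b‖ = 1
  re_pos : 0 < b.re
  im_pos : 0 < b.im

/-- `q = exp(ℏ)`, `ℏ = (π i / N)(1 + b²)`. -/
def q (N : ℕ) (b : ℂ) : ℂ := exp (Real.pi * I / N * (1 + b ^ 2))

/-- `q̃ = exp(ℏ̃)`, `ℏ̃ = (π i / N)(1 + b⁻²)`. -/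
def qt (N : ℕ) (b : ℂ) : ℂ := exp (Real.pi * I / N * (1 + (b⁻¹) ^ 2))

/-- `y(μ, m) = exp[(2πi/N)(-i b μ - m)]`, for complex `μ` and `m ∈ ℤ/N`. -/
def yFun (N : ℕ) (b : ℂ) (m : ZMod N) (μ : ℂ) : ℂ :=
  exp (2 * Real.pi * I / N * (-I * b * μ - (m.val : ℂ)))

/-- `ỹ(μ, m) = exp[(2πi/N)(-i b⁻¹ μ + m)]`. -/
def ytFun (N : ℕ) (b : ℂ) (m : ZMod N) (μ : ℂ) : ℂ :=
  exp (2 * Real.pi * I / N * (-I * b⁻¹ * μ + (m.val : ℂ)))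

/-- The quantum dilogarithm
`φ(y, ỹ) = [∏_{j ≥ 0} (1 + q^{2j+1} y) / ∏_{j ≥ 0} (1 + q̃^{-2j-1} ỹ)]⁻¹`. -/
def qdilog (N : ℕ) (b y yt : ℂ) : ℂ :=
  ((∏' j : ℕ, (1 + q N b ^ (2 * j + 1) * y)) /
    (∏' j : ℕ, (1 + (qt N b)⁻¹ ^ (2 * j + 1) * yt)))⁻¹

/-! ### The Hilbert space and elementary unitary operators -/

/-- `L²(ℝ)`. -/
abbrev L2R := Lp ℂ 2 (volume : Measure ℝ)

/-- `ℋ = L²(ℝ) ⊗ ℂ^N`, as the Hilbert sum of `N` copies of `L²(ℝ)`: a vector is a family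
`m ↦ f(·, m)`, `m ∈ ℤ/N`. -/
abbrev HS (N : ℕ) := PiLp 2 (fun _ : ZMod N => L2R)

theorem memLp_mul {g : ℝ → ℂ} (hg : AEStronglyMeasurable g volume)
    (h1 : ∀ᵐ x, ‖g x‖ = 1) (f : L2R) : MemLp (fun x => g x * f x) 2 volume := by
  refine (memLp_congr_norm (hg.mul (Lp.aestronglyMeasurable f))
    (Lp.aestronglyMeasurable f) ?_).2 (Lp.memLp f)
  filter_upwards [h1] with x hx
  simp [hx]

/-- Multiplication by a function of modulus one, as a linear isometry of `L²(ℝ)`. -/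
def mulIso (g : ℝ → ℂ) (hg : AEStronglyMeasurable g volume) (h1 : ∀ᵐ x, ‖g x‖ = 1) :
    L2R →ₗᵢ[ℂ] L2R where
  toFun f := (memLp_mul hg h1 f).toLp _
  map_add' f f' := by
    rw [← MemLp.toLp_add]
    apply MemLp.toLp_congr
    filter_upwards [Lp.coeFn_add f f'] with x hx
    change g x * (f + f' : L2R) x = g x * f x + g x * f' x
    rw [hx, Pi.add_apply, mul_add]
  map_smul' c f := by
    rw [RingHom.id_apply, ← MemLp.toLp_const_smul]
    apply MemLp.toLp_congr
    filter_upwards [Lp.coeFn_smul c f] with x hx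
    simp [hx]; ring
  norm_map' f := by
    change ‖(memLp_mul hg h1 f).toLp _‖ = ‖f‖
    rw [Lp.norm_toLp, Lp.norm_def]
    congr 1
    refine eLpNorm_congr_norm_ae ?_
    filter_upwards [h1] with x hx
    simp [hx]

theorem mulIso_ae (g : ℝ → ℂ) (hg : AEStronglyMeasurable g volume)
    (h1 : ∀ᵐ x, ‖g x‖ = 1) (f : L2R) : mulIso g hg h1 f =ᵐ[volume] fun x => g x * f x :=
  (memLp_mul hg h1 f).coeFn_toLp

/-- Multiplication by a function of modulus one, as a unitary operator on `L²(ℝ)`. -/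
def mulUnitary (g : ℝ → ℂ) (hg : AEStronglyMeasurable g volume) (h1 : ∀ᵐ x, ‖g x‖ = 1) :
    L2R ≃ₗᵢ[ℂ] L2R :=
  LinearIsometryEquiv.ofSurjective (mulIso g hg h1) (by
    intro f
    have hg' : AEStronglyMeasurable (fun x => conj (g x)) volume :=
      Complex.continuous_conj.comp_aestronglyMeasurable hg
    have h1' : ∀ᵐ x, ‖conj (g x)‖ = 1 := by simpa using h1
    refine ⟨mulIso _ hg' h1' f, ?_⟩
    apply Lp.ext
    filter_upwards [mulIso_ae g hg h1 (mulIso _ hg' h1' f), mulIso_ae _ hg' h1' f, h1]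
      with x hx hx' h
    rw [hx, hx', ← mul_assoc, Complex.mul_conj, Complex.normSq_eq_norm_sq, h]
    simp)

theorem measurePreserving_affine {a : ℝ} (ha : 0 < a) (c : ℝ) :
    MeasurePreserving (fun x : ℝ => a * x + c) volume (ENNReal.ofReal a⁻¹ • volume) := by
  refine ⟨by fun_prop, ?_⟩
  have h := Real.map_volume_mul_left ha.ne'
  rw [abs_of_pos (inv_pos.2 ha)] at h
  have h2 : (fun x : ℝ => a * x + c) = (fun x => x + c) ∘ (fun x => a * x) := rfl
  rw [h2, ← Measure.map_map (by fun_prop) (by fun_prop), h, Measure.map_smul,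
    (measurePreserving_add_right volume c).map_eq]

theorem memLp_affine {a : ℝ} (ha : 0 < a) (c : ℝ) (f : L2R) :
    MemLp (fun x : ℝ => (Real.sqrt a : ℂ) * f (a * x + c)) 2 volume := by
  have h : MemLp (f : ℝ → ℂ) 2 (ENNReal.ofReal a⁻¹ • volume) :=
    (Lp.memLp f).smul_measure ENNReal.ofReal_ne_top
  exact (h.comp_measurePreserving (measurePreserving_affine ha c)).const_mul _

theorem ae_affine {a : ℝ} (ha : 0 < a) (c : ℝ) {p : ℝ → Prop} (h : ∀ᵐ x, p x) :
    ∀ᵐ x : ℝ, p (a * x + c) :=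
  (measurePreserving_affine ha c).quasiMeasurePreserving.ae
    (Measure.ae_smul_measure h _)

/-- `f ↦ √a f(a x + c)`, `a > 0`, as a linear isometry of `L²(ℝ)`. -/
def affineIso (a : ℝ) (ha : 0 < a) (c : ℝ) : L2R →ₗᵢ[ℂ] L2R where
  toFun f := (memLp_affine ha c f).toLp _
  map_add' f f' := by
    rw [← MemLp.toLp_add]
    apply MemLp.toLp_congr
    filter_upwards [ae_affine ha c (Lp.coeFn_add f f')] with x hx
    change (Real.sqrt a : ℂ) * (f + f' : L2R) (a * x + c) =
      (Real.sqrt a : ℂ) * f (a * x + c) + (Real.sqrt a : ℂ) * f' (a * x + c)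
    rw [hx, Pi.add_apply, mul_add]
  map_smul' k f := by
    rw [RingHom.id_apply, ← MemLp.toLp_const_smul]
    apply MemLp.toLp_congr
    filter_upwards [ae_affine ha c (Lp.coeFn_smul k f)] with x hx
    simp [hx]; ring
  norm_map' f := by
    change ‖(memLp_affine ha c f).toLp _‖ = ‖f‖
    rw [Lp.norm_toLp, Lp.norm_def]
    congr 1
    have h0 := eLpNorm_const_smul (Real.sqrt a : ℂ) (fun x : ℝ => f (a * x + c)) 2 volume
    have h1 := eLpNorm_comp_measurePreserving (p := 2)
      ((Lp.aestronglyMeasurable f).smul_measure (ENNReal.ofReal a⁻¹))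
      (measurePreserving_affine ha c)
    have h2 := eLpNorm_smul_measure_of_ne_top (p := 2) (μ := volume) (by simp)
      (f : ℝ → ℂ) (ENNReal.ofReal a⁻¹)
    have h3 : eLpNorm (fun x : ℝ => (Real.sqrt a : ℂ) * f (a * x + c)) 2 volume =
        ‖(Real.sqrt a : ℂ)‖ₑ * (ENNReal.ofReal a⁻¹ ^ (1 / 2 : ℝ) * eLpNorm f 2 volume) := by
      refine h0.trans ?_
      congr 1
      refine (h1.trans h2).trans ?_
      simp
    rw [h3, ← mul_assoc]
    have h4 : ‖(Real.sqrt a : ℂ)‖ₑ * ENNReal.ofReal a⁻¹ ^ (1 / 2 : ℝ) = 1 := by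
      rw [ENNReal.ofReal_rpow_of_pos (inv_pos.2 ha), ← Real.sqrt_eq_rpow,
        ← ofReal_norm, ← ENNReal.ofReal_mul (norm_nonneg _)]
      simp [abs_of_nonneg (Real.sqrt_nonneg a), (Real.sqrt_pos.2 ha).ne']
    rw [h4, one_mul]

theorem affineIso_ae (a : ℝ) (ha : 0 < a) (c : ℝ) (f : L2R) :
    affineIso a ha c f =ᵐ[volume] fun x => (Real.sqrt a : ℂ) * f (a * x + c) :=
  (memLp_affine ha c f).coeFn_toLp

/-- `f ↦ √a f(a x + c)`, `a > 0`, as a unitary operator on `L²(ℝ)`. -/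
def affineUnitary (a : ℝ) (ha : 0 < a) (c : ℝ) : L2R ≃ₗᵢ[ℂ] L2R :=
  LinearIsometryEquiv.ofSurjective (affineIso a ha c) (by
    intro f
    refine ⟨affineIso a⁻¹ (inv_pos.2 ha) (-(a⁻¹ * c)) f, ?_⟩
    apply Lp.ext
    filter_upwards [affineIso_ae a ha c (affineIso a⁻¹ (inv_pos.2 ha) (-(a⁻¹ * c)) f),
      ae_affine ha c (affineIso_ae a⁻¹ (inv_pos.2 ha) (-(a⁻¹ * c)) f)] with x hx hx'
    rw [hx, hx', ← mul_assoc]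
    have h1 : a⁻¹ * (a * x + c) + -(a⁻¹ * c) = x := by field_simp; ring
    have h2 : (Real.sqrt a : ℂ) * (Real.sqrt a⁻¹ : ℂ) = 1 := by
      rw [← Complex.ofReal_mul, Real.sqrt_inv, mul_inv_cancel₀ (Real.sqrt_pos.2 ha).ne']
      simp
    rw [h1, h2, one_mul])

/-- Parseval's identity for the discrete Fourier transform on `ℤ/N`. -/
theorem dft_parseval {N : ℕ} [NeZero N] (f : ZMod N → L2R) :
    ∑ k, ‖ZMod.dft f k‖ ^ 2 = N * ∑ j, ‖f j‖ ^ 2 := by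
  have key : ∀ g h : ZMod N → L2R,
      ∑ k, inner ℂ (ZMod.dft g k) (h k) = ∑ j, inner ℂ (g j) (ZMod.dft h (-j)) := by
    intro g h
    simp only [ZMod.dft_apply, sum_inner, inner_sum, inner_smul_left, inner_smul_right]
    rw [Finset.sum_comm]
    refine Finset.sum_congr rfl fun j _ => Finset.sum_congr rfl fun k _ => ?_
    congr 1
    rw [← AddChar.map_neg_eq_conj]
    congr 1
    ring
  have h := key f (ZMod.dft f)
  rw [ZMod.dft_dft] at h
  simp only [neg_neg, inner_smul_right, inner_self_eq_norm_sq_to_K] at h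
  rw [← Finset.mul_sum] at h
  apply Complex.ofReal_injective
  push_cast
  simpa using h

/-- The unitary discrete Fourier transform
`(f_m)_m ↦ (N^{-1/2} ∑_{m'} e^{-2πi m m'/N} f_{m'})_m` on `ℋ`. -/
def dftUnitary (N : ℕ) [NeZero N] : HS N ≃ₗᵢ[ℂ] HS N where
  toLinearEquiv :=
    ((WithLp.linearEquiv 2 ℂ (ZMod N → L2R)).trans (ZMod.dft.trans
      (LinearEquiv.smulOfNeZero ℂ (ZMod N → L2R) ((Real.sqrt N : ℂ)⁻¹)
        (by simp [NeZero.ne N])))).trans (WithLp.linearEquiv 2 ℂ (ZMod N → L2R)).symm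
  norm_map' f := by
    have hN : (0 : ℝ) < N := Nat.cast_pos.2 (NeZero.pos N)
    have h := dft_parseval (N := N) (WithLp.ofLp f)
    rw [PiLp.norm_eq_of_L2, PiLp.norm_eq_of_L2]
    congr 1
    change ∑ k, ‖(Real.sqrt N : ℂ)⁻¹ • ZMod.dft (WithLp.ofLp f) k‖ ^ 2 = _
    simp only [norm_smul, mul_pow]
    rw [← Finset.mul_sum, h, ← mul_assoc]
    have h2 : ‖(Real.sqrt N : ℂ)⁻¹‖ ^ 2 * (N : ℝ) = 1 := by
      rw [norm_inv, Complex.norm_real, inv_pow, Real.norm_eq_abs, sq_abs,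
        Real.sq_sqrt hN.le, inv_mul_cancel₀ hN.ne']
    rw [h2, one_mul]

/-- The Fourier transformation
`ℱ f(μ, m) = (1/N) ∑_{m'} ∫ dμ' e^{(2πi/N)(μ μ' - m m')} f(μ', m')`.
It is the composition of the unitary discrete transform in `m`, of the inverse Fourier transform
`g ↦ ∫ e^{2πi x ξ} g(x) dx` of `L²(ℝ)`, and of the dilation `g ↦ N^{-1/2} g(μ / N)`. -/
def fourierU (N : ℕ) [NeZero N] : HS N ≃ₗᵢ[ℂ] HS N :=
  (dftUnitary N).trans (LinearIsometryEquiv.piLpCongrRight 2 fun _ : ZMod N =>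
    (Lp.fourierTransformₗᵢ ℝ ℂ).symm.trans
      (affineUnitary ((N : ℝ)⁻¹) (inv_pos.2 (Nat.cast_pos.2 (NeZero.pos N))) 0))

/-- The shift `𝒮 f(μ, m) = f(μ - μ₁, m - m₁)`. -/
def shiftU (N : ℕ) [NeZero N] (μ₁ : ℝ) (m₁ : ZMod N) : HS N ≃ₗᵢ[ℂ] HS N :=
  (LinearIsometryEquiv.piLpCongrLeft 2 ℂ L2R (Equiv.addRight m₁)).trans
    (LinearIsometryEquiv.piLpCongrRight 2 fun _ : ZMod N => affineUnitary 1 one_pos (-μ₁))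

/-- The multiplication operator `𝒟 f(μ, m) = e^{-(2πi/N)(μ₂ μ - m₂ m)} f(μ, m)`. -/
def phaseU (N : ℕ) [NeZero N] (μ₂ : ℝ) (m₂ : ZMod N) : HS N ≃ₗᵢ[ℂ] HS N :=
  LinearIsometryEquiv.piLpCongrRight 2 fun m : ZMod N =>
    mulUnitary
      (fun x : ℝ => exp (-(2 * Real.pi * I / N) * (μ₂ * x - (m₂.val : ℂ) * (m.val : ℂ))))
      (by fun_prop)
      (Filter.Eventually.of_forall fun x => by
        have h : -(2 * Real.pi * I / N) * (μ₂ * x - (m₂.val : ℂ) * (m.val : ℂ)) =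
            ((-(2 * Real.pi / N) * (μ₂ * x - m₂.val * m.val) : ℝ) : ℂ) * I := by
          push_cast; ring
        rw [h, Complex.norm_exp_ofReal_mul_I])

/-! ### The quantum dilogarithm as a unitary operator -/

theorem IsParam.conj_eq {b : ℂ} (hb : IsParam b) : conj b = b⁻¹ := by
  rw [Complex.inv_def, Complex.normSq_eq_norm_sq, hb.norm_eq]; simp

theorem IsParam.norm_q_lt {b : ℂ} (hb : IsParam b) (N : ℕ) [NeZero N] : ‖q N b‖ < 1 := by
  have hN : (0 : ℝ) < N := Nat.cast_pos.2 (NeZero.pos N)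
  have h : Real.pi * I / N * (1 + b ^ 2) = ((Real.pi / N : ℝ) : ℂ) * (I * (1 + b ^ 2)) := by
    push_cast; ring
  rw [q, Complex.norm_exp, Real.exp_lt_one_iff, h, Complex.re_ofReal_mul]
  have h2 : (I * (1 + b ^ 2)).re = -(2 * b.re * b.im) := by
    simp [pow_two]; ring
  rw [h2]
  have := mul_pos hb.re_pos hb.im_pos
  have := div_pos Real.pi_pos hN
  nlinarith

theorem IsParam.conj_q {b : ℂ} (hb : IsParam b) (N : ℕ) : conj (q N b) = (qt N b)⁻¹ := by
  rw [q, qt, ← Complex.exp_conj, ← Complex.exp_neg]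
  congr 1
  simp [hb.conj_eq]
  ring

theorem IsParam.conj_y {b : ℂ} (hb : IsParam b) (N : ℕ) (m : ZMod N) (x : ℝ) :
    conj (yFun N b m x) = ytFun N b m x := by
  have h2 : conj (2 : ℂ) = 2 := Complex.conj_ofNat 2
  rw [yFun, ytFun, ← Complex.exp_conj]
  congr 1
  simp [hb.conj_eq, h2]
  ring

theorem norm_yFun (N : ℕ) (b : ℂ) (m : ZMod N) (x : ℝ) :
    ‖yFun N b m x‖ = Real.exp (2 * Real.pi / N * b.re * x) := by
  have h : 2 * Real.pi * I / N * (-I * b * x - (m.val : ℂ)) =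
      ((2 * Real.pi / N : ℝ) : ℂ) * (b * x - I * ((m.val : ℝ) : ℂ)) := by
    push_cast
    linear_combination (-(2 * Real.pi / N * b * x) : ℂ) * I_sq
  rw [yFun, Complex.norm_exp, h, Complex.re_ofReal_mul]
  simp [mul_assoc]

/-- `φ(z, z̄)` has modulus one as soon as no factor of the products vanishes. -/
theorem IsParam.norm_qdilog {b : ℂ} (hb : IsParam b) (N : ℕ) [NeZero N] {z : ℂ}
    (hz : ∀ j : ℕ, 1 + q N b ^ (2 * j + 1) * z ≠ 0) : ‖qdilog N b z (conj z)‖ = 1 := by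
  have hs : Summable fun j : ℕ => ‖q N b ^ (2 * j + 1) * z‖ := by
    have h1 : ‖q N b‖ ^ 2 < 1 := pow_lt_one₀ (norm_nonneg _) (hb.norm_q_lt N) two_ne_zero
    have h2 := ((summable_geometric_of_lt_one (by positivity) h1).mul_left
      (‖q N b‖ * ‖z‖))
    refine h2.congr fun j => ?_
    rw [norm_mul, norm_pow, pow_succ _ (2 * j), pow_mul]; ring
  have hm : Multipliable fun j : ℕ => (1 + q N b ^ (2 * j + 1) * z) :=
    multipliable_one_add_of_summable hs
  have hne : (∏' j : ℕ, (1 + q N b ^ (2 * j + 1) * z)) ≠ 0 :=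
    tprod_one_add_ne_zero_of_summable hz hs
  have hc : (∏' j : ℕ, (1 + (qt N b)⁻¹ ^ (2 * j + 1) * conj z)) =
      conj (∏' j : ℕ, (1 + q N b ^ (2 * j + 1) * z)) := by
    rw [hm.map_tprod (starRingEnd ℂ) Complex.continuous_conj]
    refine tprod_congr fun j => ?_
    simp [← hb.conj_q]
  rw [qdilog, hc, norm_inv, norm_div, RCLike.norm_conj, div_self (norm_ne_zero_iff.2 hne), inv_one]

theorem conj_arg {b : ℂ} (hb : IsParam b) (N : ℕ) (c : ℂ) (σ : ℤˣ) (m : ZMod N) (x : ℝ) :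
    conj c * ytFun N b m x ^ (σ : ℤ) = conj (c * yFun N b m x ^ (σ : ℤ)) := by
  rw [map_mul, map_zpow₀, hb.conj_y]

theorem measurable_qdilog {b : ℂ} (N : ℕ) (c : ℂ) (σ : ℤˣ) (m : ZMod N) :
    Measurable fun x : ℝ =>
      qdilog N b (c * yFun N b m x ^ (σ : ℤ)) (conj c * ytFun N b m x ^ (σ : ℤ)) := by
  have h1 : Measurable fun x : ℝ => yFun N b m x ^ (σ : ℤ) := by
    have h : (fun x : ℝ => yFun N b m x ^ (σ : ℤ)) = fun x : ℝ =>
        exp (((σ : ℤ) : ℂ) * (2 * Real.pi * I / N * (-I * b * x - (m.val : ℂ)))) := by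
      funext x; rw [yFun, Complex.exp_int_mul]
    rw [h]; fun_prop
  have h2 : Measurable fun x : ℝ => ytFun N b m x ^ (σ : ℤ) := by
    have h : (fun x : ℝ => ytFun N b m x ^ (σ : ℤ)) = fun x : ℝ =>
        exp (((σ : ℤ) : ℂ) * (2 * Real.pi * I / N * (-I * b⁻¹ * x + (m.val : ℂ)))) := by
      funext x; rw [ytFun, Complex.exp_int_mul]
    rw [h]; fun_prop
  unfold qdilog
  have h3 : Measurable fun x : ℝ =>
      ∏' j : ℕ, (1 + q N b ^ (2 * j + 1) * (c * yFun N b m x ^ (σ : ℤ))) :=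
    Measurable.tprod fun j => ((h1.const_mul _).const_mul _).const_add _
  have h4 : Measurable fun x : ℝ =>
      ∏' j : ℕ, (1 + (qt N b)⁻¹ ^ (2 * j + 1) * (conj c * ytFun N b m x ^ (σ : ℤ))) :=
    Measurable.tprod fun j => ((h2.const_mul _).const_mul _).const_add _
  exact (h3.div h4).inv

theorem ae_norm_qdilog {b : ℂ} (hb : IsParam b) (N : ℕ) [NeZero N] (c : ℂ) (σ : ℤˣ)
    (m : ZMod N) : ∀ᵐ x : ℝ,
      ‖qdilog N b (c * yFun N b m x ^ (σ : ℤ)) (conj c * ytFun N b m x ^ (σ : ℤ))‖ = 1 := by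
  have hN : (0 : ℝ) < N := Nat.cast_pos.2 (NeZero.pos N)
  have hcount : (⋃ j : ℕ,
      {x : ℝ | 1 + q N b ^ (2 * j + 1) * (c * yFun N b m x ^ (σ : ℤ)) = 0}).Countable := by
    refine Set.countable_iUnion fun j => Set.Subsingleton.countable ?_
    intro x hx x' hx'
    simp only [Set.mem_ofPred_eq] at hx hx'
    have e1 : ‖q N b ^ (2 * j + 1) * (c * yFun N b m x ^ (σ : ℤ))‖ = 1 := by
      rw [eq_neg_of_add_eq_zero_right hx]; simp
    have e2 : ‖q N b ^ (2 * j + 1) * (c * yFun N b m x' ^ (σ : ℤ))‖ = 1 := by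
      rw [eq_neg_of_add_eq_zero_right hx']; simp
    rw [← mul_assoc, norm_mul] at e1 e2
    have hk : ‖q N b ^ (2 * j + 1) * c‖ ≠ 0 := by
      intro h; rw [h, zero_mul] at e1; exact zero_ne_one e1
    have e3 : ‖yFun N b m x ^ (σ : ℤ)‖ = ‖yFun N b m x' ^ (σ : ℤ)‖ :=
      mul_left_cancel₀ hk (e1.trans e2.symm)
    have e4 : ‖yFun N b m x‖ = ‖yFun N b m x'‖ := by
      rcases Int.units_eq_one_or σ with rfl | rfl
      · simpa using e3
      · simpa using e3
    rw [norm_yFun, norm_yFun, Real.exp_eq_exp] at e4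
    have hpos : 2 * Real.pi / N * b.re ≠ 0 :=
      (mul_pos (div_pos (by positivity) hN) hb.re_pos).ne'
    exact mul_left_cancel₀ hpos e4
  filter_upwards [(Set.Countable.ae_notMem hcount volume)] with x hx
  rw [conj_arg hb]
  refine hb.norm_qdilog N fun j hj => hx ?_
  exact Set.mem_iUnion.2 ⟨j, hj⟩

/-- For `σ = ±1`, the unitary operator `φ(c 𝐲^σ, c̄ 𝐲̃^σ)`: multiplication by
`φ(c y(μ,m)^σ, c̄ ỹ(μ,m)^σ)`. -/
def dilogY {b : ℂ} (hb : IsParam b) (N : ℕ) [NeZero N] (c : ℂ) (σ : ℤˣ) : HS N ≃ₗᵢ[ℂ] HS N :=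
  LinearIsometryEquiv.piLpCongrRight 2 fun m : ZMod N =>
    mulUnitary
      (fun x : ℝ =>
        qdilog N b (c * yFun N b m x ^ (σ : ℤ)) (conj c * ytFun N b m x ^ (σ : ℤ)))
      (measurable_qdilog N c σ m).aestronglyMeasurable
      (ae_norm_qdilog hb N c σ m)

/-- For `σ = ±1`, the unitary operator `φ(c 𝐮^σ, c̄ 𝐮̃^σ)`. As `ℱ` diagonalizes `𝐮` and `𝐮̃`,
`ℱ 𝐮 ℱ⁻¹ = 𝐲` and `ℱ 𝐮̃ ℱ⁻¹ = 𝐲̃`, this is `ℱ⁻¹ φ(c 𝐲^σ, c̄ 𝐲̃^σ) ℱ`. -/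
def dilogU {b : ℂ} (hb : IsParam b) (N : ℕ) [NeZero N] (c : ℂ) (σ : ℤˣ) : HS N ≃ₗᵢ[ℂ] HS N :=
  (fourierU N)⁻¹ * dilogY hb N c σ * fourierU N

/-- The unitary operator `C₁`, given by
`C₁⁻¹ = φ(e^{Y - L₂}, e^{Ỹ - L̃₂}) φ(e^{-U + L₁}, e^{-Ũ + L̃₁}) φ(e^{U + L₁}, e^{Ũ + L̃₁})⁻¹`,
where `e^{L_a} = λ_a` and `e^{L̃_a}` is the complex conjugate of `λ_a`. -/
def C₁ {b : ℂ} (hb : IsParam b) (N : ℕ) [NeZero N] (l₁ l₂ : ℂ) : HS N ≃ₗᵢ[ℂ] HS N :=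
  (dilogY hb N l₂⁻¹ 1 * (dilogU hb N l₁ (-1) * (dilogU hb N l₁ 1)⁻¹))⁻¹

/-! ### The dense space of Gaussian-type functions -/

/-- The span of the entire functions `μ ↦ μ^k e^{-α μ² + β μ}`, `Re α > 0`, `β ∈ ℂ`, `k ∈ ℕ`. -/
def gaussW : Submodule ℂ (ℂ → ℂ) :=
  Submodule.span ℂ {f | ∃ (k : ℕ) (α β : ℂ), 0 < α.re ∧
    f = fun z => z ^ k * exp (-α * z ^ 2 + β * z)}

/-- The functions `f(μ, m)` on `ℂ × ℤ/N` whose components `f(·, m)` are linear combinations of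
functions `μ^k e^{-α μ² + β μ}`, `Re α > 0`. Their restrictions to `ℝ × ℤ/N` form the space
`𝒲 ⊂ ℋ`; an element is kept here as an entire function, so that it can be evaluated at complex
arguments. -/
def W (N : ℕ) : Submodule ℂ (ZMod N → ℂ → ℂ) := Submodule.pi Set.univ fun _ => gaussW

theorem gaussW_shift {f : ℂ → ℂ} (hf : f ∈ gaussW) (t : ℂ) : (fun z => f (z + t)) ∈ gaussW := by
  induction hf using Submodule.span_induction with
  | mem f hf =>
    obtain ⟨k, α, β, hα, rfl⟩ := hf
    have h : (fun z : ℂ => (z + t) ^ k * exp (-α * (z + t) ^ 2 + β * (z + t))) =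
        ∑ i ∈ Finset.range (k + 1),
          (t ^ (k - i) * (k.choose i : ℂ) * exp (-α * t ^ 2 + β * t)) •
            fun z : ℂ => z ^ i * exp (-α * z ^ 2 + (β - 2 * α * t) * z) := by
      funext z
      have he : exp (-α * (z + t) ^ 2 + β * (z + t)) =
          exp (-α * t ^ 2 + β * t) * exp (-α * z ^ 2 + (β - 2 * α * t) * z) := by
        rw [← Complex.exp_add]; congr 1; ring
      rw [Finset.sum_apply, add_pow, Finset.sum_mul, he]
      refine Finset.sum_congr rfl fun i _ => ?_
      simp only [Pi.smul_apply, smul_eq_mul]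
      ring
    rw [h]
    exact Submodule.sum_mem _ fun i _ => Submodule.smul_mem _ _
      (Submodule.subset_span ⟨i, α, _, hα, rfl⟩)
  | zero => exact Submodule.zero_mem _
  | add f g _ _ hf hg => exact Submodule.add_mem _ hf hg
  | smul a f _ hf => exact Submodule.smul_mem _ a hf

theorem gaussW_exp {f : ℂ → ℂ} (hf : f ∈ gaussW) (s t : ℂ) :
    (fun z => exp (s * z + t) * f z) ∈ gaussW := by
  induction hf using Submodule.span_induction with
  | mem f hf =>
    obtain ⟨k, α, β, hα, rfl⟩ := hf
    have h : (fun z : ℂ => exp (s * z + t) * (z ^ k * exp (-α * z ^ 2 + β * z))) =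
        exp t • fun z : ℂ => z ^ k * exp (-α * z ^ 2 + (β + s) * z) := by
      funext z
      have he : exp (s * z + t) * exp (-α * z ^ 2 + β * z) =
          exp t * exp (-α * z ^ 2 + (β + s) * z) := by
        rw [← Complex.exp_add, ← Complex.exp_add]; congr 1; ring
      simp only [Pi.smul_apply, smul_eq_mul]
      linear_combination (z ^ k) * he
    rw [h]
    exact Submodule.smul_mem _ _ (Submodule.subset_span ⟨k, α, _, hα, rfl⟩)
  | zero =>
    convert Submodule.zero_mem gaussW using 1
    funext z; simp
  | add f g _ _ hf hg =>
    convert Submodule.add_mem _ hf hg using 1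
    funext z; simp [mul_add]
  | smul a f _ hf =>
    convert Submodule.smul_mem _ a hf using 1
    funext z; simp; ring

theorem gaussW_differentiable {f : ℂ → ℂ} (hf : f ∈ gaussW) : Differentiable ℂ f := by
  induction hf using Submodule.span_induction with
  | mem f hf => obtain ⟨k, α, β, hα, rfl⟩ := hf; fun_prop
  | zero => exact differentiable_const 0
  | add f g _ _ hf hg => exact hf.add hg
  | smul a f _ hf => exact hf.const_smul a

theorem memLp_gauss {α : ℂ} (hα : 0 < α.re) (β : ℂ) :
    MemLp (fun x : ℝ => exp (-α * (x : ℂ) ^ 2 + β * x)) 2 volume := by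
  rw [memLp_two_iff_integrable_sq_norm (by fun_prop)]
  have h := (integrable_cexp_quadratic (b := 2 * α) (by simpa using hα) (2 * β) 0).norm
  refine h.congr (Filter.Eventually.of_forall fun x => ?_)
  simp only
  rw [← norm_pow, ← Complex.exp_nat_mul]
  congr 2
  push_cast; ring

theorem memLp_gauss_pow {α : ℂ} (hα : 0 < α.re) (β : ℂ) (k : ℕ) :
    MemLp (fun x : ℝ => (x : ℂ) ^ k * exp (-α * (x : ℂ) ^ 2 + β * x)) 2 volume := by
  have h1 := ((memLp_gauss hα (β + 1)).norm.add (memLp_gauss hα (β - 1)).norm).const_mul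
    (k.factorial : ℝ)
  refine h1.mono' (by fun_prop) (Filter.Eventually.of_forall fun x => ?_)
  have e1 : ‖exp (-α * (x : ℂ) ^ 2 + (β + 1) * x)‖ =
      Real.exp x * ‖exp (-α * (x : ℂ) ^ 2 + β * x)‖ := by
    rw [← Complex.norm_exp_ofReal x, ← norm_mul, ← Complex.exp_add]
    congr 2; ring
  have e2 : ‖exp (-α * (x : ℂ) ^ 2 + (β - 1) * x)‖ =
      Real.exp (-x) * ‖exp (-α * (x : ℂ) ^ 2 + β * x)‖ := by
    rw [← Complex.norm_exp_ofReal (-x), ← norm_mul, ← Complex.exp_add]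
    congr 2; push_cast; ring
  have e3 : |x| ^ k ≤ k.factorial * (Real.exp x + Real.exp (-x)) := by
    have h2 := Real.pow_div_factorial_le_exp |x| (abs_nonneg x) k
    have h3 : Real.exp |x| ≤ Real.exp x + Real.exp (-x) := by
      rcases abs_cases x with ⟨h, _⟩ | ⟨h, _⟩ <;> rw [h] <;>
        linarith [Real.exp_pos x, Real.exp_pos (-x)]
    rw [div_le_iff₀ (by positivity)] at h2
    calc |x| ^ k ≤ Real.exp |x| * k.factorial := h2
      _ ≤ (Real.exp x + Real.exp (-x)) * k.factorial := by gcongr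
      _ = _ := by ring
  simp only [Pi.add_apply, e1, e2, norm_mul, norm_pow, Complex.norm_real, Real.norm_eq_abs]
  calc |x| ^ k * ‖exp (-α * (x : ℂ) ^ 2 + β * x)‖
      ≤ (k.factorial * (Real.exp x + Real.exp (-x))) * ‖exp (-α * (x : ℂ) ^ 2 + β * x)‖ := by
        gcongr
    _ = _ := by ring

theorem gaussW_memLp {f : ℂ → ℂ} (hf : f ∈ gaussW) : MemLp (fun x : ℝ => f x) 2 volume := by
  induction hf using Submodule.span_induction with
  | mem f hf => obtain ⟨k, α, β, hα, rfl⟩ := hf; exact memLp_gauss_pow hα β k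
  | zero => exact MemLp.zero'
  | add f g _ _ hf hg => exact hf.add hg
  | smul a f _ hf => exact hf.const_smul a

variable {N : ℕ}

theorem W_mem (f : W N) (m : ZMod N) : (f : ZMod N → ℂ → ℂ) m ∈ gaussW :=
  Submodule.mem_pi.1 f.2 m trivial

/-- Restriction to `ℝ × ℤ/N`: the embedding of `𝒲` into `ℋ`. -/
def toHS (N : ℕ) : W N →ₗ[ℂ] HS N where
  toFun f := WithLp.toLp 2 fun m =>
    (gaussW_memLp (W_mem f m)).toLp (fun x : ℝ => (f : ZMod N → ℂ → ℂ) m x)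
  map_add' _ _ := rfl
  map_smul' _ _ := rfl

/-- An entire function is determined by the class of its restriction to `ℝ`. -/
theorem toHS_injective (N : ℕ) : Function.Injective (toHS N) := by
  intro f g h
  ext m z
  have h1 : (gaussW_memLp (W_mem f m)).toLp (fun x : ℝ => (f : ZMod N → ℂ → ℂ) m x) =
      (gaussW_memLp (W_mem g m)).toLp (fun x : ℝ => (g : ZMod N → ℂ → ℂ) m x) :=
    congrFun (congrArg WithLp.ofLp h) m
  rw [MemLp.toLp_eq_toLp_iff] at h1
  have df := gaussW_differentiable (W_mem f m)
  have dg := gaussW_differentiable (W_mem g m)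
  have h2 : (fun x : ℝ => (f : ZMod N → ℂ → ℂ) m x) = fun x : ℝ => (g : ZMod N → ℂ → ℂ) m x :=
    (df.continuous.comp Complex.continuous_ofReal).ae_eq_iff_eq volume
      (dg.continuous.comp Complex.continuous_ofReal) |>.1 h1
  refine congrFun (AnalyticOnNhd.eq_of_frequently_eq (𝕜 := ℂ) (z₀ := 0)
    (fun z _ => df.analyticAt z) (fun z _ => dg.analyticAt z) ?_) z
  have ht : Filter.Tendsto (fun n : ℕ => ((1 / ((n : ℝ) + 1) : ℝ) : ℂ)) Filter.atTop
      (nhdsWithin 0 {0}ᶜ) := by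
    refine tendsto_nhdsWithin_iff.2 ⟨?_, Filter.Eventually.of_forall fun n => ?_⟩
    · have := (Complex.continuous_ofReal.tendsto 0).comp
        (tendsto_one_div_add_atTop_nhds_zero_nat (𝕜 := ℝ))
      simpa [Function.comp_def] using this
    · simp only [Set.mem_compl_iff, Set.mem_singleton_iff, Complex.ofReal_eq_zero]
      positivity
  exact ht.frequently (Filter.Frequently.of_forall fun n => congrFun h2 _)

/-! ### The representation of the quantum torus algebra -/

/-- `𝐮 f(μ, m) = f(μ + i b, m - 1)` on `𝒲`. -/
def uOp (N : ℕ) (b : ℂ) : W N ≃ₗ[ℂ] W N where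
  toFun f := ⟨fun m z => (f : ZMod N → ℂ → ℂ) (m - 1) (z + I * b),
    Submodule.mem_pi.2 fun m _ => gaussW_shift (W_mem f (m - 1)) _⟩
  invFun f := ⟨fun m z => (f : ZMod N → ℂ → ℂ) (m + 1) (z + -(I * b)),
    Submodule.mem_pi.2 fun m _ => gaussW_shift (W_mem f (m + 1)) _⟩
  map_add' _ _ := rfl
  map_smul' _ _ := rfl
  left_inv f := by ext m z; simp
  right_inv f := by ext m z; simp

theorem gaussW_y {f : ℂ → ℂ} (hf : f ∈ gaussW) (N : ℕ) (b : ℂ) (m : ZMod N) :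
    (fun z => yFun N b m z * f z) ∈ gaussW := by
  convert gaussW_exp hf (2 * Real.pi * I / N * (-I * b))
    (2 * Real.pi * I / N * (-(m.val : ℂ))) using 3
  rw [yFun]; congr 1; ring

theorem gaussW_y_inv {f : ℂ → ℂ} (hf : f ∈ gaussW) (N : ℕ) (b : ℂ) (m : ZMod N) :
    (fun z => (yFun N b m z)⁻¹ * f z) ∈ gaussW := by
  convert gaussW_exp hf (-(2 * Real.pi * I / N * (-I * b)))
    (-(2 * Real.pi * I / N * (-(m.val : ℂ)))) using 3
  rw [yFun, ← Complex.exp_neg]; congr 1; ring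

/-- `𝐲 f(μ, m) = e^{(2πi/N)(-i b μ - m)} f(μ, m)` on `𝒲`. -/
def yOp (N : ℕ) (b : ℂ) : W N ≃ₗ[ℂ] W N where
  toFun f := ⟨fun m z => yFun N b m z * (f : ZMod N → ℂ → ℂ) m z,
    Submodule.mem_pi.2 fun m _ => gaussW_y (W_mem f m) N b m⟩
  invFun f := ⟨fun m z => (yFun N b m z)⁻¹ * (f : ZMod N → ℂ → ℂ) m z,
    Submodule.mem_pi.2 fun m _ => gaussW_y_inv (W_mem f m) N b m⟩
  map_add' f g := by ext m z; simp [mul_add]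
  map_smul' c f := by ext m z; simp; ring
  left_inv f := by ext m z; simp [yFun, Complex.exp_ne_zero]
  right_inv f := by ext m z; simp [yFun, Complex.exp_ne_zero]

/-- `e^{αU + βY} = q^{-αβ} 𝐮^α 𝐲^β` on `𝒲`, for `α, β ∈ ℤ`. -/
def torusOp (N : ℕ) (b : ℂ) (α β : ℤ) : Module.End ℂ (W N) :=
  q N b ^ (-(α * β)) • ((uOp N b ^ α * yOp N b ^ β : W N ≃ₗ[ℂ] W N) : W N →ₗ[ℂ] W N)

/-- `Q₁' = e^{Y - U} + e^{-Y + U} + e^{-Y} Q₁ + e^{-U} Q₂ + e^{-U - Y}` on `𝒲`, where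
`Q_a = λ_a + λ_a⁻¹`. -/
def Q₁' (N : ℕ) (b l₁ l₂ : ℂ) : Module.End ℂ (W N) :=
  torusOp N b (-1) 1 + torusOp N b 1 (-1) + (l₁ + l₁⁻¹) • torusOp N b 0 (-1) +
    (l₂ + l₂⁻¹) • torusOp N b (-1) 0 + torusOp N b (-1) (-1)

/-- `Q₁'' = e^{-U + L₂} + e^{U - L₂} + e^{-Y - L₁}` on `𝒲`, where `e^{L_a} = λ_a`. -/
def Q₁'' (N : ℕ) (b l₁ l₂ : ℂ) : Module.End ℂ (W N) :=
  l₂ • torusOp N b (-1) 0 + l₂⁻¹ • torusOp N b 1 0 + l₁⁻¹ • torusOp N b 0 (-1)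

/-- `L = 𝐲⁻¹ + 𝐲 + 𝐮` on `𝒲`. -/
def LOp (N : ℕ) (b : ℂ) : Module.End ℂ (W N) :=
  torusOp N b 0 (-1) + torusOp N b 0 1 + torusOp N b 1 0

/-! ### Unbounded operators on `ℋ` -/

/-- An operator on `𝒲`, as a densely defined operator in `ℋ` with domain `𝒲`. -/
def toPMap [NeZero N] (A : Module.End ℂ (W N)) : HS N →ₗ.[ℂ] HS N where
  domain := LinearMap.range (toHS N)
  toFun := toHS N ∘ₗ A ∘ₗ (LinearEquiv.ofInjective (toHS N) (toHS_injective N)).symm.toLinearMap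

/-- The conjugate `V T V⁻¹` of an unbounded operator `T` by a unitary operator `V`, with domain
`V (dom T)`. -/
def conjPMap [NeZero N] (V : HS N ≃ₗᵢ[ℂ] HS N) (T : HS N →ₗ.[ℂ] HS N) : HS N →ₗ.[ℂ] HS N where
  domain := T.domain.comap (V.symm.toLinearEquiv : HS N →ₗ[ℂ] HS N)
  toFun := (V.toLinearEquiv : HS N →ₗ[ℂ] HS N) ∘ₗ T.toFun ∘ₗ
    (V.symm.toLinearEquiv : HS N →ₗ[ℂ] HS N).restrict (fun _ hx => hx)

end LevelN

end

open LevelN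

namespace LevelN

open scoped FourierTransform

/-! ### Gaussian bounds and shifts of contours -/

/-! Every claimed identity is an equality of closed graphs in `HS N × HS N`, and equality of graphs
contains equality of domains. `Conjugates V A B` records it; it composes and inverts, so each part
reduces to a chain of elementary conjugations. Closability is independent of the chain: since |b| =
1, the conjugate of y on the real line is the exponential ỹ, so y, its inverse and, through ℱ, u and
its inverse have formal adjoints on the dense space 𝒲 (`HasFormalAdjoint.isClosable`).

Shifts, phases and ℱ restrict to automorphisms of 𝒲. Their conjugations are algebra on 𝒲
(`LiftsTo.conjugates`), and part (2) needs nothing else.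

Part (1) splits as follows. ℱ turns Q₁'' into λ₂y⁻¹ + λ₂⁻¹y + λ₁⁻¹u. Two dilogarithms in y and y⁻¹
multiply the coefficient of u by (1 + qλ₁y)(1 + q⁻¹λ₁y⁻¹), giving λ₁ + λ₁⁻¹ + qy + q⁻¹y⁻¹. After ℱ⁻¹
a third dilogarithm takes a factor away from the forward shift and gives one to the backward shift,
which produces Q₁'. Formally all this is the functional equation φ(q²y) = (1 + qy)φ(y).

The analytic difficulty is that φ does not preserve 𝒲. To place (Vf, VAf) in the closed graph of B,
take a functional (v, w) annihilating the graph of B on 𝒲. By Fourier inversion, a function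
holomorphic with Gaussian decay in a strip wider than the shifts is a superposition of Gaussians, so
(v, w) annihilates its pair too (`HasCoeffs.annihilates_strip`). Apply this to Φ(z + iδ)f(z), Φ
being the holomorphic continuation of φ, and let δ → 0. The backward shift reaches the line Im z =
-Re b, where Φ may have poles; there the coefficient of B has a factor with simple zeros that keeps
the integrand dominated (`HalfPlaneMult.mem_graphCl`). The inverse operator is treated in the
conjugate half plane.

What remains is that φ((-1)^N y) has such a continuation. The zeros of its denominator with Im z >
-Re b cancel against the numerator (`dilogNum_eq_zero`), and it grows at most exponentially on
horizontal strips because its two functional equations combine to a real translation by 2 Im b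
(`halfPlaneMult_dilogFun`). -/

theorem exp_linear_sub_sq_le {ε : ℝ} (hε : 0 < ε) (K x : ℝ) :
    Real.exp (K * |x|) * Real.exp (-ε * x ^ 2) ≤
      Real.exp (K ^ 2 / (2 * ε)) * Real.exp (-(ε / 2) * x ^ 2) := by
  rw [← Real.exp_add, ← Real.exp_add, Real.exp_le_exp]
  have h : K ^ 2 / (2 * ε) + -(ε / 2) * x ^ 2 - (K * |x| + -ε * x ^ 2) =
      (K - ε * |x|) ^ 2 / (2 * ε) := by
    rw [← sq_abs x]; field_simp; ring
  have : 0 ≤ (K - ε * |x|) ^ 2 / (2 * ε) := by positivity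
  linarith

/-- `f` is bounded by `C e^{-ε (Re z)²}` on every horizontal strip. -/
def GaussBound (f : ℂ → ℂ) : Prop :=
  ∀ R : ℝ, ∃ C ε : ℝ, 0 ≤ C ∧ 0 < ε ∧
    ∀ z : ℂ, |z.im| ≤ R → ‖f z‖ ≤ C * Real.exp (-ε * z.re ^ 2)

theorem gaussBound_monomial (k : ℕ) {α : ℂ} (hα : 0 < α.re) (β : ℂ) :
    GaussBound fun z => z ^ k * exp (-α * z ^ 2 + β * z) := by
  intro R
  -- `K` is the total linear rate in |Re z|: the cross term of αz², the term βz, and 1 from |z|^k ≤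
  -- k! e^{|z|}. Half of Re α is then spent on absorbing it.
  set K := 2 * |α.im| * |R| + |β.re| + 1 with hK
  refine ⟨k.factorial * Real.exp |R| * Real.exp (α.re * R ^ 2 + |β.im| * |R|) *
    Real.exp (K ^ 2 / (2 * α.re)), α.re / 2, by positivity, by positivity, fun z hz => ?_⟩
  have hz' : |z.im| ≤ |R| := hz.trans (le_abs_self R)
  have h1 : ‖z‖ ^ k ≤ k.factorial * (Real.exp |R| * Real.exp |z.re|) := by
    have h2 := Real.pow_div_factorial_le_exp ‖z‖ (norm_nonneg _) k
    rw [div_le_iff₀ (by positivity)] at h2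
    have h3 : ‖z‖ ≤ |R| + |z.re| := (norm_le_abs_re_add_abs_im z).trans (by linarith)
    calc ‖z‖ ^ k ≤ Real.exp ‖z‖ * k.factorial := h2
      _ ≤ Real.exp (|R| + |z.re|) * k.factorial := by gcongr
      _ = _ := by rw [Real.exp_add]; ring
  have h4 : (-α * z ^ 2 + β * z).re ≤ -α.re * z.re ^ 2 + (2 * |α.im| * |R| + |β.re|) * |z.re| +
      (α.re * R ^ 2 + |β.im| * |R|) := by
    have e : (-α * z ^ 2 + β * z).re = -α.re * z.re ^ 2 + α.re * z.im ^ 2 +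
        2 * (α.im * z.im * z.re) + β.re * z.re - β.im * z.im := by
      simp [pow_two]; ring
    have i1 : α.im * z.im * z.re ≤ |α.im| * |R| * |z.re| := by
      refine (le_abs_self _).trans ?_
      rw [abs_mul, abs_mul]; gcongr
    have i2 : β.re * z.re ≤ |β.re| * |z.re| := by rw [← abs_mul]; exact le_abs_self _
    have i3 : -(β.im * z.im) ≤ |β.im| * |R| := by
      refine (neg_le_abs _).trans ?_
      rw [abs_mul]; gcongr
    have i4 : α.re * z.im ^ 2 ≤ α.re * R ^ 2 := by
      have : z.im ^ 2 ≤ R ^ 2 := sq_le_sq.2 hz'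
      gcongr
    rw [e]; nlinarith
  rw [norm_mul, norm_pow, Complex.norm_exp]
  calc ‖z‖ ^ k * Real.exp (-α * z ^ 2 + β * z).re
      ≤ (k.factorial * (Real.exp |R| * Real.exp |z.re|)) *
        Real.exp (-α.re * z.re ^ 2 + (2 * |α.im| * |R| + |β.re|) * |z.re| +
          (α.re * R ^ 2 + |β.im| * |R|)) := by
        gcongr
    _ = k.factorial * Real.exp |R| * Real.exp (α.re * R ^ 2 + |β.im| * |R|) *
        (Real.exp (K * |z.re|) * Real.exp (-α.re * z.re ^ 2)) := by
        have : K * |z.re| = |z.re| + (2 * |α.im| * |R| + |β.re|) * |z.re| := by rw [hK]; ring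
        rw [this]
        simp only [Real.exp_add]; ring
    _ ≤ k.factorial * Real.exp |R| * Real.exp (α.re * R ^ 2 + |β.im| * |R|) *
        (Real.exp (K ^ 2 / (2 * α.re)) * Real.exp (-(α.re / 2) * z.re ^ 2)) := by
        gcongr ?_ * ?_
        exact exp_linear_sub_sq_le hα K z.re
    _ = _ := by ring

theorem gaussW_bound {f : ℂ → ℂ} (hf : f ∈ gaussW) : GaussBound f := by
  induction hf using Submodule.span_induction with
  | mem f hf => obtain ⟨k, α, β, hα, rfl⟩ := hf; exact gaussBound_monomial k hα β
  | zero => exact fun R => ⟨0, 1, le_rfl, one_pos, fun z _ => by simp⟩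
  | add f g _ _ hf hg =>
    intro R
    obtain ⟨C, ε, hC, hε, h⟩ := hf R
    obtain ⟨C', ε', hC', hε', h'⟩ := hg R
    refine ⟨C + C', min ε ε', by positivity, lt_min hε hε', fun z hz => ?_⟩
    calc ‖f z + g z‖ ≤ C * Real.exp (-ε * z.re ^ 2) + C' * Real.exp (-ε' * z.re ^ 2) :=
          (norm_add_le _ _).trans (add_le_add (h z hz) (h' z hz))
      _ ≤ C * Real.exp (-min ε ε' * z.re ^ 2) + C' * Real.exp (-min ε ε' * z.re ^ 2) := by
          gcongr <;> simp
      _ = _ := by ring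
  | smul a f _ hf =>
    intro R
    obtain ⟨C, ε, hC, hε, h⟩ := hf R
    refine ⟨‖a‖ * C, ε, by positivity, hε, fun z hz => ?_⟩
    rw [Pi.smul_apply, norm_smul, mul_assoc]
    gcongr
    exact h z hz

/-- An exponential factor does not destroy Gaussian decay. -/
theorem exists_gauss_bound_of_exp {ε : ℝ} (hε : 0 < ε) {C C' K : ℝ} (hC : 0 ≤ C)
    (hC' : 0 ≤ C') : ∃ D ε' : ℝ, 0 ≤ D ∧ 0 < ε' ∧ ∀ x : ℝ,
      C' * Real.exp (K * |x|) * (C * Real.exp (-ε * x ^ 2)) ≤ D * Real.exp (-ε' * x ^ 2) := by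
  refine ⟨C' * C * Real.exp (K ^ 2 / (2 * ε)), ε / 2, by positivity, by positivity, fun x => ?_⟩
  calc _ = C' * C * (Real.exp (K * |x|) * Real.exp (-ε * x ^ 2)) := by ring
    _ ≤ C' * C * (Real.exp (K ^ 2 / (2 * ε)) * Real.exp (-(ε / 2) * x ^ 2)) := by
      gcongr ?_ * ?_
      exact exp_linear_sub_sq_le hε K x
    _ = _ := by ring

section Strip

variable {R C ε : ℝ} {g : ℂ → ℂ}

theorem strip_line_continuous (hd : DifferentiableOn ℂ g {z | |z.im| < R}) {β : ℂ}
    (hβ : |β.im| < R) : Continuous fun x : ℝ => g (x + β) := by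
  refine hd.continuousOn.comp_continuous (by fun_prop) fun x => ?_
  simpa using hβ

theorem strip_line_integrable (hε : 0 < ε) (hd : DifferentiableOn ℂ g {z | |z.im| < R})
    (hb : ∀ z : ℂ, |z.im| < R → ‖g z‖ ≤ C * Real.exp (-ε * z.re ^ 2)) {β : ℂ}
    (hβ : |β.im| < R) : Integrable fun x : ℝ => g (x + β) := by
  have h := ((integrable_exp_neg_mul_sq hε).comp_add_right β.re).const_mul C
  refine h.mono' (strip_line_continuous hd hβ).aestronglyMeasurable
    (Filter.Eventually.of_forall fun x => ?_)
  simpa using hb (x + β) (by simpa using hβ)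

/-- Shift of the contour of integration inside a strip. -/
theorem integral_strip_shift (hε : 0 < ε) (hd : DifferentiableOn ℂ g {z | |z.im| < R})
    (hb : ∀ z : ℂ, |z.im| < R → ‖g z‖ ≤ C * Real.exp (-ε * z.re ^ 2)) {β : ℂ}
    (hβ : |β.im| < R) : ∫ x : ℝ, g (x + β) = ∫ x : ℝ, g x := by
  have hR : 0 < R := (abs_nonneg _).trans_lt hβ
  have h0 : |((β.im : ℂ) * I).im| < R := by simpa using hβ
  have e1 : ∫ x : ℝ, g (x + β) = ∫ x : ℝ, g (x + β.im * I) := by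
    -- The real part of β is removed by translation invariance, so only a vertical shift needs
    -- Cauchy's theorem.
    rw [← integral_add_right_eq_self (fun x : ℝ => g (x + β.im * I)) β.re]
    congr 1; ext x; congr 1
    push_cast
    conv_lhs => rw [← re_add_im β]
    ring
  rw [e1]
  have i1 : Integrable fun x : ℝ => g (x + β.im * I) := strip_line_integrable hε hd hb h0
  have i0 : Integrable fun x : ℝ => g x := by
    simpa using strip_line_integrable hε hd hb (β := 0) (by simpa using hR)
  have hT : ∀ T : ℝ, (∫ x : ℝ in (-T)..T, g x) - (∫ x : ℝ in (-T)..T, g (x + β.im * I)) =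
      -(I • ∫ y : ℝ in (0:ℝ)..β.im, g (T + y * I)) +
        I • ∫ y : ℝ in (0:ℝ)..β.im, g ((-T : ℝ) + y * I) := by
    intro T
    have h := integral_boundary_rect_eq_zero_of_differentiableOn g ((-T : ℝ) : ℂ)
      ((T : ℂ) + β.im * I) (hd.mono ?_)
    · simp only [ofReal_re, ofReal_im, add_re, add_im, mul_re, mul_im, I_re, I_im, mul_zero,
        mul_one, sub_self, add_zero, zero_add, ofReal_zero, zero_mul] at h
      linear_combination h
    · intro z hz
      have h2 := hz.2
      simp only [Set.mem_preimage, ofReal_im, add_im, mul_im, ofReal_re, I_im, I_re, mul_one,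
        mul_zero, add_zero, zero_add] at h2
      have : |z.im - 0| ≤ |β.im - 0| := Set.abs_sub_left_of_mem_uIcc h2
      simp only [sub_zero] at this
      exact this.trans_lt hβ
  -- Both vertical sides at once: the Gaussian bound sees only s² = 1, and it makes them vanish as T
  -- → ∞.
  have hside : ∀ s : ℝ, s = 1 ∨ s = -1 → Filter.Tendsto
      (fun T : ℝ => ∫ y : ℝ in (0:ℝ)..β.im, g ((s * T : ℝ) + y * I)) Filter.atTop (nhds 0) := by
    intro s hs
    have hs2 : s ^ 2 = 1 := by rcases hs with rfl | rfl <;> norm_num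
    have hlim : Filter.Tendsto (fun T : ℝ => C * Real.exp (-ε * T ^ 2) * |β.im - 0|)
        Filter.atTop (nhds 0) := by
      have h1 : Filter.Tendsto (fun T : ℝ => Real.exp (-ε * T ^ 2)) Filter.atTop (nhds 0) := by
        refine Real.tendsto_exp_atBot.comp ?_
        exact (Filter.tendsto_pow_atTop two_ne_zero).const_mul_atTop_of_neg (by linarith)
      simpa using (h1.const_mul C).mul_const |β.im - 0|
    refine squeeze_zero_norm (fun T => ?_) hlim
    refine intervalIntegral.norm_integral_le_of_norm_le_const fun y hy => ?_
    have hy' : |y - 0| ≤ |β.im - 0| :=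
      Set.abs_sub_left_of_mem_uIcc (Set.uIoc_subset_uIcc hy)
    simp only [sub_zero] at hy'
    have := hb ((s * T : ℝ) + y * I) (by simpa using hy'.trans_lt hβ)
    simpa [mul_pow, hs2] using this
  have t0 := intervalIntegral_tendsto_integral i0 Filter.tendsto_neg_atTop_atBot Filter.tendsto_id
  have t1 := intervalIntegral_tendsto_integral i1 Filter.tendsto_neg_atTop_atBot Filter.tendsto_id
  have t2 := t0.sub t1
  have t3 := ((hside 1 (Or.inl rfl)).const_smul I).neg.add ((hside (-1) (Or.inr rfl)).const_smul I)
  simp only [one_mul, neg_mul, id_eq] at t2 t3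
  have := tendsto_nhds_unique (t2.congr fun T => hT T) t3
  simp only [smul_zero, neg_zero, add_zero] at this
  exact (sub_eq_zero.1 this).symm

end Strip

/-- The test function `z ↦ e^{-α z² + 2πi ξ z}`. -/
noncomputable def gaussTest (α ξ : ℝ) (z : ℂ) : ℂ :=
  exp (-(α : ℂ) * z ^ 2 + 2 * Real.pi * I * ξ * z)

theorem gaussTest_mem {α : ℝ} (hα : 0 < α) (ξ : ℝ) : gaussTest α ξ ∈ gaussW :=
  Submodule.subset_span ⟨0, α, 2 * Real.pi * I * ξ, by simpa using hα, by
    funext z; simp [gaussTest]⟩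

end LevelN

/-! ### Fourier inversion for functions holomorphic in a strip. -/

namespace LevelN

open scoped FourierTransform

theorem integrable_exp_neg_mul_abs {c : ℝ} (hc : 0 < c) :
    Integrable fun x : ℝ => Real.exp (-c * |x|) := by
  refine (integrable_inv_one_add_sq.const_mul (1 + 2 / c ^ 2)).mono' (by fun_prop)
    (Filter.Eventually.of_forall fun x => ?_)
  have h := Real.quadratic_le_exp_of_nonneg (x := c * |x|) (by positivity)
  have h1 : 1 + x ^ 2 ≤ (1 + 2 / c ^ 2) * Real.exp (c * |x|) := by
    have e : (1 + 2 / c ^ 2) * (1 + c * |x| + (c * |x|) ^ 2 / 2) =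
        1 + x ^ 2 + (c * |x| + c ^ 2 * x ^ 2 / 2 + 2 / c ^ 2 + 2 * |x| / c) := by
      rw [← sq_abs x]; field_simp; ring
    have h2 : 0 ≤ c * |x| + c ^ 2 * x ^ 2 / 2 + 2 / c ^ 2 + 2 * |x| / c := by positivity
    have h3 := mul_le_mul_of_nonneg_left h (by positivity : (0:ℝ) ≤ 1 + 2 / c ^ 2)
    linarith
  rw [Real.norm_eq_abs, Real.abs_exp, neg_mul, Real.exp_neg, ← div_eq_mul_inv,
    le_div_iff₀ (by positivity), inv_mul_le_iff₀ (by positivity)]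
  linarith

section Strip

variable {R C ε : ℝ} {k : ℂ → ℂ}

theorem norm_fourierPhase (z : ℂ) (ξ : ℝ) :
    ‖exp (-(2 * Real.pi * I * ξ * z))‖ = Real.exp (2 * Real.pi * ξ * z.im) := by
  rw [Complex.norm_exp]; congr 1
  simp

/-- A contour shift of e^{-2πiξz} k(z). For fixed ξ the phase is bounded on the strip by e^{2π|ξ|R},
so the Gaussian decay survives. -/
theorem fourier_strip_shift (hε : 0 < ε) (hd : DifferentiableOn ℂ k {z | |z.im| < R})
    (hb : ∀ z : ℂ, |z.im| < R → ‖k z‖ ≤ C * Real.exp (-ε * z.re ^ 2)) {β : ℂ}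
    (hβ : |β.im| < R) (ξ : ℝ) :
    𝓕 (fun x : ℝ => k (x + β)) ξ =
      exp (2 * Real.pi * I * ξ * β) * 𝓕 (fun x : ℝ => k x) ξ := by
  have h := integral_strip_shift (g := fun z => exp (-(2 * Real.pi * I * ξ * z)) * k z)
    (C := Real.exp (2 * Real.pi * |ξ| * R) * C) hε
    (DifferentiableOn.mul (by fun_prop) hd) (fun z hz => ?_) hβ
  · rw [Real.fourier_real_eq_integral_exp_smul, Real.fourier_real_eq_integral_exp_smul]
    have e1 : ∀ x : ℝ, exp (↑(-2 * Real.pi * x * ξ) * I) • k (x + β) =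
        exp (2 * Real.pi * I * ξ * β) *
          (exp (-(2 * Real.pi * I * ξ * (x + β))) * k (x + β)) := by
      intro x
      rw [← mul_assoc, ← Complex.exp_add, smul_eq_mul]
      congr 2; push_cast; ring
    have e2 : ∀ x : ℝ, exp (↑(-2 * Real.pi * x * ξ) * I) • k x =
        exp (-(2 * Real.pi * I * ξ * x)) * k x := by
      intro x
      rw [smul_eq_mul]
      congr 2; push_cast; ring
    simp_rw [e1, e2, integral_const_mul, h]
  · rw [norm_mul, norm_fourierPhase, mul_assoc (Real.exp (2 * Real.pi * |ξ| * R))]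
    gcongr ?_ * ?_
    · rw [Real.exp_le_exp]
      calc 2 * Real.pi * ξ * z.im ≤ |2 * Real.pi * ξ * z.im| := le_abs_self _
        _ = 2 * Real.pi * |ξ| * |z.im| := by
          rw [abs_mul, abs_mul, abs_of_pos (by positivity : 0 < 2 * Real.pi)]
        _ ≤ _ := by gcongr
    · exact hb z hz

/-- A Paley–Wiener estimate: the contour is moved to height r or -r, according to the sign of ξ, so
that the phase gains e^{-2πr|ξ|}. -/
theorem norm_fourier_strip_le (hε : 0 < ε) (hd : DifferentiableOn ℂ k {z | |z.im| < R})
    (hC : 0 ≤ C) (hb : ∀ z : ℂ, |z.im| < R → ‖k z‖ ≤ C * Real.exp (-ε * z.re ^ 2)) {r : ℝ}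
    (hr0 : 0 ≤ r) (hr : r < R) :
    ∃ M, 0 ≤ M ∧ ∀ ξ : ℝ, ‖𝓕 (fun x : ℝ => k x) ξ‖ ≤ M * Real.exp (-(2 * Real.pi * r) * |ξ|) := by
  refine ⟨∫ x : ℝ, C * Real.exp (-ε * x ^ 2), integral_nonneg fun x => by positivity,
    fun ξ => ?_⟩
  have key : ∀ s : ℝ, |s| = r → Real.exp (-(2 * Real.pi * ξ * s)) *
      ‖𝓕 (fun x : ℝ => k x) ξ‖ ≤ ∫ x : ℝ, C * Real.exp (-ε * x ^ 2) := by
    intro s hs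
    have hsR : |((s : ℂ) * I).im| < R := by simpa [hs] using hr
    have h1 := fourier_strip_shift hε hd hb hsR ξ
    have h2 : ‖exp (2 * Real.pi * I * ξ * (s * I))‖ = Real.exp (-(2 * Real.pi * ξ * s)) := by
      rw [Complex.norm_exp]; congr 1; simp
    rw [← h2, ← norm_mul, ← h1]
    refine (VectorFourier.norm_fourierIntegral_le_integral_norm _ _ _ _ _).trans ?_
    refine integral_mono_of_nonneg (Filter.Eventually.of_forall fun x => norm_nonneg _)
      ((integrable_exp_neg_mul_sq hε).const_mul C) (Filter.Eventually.of_forall fun x => ?_)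
    simpa using hb (x + s * I) (by simpa [hs] using hr)
  have : ∃ s : ℝ, |s| = r ∧ ξ * s = -(r * |ξ|) := by
    rcases abs_cases ξ with ⟨h, _⟩ | ⟨h, _⟩
    · exact ⟨-r, by rw [abs_neg, abs_of_nonneg hr0], by rw [h]; ring⟩
    · exact ⟨r, abs_of_nonneg hr0, by rw [h]; ring⟩
  obtain ⟨s, hs, hξ⟩ := this
  have h3 := key s hs
  rw [mul_assoc, hξ] at h3
  have h4 : Real.exp (-(2 * Real.pi * -(r * |ξ|))) = (Real.exp (-(2 * Real.pi * r) * |ξ|))⁻¹ := by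
    rw [← Real.exp_neg]; congr 1; ring
  rw [h4, inv_mul_le_iff₀ (Real.exp_pos _)] at h3
  linarith

theorem fourier_strip_integrable (hε : 0 < ε) (hd : DifferentiableOn ℂ k {z | |z.im| < R})
    (hC : 0 ≤ C) (hb : ∀ z : ℂ, |z.im| < R → ‖k z‖ ≤ C * Real.exp (-ε * z.re ^ 2)) {β : ℂ}
    (hβ : |β.im| < R) :
    Integrable fun ξ : ℝ => exp (2 * Real.pi * I * ξ * β) * 𝓕 (fun x : ℝ => k x) ξ := by
  -- Decay at a rate r strictly between |Im β| and R beats the growth of e^{2πiξβ}, with margin r -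
  -- |Im β|.
  obtain ⟨r, hr1, hr2⟩ := exists_between hβ
  obtain ⟨M, hM, h⟩ := norm_fourier_strip_le hε hd hC hb ((abs_nonneg _).trans hr1.le) hr2
  have hR : |(0 : ℂ).im| < R := by simpa using (abs_nonneg _).trans_lt hβ
  have hi : Integrable fun x : ℝ => k x := by
    simpa using strip_line_integrable hε hd hb hR
  have hcont : Continuous (𝓕 fun x : ℝ => k x) := VectorFourier.fourierIntegral_continuous
    Real.continuous_fourierChar (by exact continuous_inner) hi
  refine ((integrable_exp_neg_mul_abs (c := 2 * Real.pi * (r - |β.im|))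
    (mul_pos (by positivity) (by linarith))).const_mul M).mono'
    (Continuous.aestronglyMeasurable (by fun_prop)) (Filter.Eventually.of_forall fun ξ => ?_)
  rw [norm_mul]
  have h2 : ‖exp (2 * Real.pi * I * ξ * β)‖ ≤ Real.exp (2 * Real.pi * |β.im| * |ξ|) := by
    rw [Complex.norm_exp, Real.exp_le_exp]
    have : (2 * Real.pi * I * ξ * β).re = 2 * Real.pi * (-(β.im * ξ)) := by simp; ring
    rw [this, mul_assoc (2 * Real.pi)]
    refine mul_le_mul_of_nonneg_left ?_ (by positivity)
    rw [← abs_mul]; exact neg_le_abs _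
  calc _ ≤ Real.exp (2 * Real.pi * |β.im| * |ξ|) *
        (M * Real.exp (-(2 * Real.pi * r) * |ξ|)) := by gcongr; exact h ξ
    _ = M * (Real.exp (2 * Real.pi * |β.im| * |ξ|) * Real.exp (-(2 * Real.pi * r) * |ξ|)) := by
      ring
    _ = _ := by rw [← Real.exp_add]; congr 2; ring

/-- A function which is holomorphic with Gaussian decay in a strip is a superposition of the
Gaussian test functions, compatibly with complex translations inside the strip. -/
theorem integral_mul_strip {α : ℝ} (hα : 0 < α) (hαε : α < ε) {h : ℂ → ℂ}
    (hd : DifferentiableOn ℂ h {z | |z.im| < R}) (hC : 0 ≤ C)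
    (hb : ∀ z : ℂ, |z.im| < R → ‖h z‖ ≤ C * Real.exp (-ε * z.re ^ 2)) {β : ℂ}
    (hβ : |β.im| < R) {G : ℝ → ℂ}
    (hG : ∀ a : ℝ, 0 < a → Integrable fun x : ℝ => G x * (Real.exp (-a * x ^ 2) : ℂ)) :
    (Integrable fun ξ : ℝ => 𝓕 (fun x : ℝ => exp (α * (x : ℂ) ^ 2) * h x) ξ *
      ∫ x : ℝ, G x * gaussTest α ξ (x + β)) ∧
    ∫ x : ℝ, G x * h (x + β) = ∫ ξ : ℝ, 𝓕 (fun x : ℝ => exp (α * (x : ℂ) ^ 2) * h x) ξ *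
      ∫ x : ℝ, G x * gaussTest α ξ (x + β) := by
  -- Dividing the Gaussian e^{-αz²} out of h leaves decay ε - α > 0. Fourier inversion of k,
  -- multiplied back by e^{-αz²}, is the superposition of `gaussTest α ξ`.
  set k : ℂ → ℂ := fun z => exp (α * z ^ 2) * h z with hk
  have hε' : 0 < ε - α := by linarith
  have kd : DifferentiableOn ℂ k {z | |z.im| < R} := DifferentiableOn.mul (by fun_prop) hd
  have kb : ∀ z : ℂ, |z.im| < R → ‖k z‖ ≤ C * Real.exp (-(ε - α) * z.re ^ 2) := by
    intro z hz
    have h1 : ‖exp (α * z ^ 2)‖ ≤ Real.exp (α * z.re ^ 2) := by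
      rw [Complex.norm_exp, Real.exp_le_exp, Complex.re_ofReal_mul]
      gcongr
      simp only [pow_two, mul_re]
      nlinarith [mul_self_nonneg z.im]
    calc ‖k z‖ ≤ Real.exp (α * z.re ^ 2) * (C * Real.exp (-ε * z.re ^ 2)) := by
          rw [hk, norm_mul]; gcongr; exact hb z hz
      _ = C * (Real.exp (α * z.re ^ 2) * Real.exp (-ε * z.re ^ 2)) := by ring
      _ = _ := by rw [← Real.exp_add]; congr 2; ring
  have inv : ∀ x : ℝ, k (x + β) = ∫ ξ : ℝ, exp (2 * Real.pi * I * ξ * x) *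
      (exp (2 * Real.pi * I * ξ * β) * 𝓕 (fun x : ℝ => k x) ξ) := by
    intro x
    have hF : 𝓕 (fun x : ℝ => k (x + β)) = fun ξ : ℝ =>
        exp (2 * Real.pi * I * ξ * β) * 𝓕 (fun x : ℝ => k x) ξ :=
      funext fun ξ => fourier_strip_shift hε' kd kb hβ ξ
    have h1 := Continuous.fourierInv_fourier_eq (strip_line_continuous kd hβ)
      (strip_line_integrable hε' kd kb hβ)
      (by rw [hF]; exact fourier_strip_integrable hε' kd hC kb hβ)
    have h2 := congrFun h1 x
    rw [hF, Real.fourierInv_eq'] at h2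
    rw [← h2]
    congr 1; ext ξ
    rw [smul_eq_mul]
    congr 2
    simp [mul_comm]; ring
  set g : ℝ → ℂ := fun x => G x * exp (-(α : ℂ) * (x + β) ^ 2) with hg
  have gi : Integrable g := by
    -- G is only assumed integrable against real centred Gaussians. Half of α supplies one of them;
    -- the other half keeps the remaining factor, which involves β, bounded.
    have h1 := (hG (α / 2) (by positivity)).mul_bdd
      (g := fun x : ℝ => exp (-(α : ℂ) * (x + β) ^ 2 + (α / 2 : ℝ) * (x : ℂ) ^ 2))
      (c := Real.exp (α * β.im ^ 2 + α * β.re ^ 2))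
      (Continuous.aestronglyMeasurable (by fun_prop)) (Filter.Eventually.of_forall fun x => ?_)
    · refine h1.congr (Filter.Eventually.of_forall fun x => ?_)
      simp only [hg]
      rw [mul_assoc, Complex.ofReal_exp, ← Complex.exp_add]
      congr 2; push_cast; ring
    · rw [Complex.norm_exp, Real.exp_le_exp]
      have e : (-(α : ℂ) * (x + β) ^ 2 + (α / 2 : ℝ) * (x : ℂ) ^ 2).re =
          α * β.im ^ 2 + α * β.re ^ 2 - α / 2 * (x + 2 * β.re) ^ 2 := by
        rw [add_re, neg_mul, neg_re, Complex.re_ofReal_mul, Complex.re_ofReal_mul]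
        simp [pow_two]; ring
      rw [e]
      have : 0 ≤ α / 2 * (x + 2 * β.re) ^ 2 := by positivity
      linarith
  have fi := fourier_strip_integrable hε' kd hC kb hβ
  -- Fubini: up to a phase of modulus one the integrand is a product of integrable functions of x
  -- and of ξ.
  have pi : Integrable (fun p : ℝ × ℝ => exp (2 * Real.pi * I * p.2 * p.1) *
      (g p.1 * (exp (2 * Real.pi * I * p.2 * β) * 𝓕 (fun x : ℝ => k x) p.2))) := by
    refine (gi.mul_prod fi).bdd_mul (c := 1)
      (Continuous.aestronglyMeasurable (by fun_prop)) (Filter.Eventually.of_forall fun p => ?_)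
    have : 2 * Real.pi * I * p.2 * p.1 = ((2 * Real.pi * p.2 * p.1 : ℝ) : ℂ) * I := by
      push_cast; ring
    rw [this, Complex.norm_exp_ofReal_mul_I]
  have inner_eq : ∀ ξ : ℝ, 𝓕 (fun x : ℝ => k x) ξ * ∫ x : ℝ, G x * gaussTest α ξ (x + β) =
      ∫ x : ℝ, exp (2 * Real.pi * I * ξ * x) *
      (g x * (exp (2 * Real.pi * I * ξ * β) * 𝓕 (fun x : ℝ => k x) ξ)) := by
    intro ξ
    rw [← integral_const_mul]
    congr 1; ext x
    have : gaussTest α ξ (x + β) = exp (-(α : ℂ) * (x + β) ^ 2) *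
        (exp (2 * Real.pi * I * ξ * x) * exp (2 * Real.pi * I * ξ * β)) := by
      rw [gaussTest, ← Complex.exp_add, ← Complex.exp_add]; congr 1; ring
    rw [this]; simp only [hg]; ring
  constructor
  · exact (pi.swap.integral_prod_left).congr
      (Filter.Eventually.of_forall fun ξ => (inner_eq ξ).symm)
  · have e1 : ∀ x : ℝ, G x * h (x + β) = ∫ ξ : ℝ, exp (2 * Real.pi * I * ξ * x) *
      (g x * (exp (2 * Real.pi * I * ξ * β) * 𝓕 (fun x : ℝ => k x) ξ)) := by
      intro x
      have h1 : h (x + β) = exp (-(α : ℂ) * (x + β) ^ 2) * k (x + β) := by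
        rw [hk]; simp only
        rw [← mul_assoc, ← Complex.exp_add]
        simp
      rw [h1, inv x, ← mul_assoc, ← integral_const_mul]
      congr 1; ext ξ
      simp only [hg]; ring
    simp_rw [e1]
    rw [integral_integral_swap pi]
    exact integral_congr_ae (Filter.Eventually.of_forall fun ξ => (inner_eq ξ).symm)

end Strip

end LevelN

namespace LevelN

open scoped FourierTransform SchwartzMap

/-! ### The Fourier transform of Gaussian-type functions -/

theorem gaussW_mul_id {f : ℂ → ℂ} (hf : f ∈ gaussW) : (fun z => z * f z) ∈ gaussW := by
  induction hf using Submodule.span_induction with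
  | mem f hf =>
    obtain ⟨k, α, β, hα, rfl⟩ := hf
    refine Submodule.subset_span ⟨k + 1, α, β, hα, ?_⟩
    funext z; rw [pow_succ]; ring
  | zero => convert Submodule.zero_mem gaussW using 1; funext z; simp
  | add f g _ _ hf hg => convert Submodule.add_mem _ hf hg using 1; funext z; simp [mul_add]
  | smul a f _ hf => convert Submodule.smul_mem _ a hf using 1; funext z; simp; ring

theorem gaussW_pow_mul {f : ℂ → ℂ} (hf : f ∈ gaussW) (k : ℕ) :
    (fun z => z ^ k * f z) ∈ gaussW := by
  induction k with
  | zero => simpa using hf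
  | succ k ih => convert gaussW_mul_id ih using 2 with z; rw [pow_succ]; ring

theorem monomial_hasDerivAt (k : ℕ) (α β z : ℂ) :
    HasDerivAt (fun z : ℂ => z ^ k * exp (-α * z ^ 2 + β * z))
      (k * (z ^ (k - 1) * exp (-α * z ^ 2 + β * z)) -
        2 * α * (z ^ (k + 1) * exp (-α * z ^ 2 + β * z)) +
        β * (z ^ k * exp (-α * z ^ 2 + β * z))) z := by
  have h1 : HasDerivAt (fun z : ℂ => -α * z ^ 2 + β * z) (-α * (2 * z) + β) z := by
    refine ((((hasDerivAt_id z).fun_pow 2).const_mul (-α)).fun_add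
      ((hasDerivAt_id z).const_mul β)).congr_deriv ?_
    simp
  refine ((hasDerivAt_pow k z).fun_mul h1.cexp).congr_deriv ?_
  ring

theorem gaussW_deriv {f : ℂ → ℂ} (hf : f ∈ gaussW) : deriv f ∈ gaussW := by
  induction hf using Submodule.span_induction with
  | mem f hf =>
    obtain ⟨k, α, β, hα, rfl⟩ := hf
    have h : deriv (fun z : ℂ => z ^ k * exp (-α * z ^ 2 + β * z)) =
        (k : ℂ) • (fun z : ℂ => z ^ (k - 1) * exp (-α * z ^ 2 + β * z)) -
        (2 * α) • (fun z : ℂ => z ^ (k + 1) * exp (-α * z ^ 2 + β * z)) +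
        β • (fun z : ℂ => z ^ k * exp (-α * z ^ 2 + β * z)) :=
      funext fun z => (monomial_hasDerivAt k α β z).deriv
    have hm : ∀ j : ℕ, (fun z : ℂ => z ^ j * exp (-α * z ^ 2 + β * z)) ∈ gaussW := fun j =>
      Submodule.subset_span ⟨j, α, β, hα, rfl⟩
    rw [h]
    exact Submodule.add_mem _ (Submodule.sub_mem _ (Submodule.smul_mem _ _ (hm _))
      (Submodule.smul_mem _ _ (hm _))) (Submodule.smul_mem _ _ (hm _))
  | zero => simp
  | add f g hf' hg' hf hg =>
    have : deriv (f + g) = deriv f + deriv g := funext fun z =>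
      deriv_add (gaussW_differentiable hf' z) (gaussW_differentiable hg' z)
    rw [this]; exact Submodule.add_mem _ hf hg
  | smul a f hf' hf =>
    have : deriv (a • f) = a • deriv f := funext fun z =>
      deriv_const_smul _ (gaussW_differentiable hf' z)
    rw [this]; exact Submodule.smul_mem _ a hf

theorem gaussW_iteratedDeriv {f : ℂ → ℂ} (hf : f ∈ gaussW) (n : ℕ) :
    ∃ g ∈ gaussW, iteratedDeriv n (fun x : ℝ => f x) = fun x : ℝ => g x := by
  induction n with
  | zero => exact ⟨f, hf, iteratedDeriv_zero⟩
  | succ n ih =>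
    obtain ⟨g, hg, h⟩ := ih
    refine ⟨deriv g, gaussW_deriv hg, ?_⟩
    rw [iteratedDeriv_succ, h]
    funext x
    exact ((gaussW_differentiable hg x).hasDerivAt.comp_ofReal).deriv

theorem gaussW_bounded {f : ℂ → ℂ} (hf : f ∈ gaussW) : ∃ C, ∀ x : ℝ, ‖f x‖ ≤ C := by
  obtain ⟨C, ε, hC, hε, h⟩ := gaussW_bound hf 0
  refine ⟨C, fun x => (h x (by simp)).trans (mul_le_of_le_one_right hC ?_)⟩
  rw [Real.exp_le_one_iff, ofReal_re]
  nlinarith [sq_nonneg x]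

theorem gaussW_integrable {f : ℂ → ℂ} (hf : f ∈ gaussW) : Integrable fun x : ℝ => f x := by
  obtain ⟨C, ε, hC, hε, h⟩ := gaussW_bound hf 1
  simpa using strip_line_integrable (R := 1) hε (gaussW_differentiable hf).differentiableOn
    (fun z hz => h z (le_of_lt hz)) (β := 0) (by simp)

/-- The restriction to `ℝ` of a Gaussian-type function, as a Schwartz function. -/
noncomputable def gaussSchwartz (f : gaussW) : 𝓢(ℝ, ℂ) where
  toFun x := (f : ℂ → ℂ) x
  smooth' := ((gaussW_differentiable f.2).contDiff (n := ⊤)).restrict_scalars ℝ |>.comp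
    Complex.ofRealCLM.contDiff |>.of_le le_top
  decay' k n := by
    obtain ⟨g, hg, h⟩ := gaussW_iteratedDeriv f.2 n
    obtain ⟨C, hC⟩ := gaussW_bounded (gaussW_pow_mul hg k)
    refine ⟨C, fun x => ?_⟩
    rw [norm_iteratedFDeriv_eq_norm_iteratedDeriv, h]
    simpa using hC x

/-- The embedding of the Gaussian-type functions into `L²(ℝ)`. -/
noncomputable def gaussL2 : gaussW →ₗ[ℂ] L2R where
  toFun f := (gaussW_memLp f.2).toLp (fun x : ℝ => (f : ℂ → ℂ) x)
  map_add' _ _ := rfl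
  map_smul' _ _ := rfl

theorem gaussL2_ae (f : gaussW) : gaussL2 f =ᵐ[volume] fun x : ℝ => (f : ℂ → ℂ) x :=
  (gaussW_memLp f.2).coeFn_toLp

theorem gaussL2_eq_schwartz (f : gaussW) : gaussL2 f = (gaussSchwartz f).toLp 2 := by
  apply Lp.ext
  filter_upwards [gaussL2_ae f, (gaussSchwartz f).coeFn_toLp 2 volume] with x h1 h2
  rw [h1, h2]; rfl

/-- The Gaussian moment `∫ x^k e^{-α x² + β x} dx`. -/
noncomputable def gaussMoment (k : ℕ) (α β : ℂ) : ℂ :=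
  ∫ x : ℝ, (x : ℂ) ^ k * exp (-α * (x : ℂ) ^ 2 + β * x)

/-- Integration by parts: the derivative of x^k e^{-αx² + βx} has integral zero. For k = 0 the
truncated index k - 1 is harmless, its coefficient being 0. -/
theorem gaussMoment_rec (k : ℕ) {α : ℂ} (hα : 0 < α.re) (β : ℂ) :
    gaussMoment (k + 1) α β =
      (2 * α)⁻¹ * (β * gaussMoment k α β + k * gaussMoment (k - 1) α β) := by
  have hm : ∀ j : ℕ, Integrable fun x : ℝ => (x : ℂ) ^ j * exp (-α * (x : ℂ) ^ 2 + β * x) :=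
    fun j => gaussW_integrable (f := fun z => z ^ j * exp (-α * z ^ 2 + β * z))
      (Submodule.subset_span ⟨j, α, β, hα, rfl⟩)
  have i1 := ((hm (k - 1)).const_mul (k : ℂ)).sub ((hm (k + 1)).const_mul (2 * α))
  have i2 := (hm k).const_mul β
  have h := integral_eq_zero_of_hasDerivAt_of_integrable
    (fun x : ℝ => (monomial_hasDerivAt k α β x).comp_ofReal) (i1.add i2) (hm k)
  have h2 : (∫ x : ℝ, (k : ℂ) * ((x : ℂ) ^ (k - 1) * exp (-α * (x : ℂ) ^ 2 + β * x)) -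
        2 * α * ((x : ℂ) ^ (k + 1) * exp (-α * (x : ℂ) ^ 2 + β * x)) +
        β * ((x : ℂ) ^ k * exp (-α * (x : ℂ) ^ 2 + β * x))) =
      k * gaussMoment (k - 1) α β - 2 * α * gaussMoment (k + 1) α β + β * gaussMoment k α β := by
    refine (integral_add i1 i2).trans ?_
    have h3 := integral_sub ((hm (k - 1)).const_mul (k : ℂ)) ((hm (k + 1)).const_mul (2 * α))
    simp only [integral_const_mul] at h3
    rw [integral_const_mul]
    exact congrArg₂ (· + ·) h3 rfl
  rw [h2] at h
  have hα0 : α ≠ 0 := fun h0 => by simp [h0] at hα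
  field_simp
  linear_combination -h

/-- The moment of order 0 is a Gaussian in z with quadratic coefficient -s²/(4α), whose real part is
positive because s is purely imaginary and nonzero. The recursion goes two steps back, hence the
strong induction. -/
theorem gaussMoment_mem (k : ℕ) {α : ℂ} (hα : 0 < α.re) (β : ℂ) {s : ℂ} (hs : s.re = 0)
    (hs0 : s ≠ 0) : (fun z => gaussMoment k α (β + s * z)) ∈ gaussW := by
  have hα0 : α ≠ 0 := fun h0 => by simp [h0] at hα
  induction k using Nat.strong_induction_on with
  | _ k ih =>
  rcases k with _ | k
  · have h : (fun z => gaussMoment 0 α (β + s * z)) =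
        ((Real.pi / α) ^ (1 / 2 : ℂ) * exp (β ^ 2 / (4 * α))) • fun z : ℂ => z ^ 0 *
          exp (-(-(s ^ 2 / (4 * α))) * z ^ 2 + (2 * β * s / (4 * α)) * z) := by
      funext z
      have h1 := integral_cexp_quadratic (b := -α) (by simpa using hα) (β + s * z) 0
      simp only [neg_neg, add_zero] at h1
      simp only [gaussMoment, pow_zero, one_mul, Pi.smul_apply, smul_eq_mul]
      rw [h1, mul_assoc, ← Complex.exp_add]
      congr 2
      field_simp; ring
    rw [h]
    refine Submodule.smul_mem _ _ (Submodule.subset_span ⟨0, _, _, ?_, rfl⟩)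
    have hs2 : s ^ 2 = ((-(s.im ^ 2) : ℝ) : ℂ) := by
      apply Complex.ext <;> simp [pow_two, hs]
    have him : s.im ≠ 0 := fun h => hs0 (Complex.ext hs h)
    have e : -(s ^ 2 / (4 * α)) = ((s.im ^ 2 / 4 : ℝ) : ℂ) * α⁻¹ := by
      rw [hs2]; push_cast; field_simp
    rw [e, Complex.re_ofReal_mul, Complex.inv_re]
    have : 0 < normSq α := normSq_pos.2 hα0
    positivity
  · have h : (fun z => gaussMoment (k + 1) α (β + s * z)) = (2 * α)⁻¹ •
        (β • (fun z => gaussMoment k α (β + s * z)) +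
          s • (fun z => z * gaussMoment k α (β + s * z)) +
          (k : ℂ) • fun z => gaussMoment (k - 1) α (β + s * z)) := by
      funext z
      rw [gaussMoment_rec k hα]
      simp only [Pi.smul_apply, Pi.add_apply, smul_eq_mul]
      ring
    rw [h]
    refine Submodule.smul_mem _ _ (Submodule.add_mem _ (Submodule.add_mem _
      (Submodule.smul_mem _ _ (ih k (by omega)))
      (Submodule.smul_mem _ _ (gaussW_mul_id (ih k (by omega)))))
      (Submodule.smul_mem _ _ (ih (k - 1) (by omega))))

/-- `z ↦ ∫ e^{s z x} f(x) dx`. -/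
noncomputable def gaussFourier (s : ℂ) (f : ℂ → ℂ) (z : ℂ) : ℂ :=
  ∫ x : ℝ, exp (s * z * x) * f x

theorem integrable_exp_mul_gaussW {f : ℂ → ℂ} (hf : f ∈ gaussW) (c : ℂ) :
    Integrable fun x : ℝ => exp (c * x) * f x := by
  simpa using gaussW_integrable (gaussW_exp hf c 0)

theorem gaussFourier_add (s : ℂ) {f g : ℂ → ℂ} (hf : f ∈ gaussW) (hg : g ∈ gaussW) :
    gaussFourier s (f + g) = gaussFourier s f + gaussFourier s g := by
  funext z
  rw [Pi.add_apply, gaussFourier, gaussFourier, gaussFourier,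
    ← integral_add (integrable_exp_mul_gaussW hf _) (integrable_exp_mul_gaussW hg _)]
  simp [mul_add]

theorem gaussFourier_smul (s a : ℂ) (f : ℂ → ℂ) :
    gaussFourier s (a • f) = a • gaussFourier s f := by
  funext z
  rw [Pi.smul_apply, gaussFourier, gaussFourier, smul_eq_mul, ← integral_const_mul]
  congr 1; ext x; simp; ring

theorem gaussFourier_mem {s : ℂ} (hs : s.re = 0) (hs0 : s ≠ 0) {f : ℂ → ℂ} (hf : f ∈ gaussW) :
    gaussFourier s f ∈ gaussW := by
  induction hf using Submodule.span_induction with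
  | mem f hf =>
    obtain ⟨k, α, β, hα, rfl⟩ := hf
    convert gaussMoment_mem k hα β hs hs0 using 2 with z
    refine integral_congr_ae (Filter.Eventually.of_forall fun x => ?_)
    simp only
    rw [mul_left_comm, ← Complex.exp_add]
    congr 2; ring
  | zero =>
    convert Submodule.zero_mem gaussW using 1
    funext z; simp [gaussFourier]
  | add f g hf' hg' hf hg => rw [gaussFourier_add s hf' hg']; exact Submodule.add_mem _ hf hg
  | smul a f _ hf => rw [gaussFourier_smul]; exact Submodule.smul_mem _ a hf

/-- A complex translation becomes multiplication by an exponential. -/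
theorem gaussFourier_shift (s : ℂ) {f : ℂ → ℂ} (hf : f ∈ gaussW) (β z : ℂ) :
    gaussFourier s (fun w => f (w + β)) z = exp (-(s * z * β)) * gaussFourier s f z := by
  have hg := gaussW_exp hf (s * z) 0
  obtain ⟨C, ε, hC, hε, hb⟩ := gaussW_bound hg (|β.im| + 1)
  have h := integral_strip_shift (R := |β.im| + 1) hε
    (gaussW_differentiable hg).differentiableOn (fun z hz => hb z (le_of_lt hz)) (β := β)
    (by linarith)
  simp only [add_zero] at h
  rw [gaussFourier, gaussFourier, ← h, ← integral_const_mul]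
  congr 1; ext x
  rw [← mul_assoc, ← Complex.exp_add]
  congr 2; ring

theorem gaussFourier_exp (s : ℂ) (f : ℂ → ℂ) {c d : ℂ} (z : ℂ) {t : ℂ} (ht : s * t = c) :
    gaussFourier s (fun w => exp (c * w + d) * f w) z = exp d * gaussFourier s f (z + t) := by
  rw [gaussFourier, gaussFourier, ← integral_const_mul]
  congr 1; ext x
  rw [← mul_assoc, ← mul_assoc, ← Complex.exp_add, ← Complex.exp_add, ← ht]
  congr 2; ring

end LevelN

namespace LevelN

open scoped FourierTransform SchwartzMap

/-! ### Closures of graphs and conjugation by unitary operators -/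

theorem toHS_ae {N : ℕ} (f : W N) (m : ZMod N) :
    ((toHS N f) m : ℝ → ℂ) =ᵐ[volume] fun x : ℝ => (f : ZMod N → ℂ → ℂ) m x :=
  (gaussW_memLp (W_mem f m)).coeFn_toLp

section Graphs

variable {N : ℕ} [NeZero N]

/-- The closure of the graph of an operator on `𝒲`. -/
def graphCl (A : Module.End ℂ (W N)) : Set (HS N × HS N) :=
  closure (Set.range fun f : W N => (toHS N f, toHS N (A f)))

theorem toPMap_graph (A : Module.End ℂ (W N)) :
    ((toPMap A).graph : Set (HS N × HS N)) =
      Set.range fun f : W N => (toHS N f, toHS N (A f)) := by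
  ext x
  rw [SetLike.mem_coe, LinearPMap.mem_graph_iff']
  have key : ∀ f : W N, (LinearEquiv.ofInjective (toHS N) (toHS_injective N)).symm
      ⟨toHS N f, LinearMap.mem_range_self _ f⟩ = f := fun f => by
    rw [LinearEquiv.symm_apply_eq]; rfl
  constructor
  · rintro ⟨⟨y, f, rfl⟩, rfl⟩
    exact ⟨f, Prod.ext rfl (by
      change toHS N (A f) = toHS N (A ((LinearEquiv.ofInjective (toHS N)
        (toHS_injective N)).symm ⟨toHS N f, _⟩))
      rw [key])⟩
  · rintro ⟨f, rfl⟩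
    exact ⟨⟨toHS N f, LinearMap.mem_range_self _ f⟩, Prod.ext rfl (by
      change toHS N (A ((LinearEquiv.ofInjective (toHS N)
        (toHS_injective N)).symm ⟨toHS N f, _⟩)) = toHS N (A f)
      rw [key])⟩

theorem closure_graph_eq {A : Module.End ℂ (W N)} (hA : (toPMap A).IsClosable) :
    ((toPMap A).closure.graph : Set (HS N × HS N)) = graphCl A := by
  rw [← hA.graph_closure_eq_closure_graph, Submodule.topologicalClosure_coe, toPMap_graph]
  rfl

/-- `V` conjugates the closure of (the graph of) `A` into the closure of `B`. -/
def Conjugates (V : HS N ≃ₗᵢ[ℂ] HS N) (A B : Module.End ℂ (W N)) : Prop :=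
  Prod.map V V '' graphCl A = graphCl B

theorem Conjugates.mul {V V' : HS N ≃ₗᵢ[ℂ] HS N} {A B C : Module.End ℂ (W N)}
    (h' : Conjugates V' B C) (h : Conjugates V A B) : Conjugates (V' * V) A C := by
  rw [Conjugates, ← h', ← h, Set.image_image]
  rfl

theorem Conjugates.inv {V : HS N ≃ₗᵢ[ℂ] HS N} {A B : Module.End ℂ (W N)}
    (h : Conjugates V A B) : Conjugates V⁻¹ B A := by
  rw [Conjugates, ← h, Set.image_image]
  convert Set.image_id _ using 2
  funext x
  exact Prod.ext (V.symm_apply_apply x.1) (V.symm_apply_apply x.2)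

/-- Each inclusion of closed graphs need only be tested on 𝒲. The inclusion for V⁻¹ gives the
reverse inclusion for V. -/
theorem conjugates_of_mem {V : HS N ≃ₗᵢ[ℂ] HS N} {A B : Module.End ℂ (W N)}
    (h : ∀ f : W N, (V (toHS N f), V (toHS N (A f))) ∈ graphCl B)
    (h' : ∀ f : W N, (V⁻¹ (toHS N f), V⁻¹ (toHS N (B f))) ∈ graphCl A) : Conjugates V A B := by
  have sub : ∀ (U : HS N ≃ₗᵢ[ℂ] HS N) (A B : Module.End ℂ (W N)),
      (∀ f : W N, (U (toHS N f), U (toHS N (A f))) ∈ graphCl B) →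
      Prod.map U U '' graphCl A ⊆ graphCl B := by
    intro U A B hU
    refine (image_closure_subset_closure_image
      (U.continuous.prodMap U.continuous)).trans (closure_minimal ?_ isClosed_closure)
    rintro _ ⟨_, ⟨f, rfl⟩, rfl⟩
    exact hU f
  refine (sub V A B h).antisymm fun x hx => ?_
  refine ⟨Prod.map (V⁻¹ : HS N ≃ₗᵢ[ℂ] HS N) (V⁻¹ : HS N ≃ₗᵢ[ℂ] HS N) x,
    sub V⁻¹ B A h' ⟨x, hx, rfl⟩, ?_⟩
  exact Prod.ext (V.apply_symm_apply x.1) (V.apply_symm_apply x.2)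

theorem conjPMap_graph (V : HS N ≃ₗᵢ[ℂ] HS N) (T : HS N →ₗ.[ℂ] HS N) :
    ((conjPMap V T).graph : Set (HS N × HS N)) = Prod.map V V '' (T.graph : Set _) := by
  ext x
  simp only [SetLike.mem_coe, LinearPMap.mem_graph_iff', Set.mem_image]
  constructor
  · rintro ⟨y, rfl⟩
    exact ⟨(V.symm y, T ⟨V.symm y, y.2⟩), ⟨⟨V.symm y, y.2⟩, rfl⟩,
      Prod.ext (V.apply_symm_apply _) rfl⟩
  · rintro ⟨_, ⟨y, rfl⟩, rfl⟩
    have hy : V.symm (V y) = y := V.symm_apply_apply _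
    refine ⟨⟨V y, ?_⟩, Prod.ext rfl ?_⟩
    · change V.symm (V y) ∈ T.domain
      rw [hy]; exact y.2
    · change V (T ⟨V.symm (V y), _⟩) = V (T y)
      congr 2
      exact Subtype.ext hy

/-- A partial linear map is determined by its graph, so the equality of domains is included. -/
theorem Conjugates.conjPMap_eq {V : HS N ≃ₗᵢ[ℂ] HS N} {A B : Module.End ℂ (W N)}
    (h : Conjugates V A B) (hA : (toPMap A).IsClosable) (hB : (toPMap B).IsClosable) :
    conjPMap V (toPMap A).closure = (toPMap B).closure := by
  apply LinearPMap.eq_of_eq_graph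
  apply SetLike.coe_injective
  rw [conjPMap_graph, closure_graph_eq hA, closure_graph_eq hB, h]

/-- `V` restricts to the automorphism `e` of `𝒲`. -/
def LiftsTo (V : HS N ≃ₗᵢ[ℂ] HS N) (e : W N ≃ₗ[ℂ] W N) : Prop :=
  ∀ f, V (toHS N f) = toHS N (e f)

theorem LiftsTo.symm {V : HS N ≃ₗᵢ[ℂ] HS N} {e : W N ≃ₗ[ℂ] W N} (h : LiftsTo V e) :
    LiftsTo V⁻¹ e.symm := by
  intro f
  change V.symm (toHS N f) = _
  rw [LinearIsometryEquiv.symm_apply_eq, h, e.apply_symm_apply]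

theorem LiftsTo.conjugates {V : HS N ≃ₗᵢ[ℂ] HS N} {e : W N ≃ₗ[ℂ] W N} (h : LiftsTo V e)
    {A B : Module.End ℂ (W N)} (hAB : ∀ f, e (A f) = B (e f)) : Conjugates V A B := by
  refine conjugates_of_mem (fun f => ?_) fun f => ?_
  · rw [h, h, hAB]
    exact subset_closure ⟨e f, rfl⟩
  · rw [h.symm, h.symm]
    have : e.symm (B f) = A (e.symm f) := by
      rw [LinearEquiv.symm_apply_eq, hAB, e.apply_symm_apply]
    rw [this]
    exact subset_closure ⟨e.symm f, rfl⟩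

/-- The closure of the graph, tested against linear functionals. -/
theorem mem_graphCl {A : Module.End ℂ (W N)} {x y : HS N}
    (h : ∀ v w : HS N, (∀ f : W N, inner ℂ v (toHS N f) + inner ℂ w (toHS N (A f)) = 0) →
      inner ℂ v x + inner ℂ w y = 0) : (x, y) ∈ graphCl A := by
  by_contra hx
  rw [graphCl, ← toPMap_graph, ← Submodule.topologicalClosure_coe] at hx
  set S := (toPMap A).graph.topologicalClosure with hS
  have hSc : IsClosed (S : Set (HS N × HS N)) := Submodule.isClosed_topologicalClosure _
  -- Closedness makes the quotient by S a normed space, on which continuous functionals separate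
  -- points.
  have : IsClosed (S.toAddSubgroup : Set (HS N × HS N)) := hSc
  have hq : S.mkQ (x, y) ≠ 0 := by rwa [Ne, Submodule.mkQ_apply, Submodule.Quotient.mk_eq_zero]
  obtain ⟨ℓ₀, hℓ₀⟩ := SeparatingDual.exists_ne_zero (R := ℂ) hq
  set ℓ : HS N × HS N →L[ℂ] ℂ := ℓ₀ ∘L S.mkQL
  have hℓ1 : ∀ p ∈ S, ℓ p = 0 := fun p hp => by
    change ℓ₀ (S.mkQ p) = 0
    rw [Submodule.mkQ_apply, (Submodule.Quotient.mk_eq_zero S).2 hp, map_zero]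
  have hℓ2 : ℓ (x, y) ≠ 0 := hℓ₀
  -- The product carries the sup norm and is not a Hilbert space, so the Riesz representation is
  -- applied to each factor.
  set v := (InnerProductSpace.toDual ℂ (HS N)).symm (ℓ ∘L ContinuousLinearMap.inl ℂ _ _)
  set w := (InnerProductSpace.toDual ℂ (HS N)).symm (ℓ ∘L ContinuousLinearMap.inr ℂ _ _)
  have e : ∀ p : HS N × HS N, inner ℂ v p.1 + inner ℂ w p.2 = ℓ p := by
    intro p
    rw [InnerProductSpace.toDual_symm_apply, InnerProductSpace.toDual_symm_apply]
    change ℓ (p.1, 0) + ℓ (0, p.2) = ℓ p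
    rw [← map_add]
    simp
  refine hℓ2 ?_
  rw [← e]
  refine h v w fun f => ?_
  rw [e (toHS N f, toHS N (A f))]
  refine hℓ1 _ (Submodule.le_topologicalClosure _ ?_)
  rw [← SetLike.mem_coe, toPMap_graph]
  exact ⟨f, rfl⟩

/-! ### Formal adjoints and closability -/

/-- `A` has a formal adjoint on `𝒲`. -/
def HasFormalAdjoint (A : Module.End ℂ (W N)) : Prop :=
  ∃ A' : W N → W N, ∀ f g, inner ℂ (toHS N g) (toHS N (A f)) = inner ℂ (toHS N (A' g)) (toHS N f)

theorem HasFormalAdjoint.add {A B : Module.End ℂ (W N)} (hA : HasFormalAdjoint A)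
    (hB : HasFormalAdjoint B) : HasFormalAdjoint (A + B) := by
  obtain ⟨A', hA⟩ := hA
  obtain ⟨B', hB⟩ := hB
  refine ⟨fun g => A' g + B' g, fun f g => ?_⟩
  rw [LinearMap.add_apply, map_add, map_add, inner_add_right, inner_add_left, hA, hB]

theorem HasFormalAdjoint.smul {A : Module.End ℂ (W N)} (c : ℂ) (hA : HasFormalAdjoint A) :
    HasFormalAdjoint (c • A) := by
  obtain ⟨A', hA⟩ := hA
  refine ⟨fun g => conj c • A' g, fun f g => ?_⟩
  rw [LinearMap.smul_apply, map_smul, map_smul, inner_smul_right, inner_smul_left, hA]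
  simp

theorem HasFormalAdjoint.mul {A B : Module.End ℂ (W N)} (hA : HasFormalAdjoint A)
    (hB : HasFormalAdjoint B) : HasFormalAdjoint (A * B) := by
  obtain ⟨A', hA⟩ := hA
  obtain ⟨B', hB⟩ := hB
  exact ⟨fun g => B' (A' g), fun f g => by rw [Module.End.mul_apply, hA, hB]⟩

theorem HasFormalAdjoint.conj {V : HS N ≃ₗᵢ[ℂ] HS N} {e : W N ≃ₗ[ℂ] W N} (h : LiftsTo V e)
    {A B : Module.End ℂ (W N)} (hAB : ∀ f, e (A f) = B (e f)) (hB : HasFormalAdjoint B) :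
    HasFormalAdjoint A := by
  obtain ⟨B', hB⟩ := hB
  refine ⟨fun g => e.symm (B' (e g)), fun f g => ?_⟩
  rw [← V.inner_map_map, h, h, hAB, hB, ← V.inner_map_map (toHS N _) (toHS N f), h, h,
    e.apply_symm_apply]

theorem hs_inner (v x : HS N) :
    inner ℂ v x = ∑ m, ∫ t : ℝ, conj ((v m : L2R) t) * (x m : L2R) t := by
  rw [PiLp.inner_apply]
  refine Finset.sum_congr rfl fun m _ => ?_
  rw [MeasureTheory.L2.inner_def]
  refine integral_congr_ae (Filter.Eventually.of_forall fun t => ?_)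
  simp [mul_comm]

/-- The function equal to `g` on the component `m` and to zero on the others. -/
def W.single (m : ZMod N) (g : gaussW) : W N :=
  ⟨Pi.single m (g : ℂ → ℂ), Submodule.mem_pi.2 fun j _ => by
    by_cases h : j = m
    · subst h; simp
    · rw [Pi.single_eq_of_ne h]; exact Submodule.zero_mem _⟩

/-- Injectivity of the Fourier transform on L¹: a smooth compactly supported test function is the
transform of a Schwartz function, and the transform can be moved onto `G`. -/
theorem ae_eq_zero_of_fourier_eq_zero {G : ℝ → ℂ} (hG : Integrable G) (h : ∀ ξ, 𝓕 G ξ = 0) :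
    ∀ᵐ x, G x = 0 := by
  refine ae_eq_zero_of_integral_contDiff_smul_eq_zero hG.locallyIntegrable fun g hg hg' => ?_
  have hs : HasCompactSupport fun x => (g x : ℂ) := hg'.comp_left (g := ((↑) : ℝ → ℂ)) rfl
  set φ : 𝓢(ℝ, ℂ) := hs.toSchwartzMap (Complex.ofRealCLM.contDiff.comp hg) with hφ
  have h1 := VectorFourier.integral_fourierIntegral_smul_eq_flip (μ := volume) (ν := volume)
    (L := innerₗ ℝ) (f := G) (g := (𝓕⁻ φ : 𝓢(ℝ, ℂ))) Real.continuous_fourierChar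
    continuous_inner hG (𝓕⁻ φ).integrable
  have h2 : ∀ x : ℝ, VectorFourier.fourierIntegral Real.fourierChar volume (innerₗ ℝ).flip
      (𝓕⁻ φ : 𝓢(ℝ, ℂ)) x = g x := by
    intro x
    rw [flip_innerₗ]
    change 𝓕 ((𝓕⁻ φ : 𝓢(ℝ, ℂ)) : ℝ → ℂ) x = g x
    rw [← SchwartzMap.fourier_coe, FourierTransform.fourier_fourierInv_eq]
    rfl
  simp_rw [h2] at h1
  have h3 : ∀ ξ : ℝ, VectorFourier.fourierIntegral Real.fourierChar volume (innerₗ ℝ) G ξ = 0 := h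
  simp_rw [h3] at h1
  have h4 : ∫ x : ℝ, G x • (g x : ℂ) = 0 := by rw [← h1]; simp
  rw [← h4]
  refine integral_congr_ae (Filter.Eventually.of_forall fun x => ?_)
  simp [mul_comm]

/-- `𝒲` is dense in `ℋ`. -/
theorem eq_zero_of_inner_toHS {v : HS N} (h : ∀ f : W N, inner ℂ (toHS N f) v = 0) : v = 0 := by
  ext1 m
  apply Lp.ext
  have hm : MemLp (fun x : ℝ => gaussTest 1 0 x) 2 volume := gaussW_memLp (gaussTest_mem one_pos 0)
  have hG : Integrable fun x : ℝ => gaussTest 1 0 x * (v m : L2R) x := hm.integrable_mul (Lp.memLp _)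
  -- The inner product of e^{-x² + 2πiξx} with the component v m is the Fourier transform at ξ of
  -- e^{-x²} v m, an integrable function.
  have key : ∀ ξ, 𝓕 (fun x : ℝ => gaussTest 1 0 x * (v m : L2R) x) ξ = 0 := by
    intro ξ
    have h1 := h (W.single m ⟨gaussTest 1 ξ, gaussTest_mem one_pos ξ⟩)
    rw [hs_inner, Finset.sum_eq_single m] at h1
    · rw [Real.fourier_real_eq_integral_exp_smul, ← h1]
      refine integral_congr_ae ?_
      filter_upwards [toHS_ae (W.single m ⟨gaussTest 1 ξ, gaussTest_mem one_pos ξ⟩) m] with x hx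
      rw [hx, smul_eq_mul, ← mul_assoc]
      congr 1
      simp only [W.single, Pi.single_eq_same, gaussTest]
      rw [← Complex.exp_add, ← Complex.exp_conj]
      congr 1
      simp [Complex.conj_ofNat]; ring
    · intro j _ hj
      refine integral_eq_zero_of_ae ?_
      filter_upwards [toHS_ae (W.single m ⟨gaussTest 1 ξ, gaussTest_mem one_pos ξ⟩) j] with x hx
      rw [hx]
      simp [W.single, Pi.single_eq_of_ne hj]
    · simp
  filter_upwards [ae_eq_zero_of_fourier_eq_zero hG key, Lp.coeFn_zero ℂ 2 (volume : Measure ℝ)]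
    with x hx h0
  rw [PiLp.zero_apply, h0]
  exact (mul_eq_zero.1 hx).resolve_left (Complex.exp_ne_zero _)

/-- The adjoint relation is a closed condition on pairs, so it holds on the closure of the graph. A
pair (0, y) there has y orthogonal to 𝒲, which is dense. -/
theorem HasFormalAdjoint.isClosable {A : Module.End ℂ (W N)} (hA : HasFormalAdjoint A) :
    (toPMap A).IsClosable := by
  obtain ⟨A', hA⟩ := hA
  set S := (toPMap A).graph.topologicalClosure with hS
  have key : ∀ x ∈ S, ∀ g : W N, inner ℂ (toHS N g) x.2 = inner ℂ (toHS N (A' g)) x.1 := by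
    intro x hx g
    have hx' : x ∈ graphCl A := by
      rw [← SetLike.mem_coe, hS, Submodule.topologicalClosure_coe, toPMap_graph] at hx
      exact hx
    refine closure_minimal (t := {x : HS N × HS N | inner ℂ (toHS N g) x.2 =
      inner ℂ (toHS N (A' g)) x.1}) ?_ (isClosed_eq (by fun_prop) (by fun_prop)) hx'
    rintro _ ⟨f, rfl⟩
    exact hA f g
  refine ⟨S.toLinearPMap, (Submodule.toLinearPMap_graph_eq S fun x hx h0 => ?_).symm⟩
  refine eq_zero_of_inner_toHS fun g => ?_
  rw [key x hx g, h0, inner_zero_right]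

end Graphs

end LevelN

namespace LevelN

open scoped FourierTransform SchwartzMap

/-! ### The Fourier transformation, shifts and phases on `𝒲` -/

theorem stdAddChar_val {N : ℕ} [NeZero N] (m : ZMod N) :
    (ZMod.stdAddChar m : ℂ) = exp (2 * Real.pi * I / N * (m.val : ℂ)) := by
  have h := ZMod.stdAddChar_coe (N := N) (m.val : ℤ)
  rw [Int.cast_natCast, ZMod.natCast_zmod_val] at h
  rw [h]
  congr 1; push_cast; ring

theorem yFun_eq {N : ℕ} [NeZero N] (b : ℂ) (m : ZMod N) (z : ℂ) :
    yFun N b m z = ZMod.stdAddChar (-m) * exp (2 * Real.pi / N * b * z) := by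
  rw [AddChar.map_neg_eq_inv, stdAddChar_val, yFun, ← Complex.exp_neg, ← Complex.exp_add]
  congr 1
  linear_combination (-(2 * Real.pi / N * b * z) : ℂ) * I_sq

theorem yFun_ne_zero (N : ℕ) (b : ℂ) (m : ZMod N) (z : ℂ) : yFun N b m z ≠ 0 :=
  Complex.exp_ne_zero _

theorem yFun_add {N : ℕ} [NeZero N] (b : ℂ) (m n : ZMod N) (z w : ℂ) :
    yFun N b (m + n) (z + w) = yFun N b m z * yFun N b n w := by
  rw [yFun_eq, yFun_eq, yFun_eq, neg_add, AddChar.map_add_eq_mul, mul_add, Complex.exp_add]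
  ring

theorem yFun_neg {N : ℕ} [NeZero N] (b : ℂ) (m : ZMod N) (z : ℂ) :
    yFun N b (-m) (-z) = (yFun N b m z)⁻¹ := by
  refine eq_inv_of_mul_eq_one_left ?_
  rw [← yFun_add, neg_add_cancel, neg_add_cancel, yFun_eq]
  simp

theorem yFun_neg_one_ib {N : ℕ} [NeZero N] (b : ℂ) : yFun N b (-1) (I * b) = q N b ^ 2 := by
  have h1 := ZMod.stdAddChar_coe (N := N) 1
  rw [Int.cast_one] at h1
  rw [yFun_eq, neg_neg, h1, q, ← Complex.exp_nat_mul, ← Complex.exp_add]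
  congr 1; push_cast; ring

/-- The source of the commutation rule 𝐮𝐲 = q²𝐲𝐮. -/
theorem yFun_shift {N : ℕ} [NeZero N] (b : ℂ) (m : ZMod N) (z : ℂ) :
    yFun N b (m - 1) (z + I * b) = q N b ^ 2 * yFun N b m z := by
  rw [sub_eq_add_neg, yFun_add, yFun_neg_one_ib, mul_comm]

theorem q_ne_zero (N : ℕ) (b : ℂ) : q N b ≠ 0 := Complex.exp_ne_zero _

theorem yFun_shift_inv {N : ℕ} [NeZero N] (b : ℂ) (m : ZMod N) (z : ℂ) :
    yFun N b (m + 1) (z - I * b) = (q N b ^ 2)⁻¹ * yFun N b m z := by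
  have h := yFun_shift b (m + 1) (z - I * b)
  rw [add_sub_cancel_right, sub_add_cancel] at h
  rw [h, inv_mul_cancel_left₀ (pow_ne_zero 2 (q_ne_zero N b))]

theorem gaussW_scale {f : ℂ → ℂ} (hf : f ∈ gaussW) {c : ℝ} (hc : c ≠ 0) :
    (fun z => f (c * z)) ∈ gaussW := by
  induction hf using Submodule.span_induction with
  | mem f hf =>
    obtain ⟨k, α, β, hα, rfl⟩ := hf
    have h : (fun z : ℂ => (c * z) ^ k * exp (-α * (c * z) ^ 2 + β * (c * z))) =
        ((c : ℂ) ^ k) • fun z : ℂ => z ^ k * exp (-(((c ^ 2 : ℝ) : ℂ) * α) * z ^ 2 +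
          (β * c) * z) := by
      funext z
      simp only [Pi.smul_apply, smul_eq_mul]
      rw [mul_pow, mul_assoc]
      congr 3
      push_cast; ring
    rw [h]
    refine Submodule.smul_mem _ _ (Submodule.subset_span ⟨k, _, _, ?_, rfl⟩)
    rw [Complex.re_ofReal_mul]
    positivity
  | zero => exact Submodule.zero_mem _
  | add f g _ _ hf hg => exact Submodule.add_mem _ hf hg
  | smul a f _ hf => exact Submodule.smul_mem _ a hf

theorem twoPiI_div_re (N : ℕ) : (2 * Real.pi * I / (N : ℂ)).re = 0 := by
  have : 2 * Real.pi * I / (N : ℂ) = ((2 * Real.pi / N : ℝ) : ℂ) * I := by push_cast; ring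
  rw [this, Complex.re_ofReal_mul]; simp

/-- The components of an element of `𝒲`. -/
def W.comp {N : ℕ} (f : W N) (m : ZMod N) : gaussW := ⟨(f : ZMod N → ℂ → ℂ) m, W_mem f m⟩

theorem toHS_apply {N : ℕ} (f : W N) (m : ZMod N) : (toHS N f) m = gaussL2 (W.comp f m) := rfl

section

variable (N : ℕ) [NeZero N]

/-- The action of `ℱ` in the variable `μ`. -/
noncomputable def fourierComp : L2R ≃ₗᵢ[ℂ] L2R :=
  (Lp.fourierTransformₗᵢ ℝ ℂ).symm.trans
    (affineUnitary ((N : ℝ)⁻¹) (inv_pos.2 (Nat.cast_pos.2 (NeZero.pos N))) 0)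

theorem twoPiI_div_ne_zero : 2 * Real.pi * I / (N : ℂ) ≠ 0 :=
  div_ne_zero two_pi_I_ne_zero (Nat.cast_ne_zero.2 (NeZero.ne N))

theorem ofReal_sqrt_inv_mul : (Real.sqrt N : ℂ) * (N : ℂ)⁻¹ = (Real.sqrt N : ℂ)⁻¹ := by
  have h0 : (Real.sqrt N : ℂ) ≠ 0 := by
    simpa using NeZero.ne N
  have h1 : (Real.sqrt N : ℂ) * Real.sqrt N = N := by
    rw [← Complex.ofReal_mul, Real.mul_self_sqrt (Nat.cast_nonneg N)]; simp
  rw [← h1, mul_inv, mul_inv_cancel_left₀ h0]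

/-- The action of `ℱ` in the variable `μ`, on the Gaussian-type functions. -/
noncomputable def gaussComp (f : gaussW) : gaussW :=
  ⟨(Real.sqrt N : ℂ)⁻¹ • gaussFourier (2 * Real.pi * I / N) f,
    Submodule.smul_mem _ _ (gaussFourier_mem (twoPiI_div_re N) (twoPiI_div_ne_zero N) f.2)⟩

theorem fourierComp_gauss (f : gaussW) :
    fourierComp N (gaussL2 f) = gaussL2 (gaussComp N f) := by
  have hN : (0 : ℝ) < (N : ℝ)⁻¹ := inv_pos.2 (Nat.cast_pos.2 (NeZero.pos N))
  have h1 : (Lp.fourierTransformₗᵢ ℝ ℂ).symm (gaussL2 f) =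
      (𝓕⁻ (gaussSchwartz f) : 𝓢(ℝ, ℂ)).toLp 2 := by
    rw [gaussL2_eq_schwartz]
    exact SchwartzMap.toLp_fourierInv_eq _
  apply Lp.ext
  change affineIso _ hN 0 ((Lp.fourierTransformₗᵢ ℝ ℂ).symm (gaussL2 f)) =ᵐ[volume] _
  rw [h1]
  filter_upwards [affineIso_ae _ hN 0 ((𝓕⁻ (gaussSchwartz f) : 𝓢(ℝ, ℂ)).toLp 2),
    ae_affine hN 0 ((𝓕⁻ (gaussSchwartz f) : 𝓢(ℝ, ℂ)).coeFn_toLp 2 volume),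
    gaussL2_ae (gaussComp N f)] with x hx hx' hx''
  rw [hx, hx', hx'', SchwartzMap.fourierInv_coe, Real.fourierInv_eq']
  change _ = (Real.sqrt N : ℂ)⁻¹ * gaussFourier (2 * Real.pi * I / N) f x
  rw [Real.sqrt_inv, Complex.ofReal_inv, gaussFourier]
  congr 2; ext v
  change _ • (f : ℂ → ℂ) v = _
  rw [smul_eq_mul]
  congr 2
  simp; ring

/-- The preimage is the transform with the opposite exponent. The inversion formula is checked in
L²(ℝ), where the Fourier transform is already unitary, and carried back to entire functions by
`toHS_injective`. -/
theorem gaussComp_surjective : Function.Surjective (gaussComp N) := by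
  intro g
  have hN : (0 : ℝ) < N := Nat.cast_pos.2 (NeZero.pos N)
  set f : gaussW := ⟨(Real.sqrt N : ℂ)⁻¹ • gaussFourier (-(2 * Real.pi * I / N)) g,
    Submodule.smul_mem _ _ (gaussFourier_mem (by rw [neg_re, twoPiI_div_re, neg_zero])
      (neg_ne_zero.2 (twoPiI_div_ne_zero N)) g.2)⟩ with hf
  -- The dilation of g that undoes the affine part of `fourierComp`; its ordinary Fourier transform
  -- is f.
  set a : gaussW := ⟨(Real.sqrt N : ℂ) • fun z => (g : ℂ → ℂ) ((N : ℝ) * z),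
    Submodule.smul_mem _ _ (gaussW_scale g.2 hN.ne')⟩ with ha
  refine ⟨f, ?_⟩
  have h1 : 𝓕 (gaussL2 a) = gaussL2 f := by
    rw [gaussL2_eq_schwartz, SchwartzMap.toLp_fourier_eq]
    apply Lp.ext
    filter_upwards [(𝓕 (gaussSchwartz a) : 𝓢(ℝ, ℂ)).coeFn_toLp 2 volume, gaussL2_ae f]
      with x hx hx'
    rw [hx, hx', SchwartzMap.fourier_coe, Real.fourier_real_eq_integral_exp_smul]
    change (∫ v : ℝ, exp (↑(-2 * Real.pi * v * x) * I) •
      ((Real.sqrt N : ℂ) * (g : ℂ → ℂ) ((N : ℝ) * v))) =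
      (Real.sqrt N : ℂ)⁻¹ * gaussFourier (-(2 * Real.pi * I / N)) g x
    have h2 := Measure.integral_comp_mul_left
      (fun v : ℝ => exp (-(2 * Real.pi * I / N) * x * v) * (g : ℂ → ℂ) v) (N : ℝ)
    rw [abs_of_pos (inv_pos.2 hN), Complex.real_smul] at h2
    rw [gaussFourier, ← ofReal_sqrt_inv_mul, mul_assoc]
    push_cast at h2
    rw [← h2, ← integral_const_mul]
    congr 1; ext v
    rw [smul_eq_mul, mul_left_comm]
    congr 3
    have : (N : ℂ) ≠ 0 := Nat.cast_ne_zero.2 (NeZero.ne N)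
    field_simp
    push_cast
    ring
  have h2 : fourierComp N (gaussL2 f) = gaussL2 g := by
    change affineIso _ (inv_pos.2 hN) 0 ((Lp.fourierTransformₗᵢ ℝ ℂ).symm (gaussL2 f)) = _
    rw [← h1]
    have h3 : (Lp.fourierTransformₗᵢ ℝ ℂ).symm (𝓕 (gaussL2 a)) = gaussL2 a :=
      (Lp.fourierTransformₗᵢ ℝ ℂ).symm_apply_apply _
    rw [h3]
    apply Lp.ext
    filter_upwards [affineIso_ae _ (inv_pos.2 hN) 0 (gaussL2 a),
      ae_affine (inv_pos.2 hN) 0 (gaussL2_ae a), gaussL2_ae g] with x hx hx' hx''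
    rw [hx, hx', hx'']
    change _ * ((Real.sqrt N : ℂ) * (g : ℂ → ℂ) ((N : ℝ) * (((N : ℝ)⁻¹ * x + 0 : ℝ) : ℂ))) = _
    have h4 : ((N : ℝ) : ℂ) * (((N : ℝ)⁻¹ * x + 0 : ℝ) : ℂ) = x := by
      rw [← Complex.ofReal_mul, add_zero, mul_inv_cancel_left₀ hN.ne']
    have h5 : (Real.sqrt N : ℂ) ≠ 0 := by simpa using NeZero.ne N
    rw [h4, Real.sqrt_inv, Complex.ofReal_inv, inv_mul_cancel_left₀ h5]
  -- Constant families over ℤ/N make the injectivity of `toHS` applicable to a single component.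
  have h3 : toHS N ⟨fun _ => (gaussComp N f : ℂ → ℂ), Submodule.mem_pi.2 fun _ _ => (gaussComp N f).2⟩ =
      toHS N ⟨fun _ => (g : ℂ → ℂ), Submodule.mem_pi.2 fun _ _ => g.2⟩ := by
    ext1 m
    exact (fourierComp_gauss N f).symm.trans h2
  have h4 := congrFun (congrArg Subtype.val (toHS_injective N h3)) 0
  exact Subtype.ext h4

/-- `ℱ` on `𝒲`. -/
noncomputable def fourierW (f : W N) : W N :=
  ⟨fun m z => (N : ℂ)⁻¹ * ∑ j, (ZMod.stdAddChar (-(j * m)) : ℂ) *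
    gaussFourier (2 * Real.pi * I / N) ((f : ZMod N → ℂ → ℂ) j) z, Submodule.mem_pi.2 fun m _ => by
    have h : (fun z => (N : ℂ)⁻¹ * ∑ j, (ZMod.stdAddChar (-(j * m)) : ℂ) *
        gaussFourier (2 * Real.pi * I / N) ((f : ZMod N → ℂ → ℂ) j) z) =
        (N : ℂ)⁻¹ • ∑ j, (ZMod.stdAddChar (-(j * m)) : ℂ) •
          gaussFourier (2 * Real.pi * I / N) ((f : ZMod N → ℂ → ℂ) j) := by
      funext z
      simp [Finset.sum_apply]
    rw [h]
    exact Submodule.smul_mem _ _ (Submodule.sum_mem _ fun j _ => Submodule.smul_mem _ _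
      (gaussFourier_mem (twoPiI_div_re N) (twoPiI_div_ne_zero N) (W_mem f j)))⟩

variable {N}

theorem fourierU_apply (x : HS N) (m : ZMod N) :
    (fourierU N x) m = fourierComp N ((Real.sqrt N : ℂ)⁻¹ • ZMod.dft (WithLp.ofLp x) m) := rfl

theorem fourierU_toHS (f : W N) : fourierU N (toHS N f) = toHS N (fourierW N f) := by
  ext1 m
  rw [fourierU_apply, ZMod.dft_apply, toHS_apply, map_smul, map_sum]
  have h1 : ∀ j, fourierComp N ((ZMod.stdAddChar (-(j * m)) : ℂ) • (toHS N f) j) =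
      gaussL2 ((ZMod.stdAddChar (-(j * m)) : ℂ) • gaussComp N (W.comp f j)) := fun j => by
    rw [map_smul, toHS_apply, fourierComp_gauss, ← map_smul]
  have h2 : ∑ j, fourierComp N ((ZMod.stdAddChar (-(j * m)) : ℂ) • (toHS N f) j) =
      ∑ j, gaussL2 ((ZMod.stdAddChar (-(j * m)) : ℂ) • gaussComp N (W.comp f j)) :=
    Finset.sum_congr rfl fun j _ => h1 j
  refine (congrArg _ h2).trans ?_
  rw [← map_sum, ← map_smul]
  congr 1
  apply Subtype.ext
  funext z
  have h5 : (Real.sqrt N : ℂ)⁻¹ * (Real.sqrt N : ℂ)⁻¹ = (N : ℂ)⁻¹ := by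
    rw [← mul_inv, ← Complex.ofReal_mul, Real.mul_self_sqrt (Nat.cast_nonneg N)]; simp
  change (Real.sqrt N : ℂ)⁻¹ * ((∑ j, (ZMod.stdAddChar (-(j * m)) : ℂ) •
    gaussComp N (W.comp f j) : gaussW) : ℂ → ℂ) z = (N : ℂ)⁻¹ * _
  rw [← h5, mul_assoc]
  congr 1
  rw [Submodule.coe_sum, Finset.sum_apply, Finset.mul_sum]
  refine Finset.sum_congr rfl fun j _ => ?_
  change _ * ((Real.sqrt N : ℂ)⁻¹ * _) = _
  rw [mul_left_comm]
  rfl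

theorem fourierW_surjective : Function.Surjective (fourierW N) := by
  intro g
  choose p hp using fun m => gaussComp_surjective N (W.comp g m)
  have h0 : (Real.sqrt N : ℂ) ≠ 0 := by simpa using NeZero.ne N
  set F : ZMod N → gaussW := ZMod.dft.symm fun m => (Real.sqrt N : ℂ) • p m with hF
  set f : W N := ⟨fun m => (F m : ℂ → ℂ), Submodule.mem_pi.2 fun m _ => (F m).2⟩ with hf
  refine ⟨f, toHS_injective N ?_⟩
  rw [← fourierU_toHS]
  ext1 m
  rw [fourierU_apply, toHS_apply, ← hp, ← fourierComp_gauss]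
  congr 1
  have h1 : ZMod.dft (WithLp.ofLp (toHS N f)) m = gaussL2 (ZMod.dft F m) := by
    rw [ZMod.dft_apply, ZMod.dft_apply, map_sum]
    refine Finset.sum_congr rfl fun j _ => ?_
    rw [map_smul]; rfl
  rw [h1, hF, LinearEquiv.apply_symm_apply, map_smul, inv_smul_smul₀ h0]

/-- Linearity and injectivity of φ are inherited from V through the injectivity of `toHS`; only
surjectivity has to be supplied. -/
theorem exists_lift {V : HS N ≃ₗᵢ[ℂ] HS N} {φ : W N → W N}
    (h : ∀ f, V (toHS N f) = toHS N (φ f)) (hs : Function.Surjective φ) :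
    ∃ e : W N ≃ₗ[ℂ] W N, LiftsTo V e ∧ ∀ f, e f = φ f := by
  refine ⟨LinearEquiv.ofBijective { toFun := φ, map_add' := fun f g => ?_, map_smul' := fun c f => ?_ }
    ⟨fun f g hfg => ?_, hs⟩, h, fun f => rfl⟩
  · apply toHS_injective N
    rw [← h, map_add, map_add, map_add, h, h]
  · apply toHS_injective N
    rw [← h, map_smul, map_smul, h, RingHom.id_apply, map_smul]
  · apply toHS_injective N
    apply V.injective
    rw [h, h]
    exact congrArg _ hfg

/-- The contour shift by ib produces the exponential in z, and the reindexing j ↦ j + 1 produces the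
character of m. Their product is y(z, m). -/
theorem fourierW_u (b : ℂ) (f : W N) : fourierW N (uOp N b f) = yOp N b (fourierW N f) := by
  ext m z
  change (N : ℂ)⁻¹ * ∑ j, (ZMod.stdAddChar (-(j * m)) : ℂ) * gaussFourier (2 * Real.pi * I / N)
      (fun w => (f : ZMod N → ℂ → ℂ) (j - 1) (w + I * b)) z =
    yFun N b m z * ((N : ℂ)⁻¹ * ∑ j, (ZMod.stdAddChar (-(j * m)) : ℂ) *
      gaussFourier (2 * Real.pi * I / N) ((f : ZMod N → ℂ → ℂ) j) z)
  rw [mul_left_comm (yFun N b m z), Finset.mul_sum _ _ (yFun N b m z)]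
  refine congrArg ((N : ℂ)⁻¹ * ·) ?_
  refine (Equiv.sum_comp (Equiv.addRight (1 : ZMod N)) _).symm.trans ?_
  refine Finset.sum_congr rfl fun j _ => ?_
  simp only [Equiv.coe_addRight, add_sub_cancel_right]
  rw [gaussFourier_shift _ (W_mem f j), yFun_eq, add_mul, one_mul, neg_add,
    AddChar.map_add_eq_mul]
  have : -(2 * Real.pi * I / N * z * (I * b)) = 2 * Real.pi / N * b * z := by
    linear_combination (-(2 * Real.pi / N * b * z) : ℂ) * I_sq
  rw [this]
  ring

/-- The exponential in y translates the argument of the transform by -ib, and its character raises m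
by one; no contour has to be moved. -/
theorem fourierW_y (b : ℂ) (f : W N) :
    fourierW N (yOp N b f) = (uOp N b).symm (fourierW N f) := by
  ext m z
  change (N : ℂ)⁻¹ * ∑ j, (ZMod.stdAddChar (-(j * m)) : ℂ) * gaussFourier (2 * Real.pi * I / N)
      (fun w => yFun N b j w * (f : ZMod N → ℂ → ℂ) j w) z =
    (N : ℂ)⁻¹ * ∑ j, (ZMod.stdAddChar (-(j * (m + 1))) : ℂ) *
      gaussFourier (2 * Real.pi * I / N) ((f : ZMod N → ℂ → ℂ) j) (z + -(I * b))
  congr 1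
  refine Finset.sum_congr rfl fun j _ => ?_
  have h1 : (fun w => yFun N b j w * (f : ZMod N → ℂ → ℂ) j w) = fun w =>
      exp (2 * Real.pi / N * b * w + -(2 * Real.pi * I / N * (j.val : ℂ))) *
        (f : ZMod N → ℂ → ℂ) j w := by
    funext w
    rw [yFun_eq, AddChar.map_neg_eq_inv, stdAddChar_val, ← Complex.exp_neg, ← Complex.exp_add,
      add_comm]
  rw [h1, gaussFourier_exp (t := -(I * b)), mul_add, mul_one, neg_add, AddChar.map_add_eq_mul,
    AddChar.map_neg_eq_inv _ j, stdAddChar_val j, Complex.exp_neg]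
  · ring
  · linear_combination (-(2 * Real.pi / N * b) : ℂ) * I_sq

end

end LevelN

/-! ### The generators on 𝒲, closability, and the conjugations of part (2). -/

namespace LevelN

section

variable (N : ℕ) (b : ℂ)

/-- `𝐮` as an endomorphism of `𝒲`. -/
def uEnd : Module.End ℂ (W N) := (uOp N b : W N →ₗ[ℂ] W N)

/-- `𝐮⁻¹` as an endomorphism of `𝒲`. -/
def uInvEnd : Module.End ℂ (W N) := ((uOp N b).symm : W N →ₗ[ℂ] W N)

/-- `𝐲` as an endomorphism of `𝒲`. -/
noncomputable def yEnd : Module.End ℂ (W N) := (yOp N b : W N →ₗ[ℂ] W N)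

/-- `𝐲⁻¹` as an endomorphism of `𝒲`. -/
noncomputable def yInvEnd : Module.End ℂ (W N) := ((yOp N b).symm : W N →ₗ[ℂ] W N)

theorem Q₁''_eq (l₁ l₂ : ℂ) :
    Q₁'' N b l₁ l₂ = l₂ • uInvEnd N b + l₂⁻¹ • uEnd N b + l₁⁻¹ • yInvEnd N b := by
  ext1 f
  simp [Q₁'', torusOp, uEnd, uInvEnd, yInvEnd]

theorem LOp_eq : LOp N b = yInvEnd N b + yEnd N b + uEnd N b := by
  ext1 f
  simp [LOp, torusOp, uEnd, yEnd, yInvEnd]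

theorem intCast_smul_LOp (σ : ℤˣ) : ((σ : ℤ) : ℂ) • LOp N b = (σ : ℤ) • LOp N b := by
  ext1 f
  rw [LinearMap.smul_apply, LinearMap.smul_apply]
  rcases Int.units_eq_one_or σ with rfl | rfl
  · simp
  · simp only [Units.val_neg, Units.val_one, Int.cast_neg, Int.cast_one, neg_smul, one_smul]

theorem Q₁'_eq (l₁ l₂ : ℂ) :
    Q₁' N b l₁ l₂ = q N b • (uInvEnd N b * yEnd N b) + q N b • (uEnd N b * yInvEnd N b) +
      (l₁ + l₁⁻¹) • yInvEnd N b + (l₂ + l₂⁻¹) • uInvEnd N b +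
      (q N b)⁻¹ • (uInvEnd N b * yInvEnd N b) := by
  ext1 f
  simp [Q₁', torusOp, uEnd, uInvEnd, yEnd, yInvEnd]

end

section

variable {N : ℕ}

variable (N) in
/-- The shift `𝒮` on `𝒲`. -/
def shiftW (μ₁ : ℝ) (m₁ : ZMod N) (f : W N) : W N :=
  ⟨fun m z => (f : ZMod N → ℂ → ℂ) (m - m₁) (z + -μ₁),
    Submodule.mem_pi.2 fun m _ => gaussW_shift (W_mem f (m - m₁)) _⟩

theorem shiftW_surjective (μ₁ : ℝ) (m₁ : ZMod N) : Function.Surjective (shiftW N μ₁ m₁) := by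
  intro f
  refine ⟨shiftW N (-μ₁) (-m₁) f, ?_⟩
  ext m z
  simp [shiftW]

variable (N) in
/-- The multiplication operator `𝒟` on `𝒲`. -/
noncomputable def phaseW (μ₂ : ℝ) (m₂ : ZMod N) (f : W N) : W N :=
  ⟨fun m z => exp (-(2 * Real.pi * I / N) * (μ₂ * z - (m₂.val : ℂ) * (m.val : ℂ))) *
      (f : ZMod N → ℂ → ℂ) m z,
    Submodule.mem_pi.2 fun m _ => by
      convert gaussW_exp (W_mem f m) (-(2 * Real.pi * I / N) * μ₂)
        ((2 * Real.pi * I / N) * ((m₂.val : ℂ) * (m.val : ℂ))) using 3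
      congr 1; ring⟩

theorem phaseW_surjective (μ₂ : ℝ) (m₂ : ZMod N) : Function.Surjective (phaseW N μ₂ m₂) := by
  intro f
  refine ⟨⟨fun m z => exp (2 * Real.pi * I / N * (μ₂ * z - (m₂.val : ℂ) * (m.val : ℂ))) *
      (f : ZMod N → ℂ → ℂ) m z, Submodule.mem_pi.2 fun m _ => by
      convert gaussW_exp (W_mem f m) ((2 * Real.pi * I / N) * μ₂)
        (-((2 * Real.pi * I / N) * ((m₂.val : ℂ) * (m.val : ℂ)))) using 3
      congr 1; ring⟩, ?_⟩
  ext m z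
  change exp _ * (exp _ * _) = _
  rw [← mul_assoc, ← Complex.exp_add, neg_mul, neg_add_cancel, Complex.exp_zero, one_mul]

variable [NeZero N] {b : ℂ}

theorem exists_fourier_lift : ∃ e : W N ≃ₗ[ℂ] W N, LiftsTo (fourierU N) e ∧
    (∀ b f, e (uEnd N b f) = yEnd N b (e f)) ∧ (∀ b f, e (uInvEnd N b f) = yInvEnd N b (e f)) ∧
    (∀ b f, e (yEnd N b f) = uInvEnd N b (e f)) ∧ (∀ b f, e (yInvEnd N b f) = uEnd N b (e f)) := by
  obtain ⟨e, he, h⟩ := exists_lift fourierU_toHS (fourierW_surjective (N := N))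
  have hu : ∀ b f, e (uEnd N b f) = yEnd N b (e f) := fun b f => by
    rw [h, h]; exact fourierW_u b f
  have hy : ∀ b f, e (yEnd N b f) = uInvEnd N b (e f) := fun b f => by
    rw [h, h]; exact fourierW_y b f
  refine ⟨e, he, hu, fun b f => ?_, hy, fun b f => ?_⟩
  · have h1 := hu b (uInvEnd N b f)
    rw [show uEnd N b (uInvEnd N b f) = f from (uOp N b).apply_symm_apply f] at h1
    rw [h1]; exact ((yOp N b).symm_apply_apply _).symm
  · have h1 := hy b (yInvEnd N b f)
    rw [show yEnd N b (yInvEnd N b f) = f from (yOp N b).apply_symm_apply f] at h1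
    rw [h1]; exact ((uOp N b).apply_symm_apply _).symm

theorem gaussW_mul_exp_inner {p p' : ZMod N → ℂ → ℂ} {f g h k : W N}
    (hf : ∀ m z, (h : ZMod N → ℂ → ℂ) m z = p m z * (f : ZMod N → ℂ → ℂ) m z)
    (hg : ∀ m z, (k : ZMod N → ℂ → ℂ) m z = p' m z * (g : ZMod N → ℂ → ℂ) m z)
    (hp : ∀ m (x : ℝ), conj (p m x) = p' m x) :
    inner ℂ (toHS N g) (toHS N h) = inner ℂ (toHS N k) (toHS N f) := by
  rw [hs_inner, hs_inner]
  refine Finset.sum_congr rfl fun m _ => integral_congr_ae ?_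
  filter_upwards [toHS_ae f m, toHS_ae g m, toHS_ae h m, toHS_ae k m] with x h1 h2 h3 h4
  rw [h1, h2, h3, h4, hf, hg, ← hp, map_mul, Complex.conj_conj]
  ring

/-- The adjoint is multiplication by ỹ, which equals the conjugate of y on ℝ because b⁻¹ is the
conjugate of b. Being an exponential, it preserves 𝒲. -/
theorem hasFormalAdjoint_y (hb : IsParam b) : HasFormalAdjoint (yEnd N b) := by
  have hm : ∀ g : W N, (fun m z => ytFun N b m z * (g : ZMod N → ℂ → ℂ) m z) ∈ W N := fun g =>
    Submodule.mem_pi.2 fun m _ => by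
      convert gaussW_exp (W_mem g m) (2 * Real.pi * I / N * (-I * b⁻¹))
        (2 * Real.pi * I / N * (m.val : ℂ)) using 3
      rw [ytFun]; congr 1; ring
  exact ⟨fun g => ⟨_, hm g⟩, fun f g => gaussW_mul_exp_inner (fun m z => rfl)
    (fun m z => rfl) fun m x => hb.conj_y N m x⟩

theorem hasFormalAdjoint_y_inv (hb : IsParam b) : HasFormalAdjoint (yInvEnd N b) := by
  have hm : ∀ g : W N, (fun m z => (ytFun N b m z)⁻¹ * (g : ZMod N → ℂ → ℂ) m z) ∈ W N :=
    fun g => Submodule.mem_pi.2 fun m _ => by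
      convert gaussW_exp (W_mem g m) (-(2 * Real.pi * I / N * (-I * b⁻¹)))
        (-(2 * Real.pi * I / N * (m.val : ℂ))) using 3
      rw [ytFun, ← Complex.exp_neg]; congr 1; ring
  exact ⟨fun g => ⟨_, hm g⟩, fun f g => gaussW_mul_exp_inner (p := fun m z => (yFun N b m z)⁻¹)
    (fun m z => rfl) (fun m z => rfl) fun m x => by rw [map_inv₀, hb.conj_y N m x]⟩

/-- Transported from 𝐲 by ℱ. -/
theorem hasFormalAdjoint_u (hb : IsParam b) : HasFormalAdjoint (uEnd N b) := by
  obtain ⟨e, he, hu, -⟩ := exists_fourier_lift (N := N)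
  exact HasFormalAdjoint.conj he (hu b) (hasFormalAdjoint_y hb)

theorem hasFormalAdjoint_u_inv (hb : IsParam b) : HasFormalAdjoint (uInvEnd N b) := by
  obtain ⟨e, he, -, hu, -⟩ := exists_fourier_lift (N := N)
  exact HasFormalAdjoint.conj he (hu b) (hasFormalAdjoint_y_inv hb)

theorem isClosable_Q₁'' (hb : IsParam b) (l₁ l₂ : ℂ) : (toPMap (Q₁'' N b l₁ l₂)).IsClosable := by
  rw [Q₁''_eq]
  exact ((((hasFormalAdjoint_u_inv hb).smul _).add ((hasFormalAdjoint_u hb).smul _)).add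
    ((hasFormalAdjoint_y_inv hb).smul _)).isClosable

theorem isClosable_Q₁' (hb : IsParam b) (l₁ l₂ : ℂ) : (toPMap (Q₁' N b l₁ l₂)).IsClosable := by
  have u := hasFormalAdjoint_u (N := N) hb
  have u' := hasFormalAdjoint_u_inv (N := N) hb
  have y := hasFormalAdjoint_y (N := N) hb
  have y' := hasFormalAdjoint_y_inv (N := N) hb
  rw [Q₁'_eq]
  exact (((((u'.mul y).smul _).add ((u.mul y').smul _)).add (y'.smul _)).add
    (u'.smul _)).add ((u'.mul y').smul _) |>.isClosable

theorem hasFormalAdjoint_LOp (hb : IsParam b) : HasFormalAdjoint (LOp N b) := by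
  rw [LOp_eq]
  exact ((hasFormalAdjoint_y_inv hb).add (hasFormalAdjoint_y hb)).add (hasFormalAdjoint_u hb)

theorem shiftU_toHS (μ₁ : ℝ) (m₁ : ZMod N) (f : W N) :
    shiftU N μ₁ m₁ (toHS N f) = toHS N (shiftW N μ₁ m₁ f) := by
  ext1 m
  apply Lp.ext
  change affineIso 1 one_pos (-μ₁) (gaussL2 (W.comp f ((Equiv.addRight m₁).symm m))) =ᵐ[volume] _
  rw [show (Equiv.addRight m₁).symm m = m - m₁ by simp [sub_eq_add_neg]]
  filter_upwards [affineIso_ae 1 one_pos (-μ₁) (gaussL2 (W.comp f (m - m₁))),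
    ae_affine one_pos (-μ₁) (gaussL2_ae (W.comp f (m - m₁))),
    toHS_ae (shiftW N μ₁ m₁ f) m] with x h1 h2 h3
  rw [h1, h2, h3]
  simp [shiftW, W.comp]

theorem phaseU_toHS (μ₂ : ℝ) (m₂ : ZMod N) (f : W N) :
    phaseU N μ₂ m₂ (toHS N f) = toHS N (phaseW N μ₂ m₂ f) := by
  ext1 m
  apply Lp.ext
  filter_upwards [mulIso_ae (fun x : ℝ =>
      exp (-(2 * Real.pi * I / N) * (μ₂ * x - (m₂.val : ℂ) * (m.val : ℂ)))) (by fun_prop)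
      (Filter.Eventually.of_forall fun x => by
        have h : -(2 * Real.pi * I / N) * (μ₂ * x - (m₂.val : ℂ) * (m.val : ℂ)) =
            ((-(2 * Real.pi / N) * (μ₂ * x - m₂.val * m.val) : ℝ) : ℂ) * I := by
          push_cast; ring
        rw [h, Complex.norm_exp_ofReal_mul_I]) (toHS N f m), toHS_ae f m,
    toHS_ae (phaseW N μ₂ m₂ f) m] with x h1 h2 h3
  rw [h3]
  refine h1.trans ?_
  rw [h2]
  rfl

/-- Rewriting with the additive character shows that the phase depends on the product m₂m only
modulo N, so m may be replaced by m - 1 although `val` is not additive. -/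
theorem phase_eq (μ₂ z : ℂ) (m₂ m : ZMod N) :
    exp (-(2 * Real.pi * I / N) * (μ₂ * z - (m₂.val : ℂ) * (m.val : ℂ))) =
      exp (-(2 * Real.pi * I / N) * (μ₂ * z)) * ZMod.stdAddChar (m₂ * m) := by
  have h := ZMod.stdAddChar_coe (N := N) ((m₂.val : ℤ) * (m.val : ℤ))
  push_cast at h
  rw [ZMod.natCast_zmod_val, ZMod.natCast_zmod_val] at h
  rw [h, ← Complex.exp_add]
  congr 1; ring

theorem conjugates_shift {l₂ l₁ : ℂ} (μ₁ : ℝ) (m₁ : ZMod N) :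
    Conjugates (shiftU N μ₁ m₁) (l₂ • uInvEnd N b + l₂⁻¹ • uEnd N b + l₁⁻¹ • yInvEnd N b)
      (l₂ • uInvEnd N b + l₂⁻¹ • uEnd N b + (l₁⁻¹ * yFun N b m₁ μ₁) • yInvEnd N b) := by
  obtain ⟨e, he, h⟩ := exists_lift (shiftU_toHS μ₁ m₁) (shiftW_surjective (N := N) μ₁ m₁)
  refine he.conjugates fun f => ?_
  have h1 : e (uEnd N b f) = uEnd N b (e f) := by
    rw [h, h]
    ext m z
    change (f : ZMod N → ℂ → ℂ) (m - m₁ - 1) (z + -μ₁ + I * b) =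
      (f : ZMod N → ℂ → ℂ) (m - 1 - m₁) (z + I * b + -μ₁)
    rw [sub_right_comm, add_right_comm]
  have h2 : e (uInvEnd N b f) = uInvEnd N b (e f) := by
    rw [h, h]
    ext m z
    change (f : ZMod N → ℂ → ℂ) (m - m₁ + 1) (z + -μ₁ + -(I * b)) =
      (f : ZMod N → ℂ → ℂ) (m + 1 - m₁) (z + -(I * b) + -μ₁)
    rw [sub_add_eq_add_sub, add_right_comm]
  have h3 : e (yInvEnd N b f) = yFun N b m₁ μ₁ • yInvEnd N b (e f) := by
    rw [h, h]
    ext m z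
    change (yFun N b (m - m₁) (z + -μ₁))⁻¹ * (f : ZMod N → ℂ → ℂ) (m - m₁) (z + -μ₁) =
      yFun N b m₁ μ₁ * ((yFun N b m z)⁻¹ * (f : ZMod N → ℂ → ℂ) (m - m₁) (z + -μ₁))
    rw [sub_eq_add_neg, yFun_add, yFun_neg, mul_inv, inv_inv]
    ring
  simp only [LinearMap.add_apply, LinearMap.smul_apply, map_add, map_smul, h1, h2, h3, smul_smul]

theorem conjugates_phase {l₂ c : ℂ} (μ₂ : ℝ) (m₂ : ZMod N) :
    Conjugates (phaseU N μ₂ m₂)⁻¹ (l₂ • uInvEnd N b + l₂⁻¹ • uEnd N b + c • yInvEnd N b)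
      ((l₂ * (yFun N b m₂ μ₂)⁻¹) • uInvEnd N b + (l₂⁻¹ * yFun N b m₂ μ₂) • uEnd N b +
        c • yInvEnd N b) := by
  obtain ⟨e, he, h⟩ := exists_lift (phaseU_toHS μ₂ m₂) (phaseW_surjective (N := N) μ₂ m₂)
  refine (he.conjugates fun f => ?_).inv
  have h1 : ∀ f, uEnd N b (e f) = yFun N b m₂ μ₂ • e (uEnd N b f) := by
    intro f
    rw [h, h]
    ext m z
    change exp (-(2 * Real.pi * I / N) * (μ₂ * (z + I * b) - (m₂.val : ℂ) * ((m - 1).val : ℂ))) *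
        (f : ZMod N → ℂ → ℂ) (m - 1) (z + I * b) = yFun N b m₂ μ₂ *
      (exp (-(2 * Real.pi * I / N) * (μ₂ * z - (m₂.val : ℂ) * (m.val : ℂ))) *
        (f : ZMod N → ℂ → ℂ) (m - 1) (z + I * b))
    rw [phase_eq, phase_eq, yFun_eq, mul_sub, mul_one, sub_eq_add_neg, AddChar.map_add_eq_mul]
    have : exp (-(2 * Real.pi * I / N) * (μ₂ * (z + I * b))) =
        exp (2 * Real.pi / N * b * μ₂) * exp (-(2 * Real.pi * I / N) * (μ₂ * z)) := by
      rw [← Complex.exp_add]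
      congr 1
      linear_combination (-(2 * Real.pi / N * b * μ₂) : ℂ) * I_sq
    rw [this]; ring
  have h2 : uInvEnd N b (e f) = (yFun N b m₂ μ₂)⁻¹ • e (uInvEnd N b f) := by
    have h4 := h1 (uInvEnd N b f)
    rw [show uEnd N b (uInvEnd N b f) = f from (uOp N b).apply_symm_apply f] at h4
    rw [show e f = (yFun N b m₂ μ₂)⁻¹ • uEnd N b (e (uInvEnd N b f)) by
      rw [h4, inv_smul_smul₀ (yFun_ne_zero N b m₂ μ₂)], map_smul]
    congr 1
    exact (uOp N b).symm_apply_apply _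
  have h3 : e (yInvEnd N b f) = yInvEnd N b (e f) := by
    rw [h, h]
    ext m z
    exact mul_left_comm _ _ _
  simp only [LinearMap.add_apply, LinearMap.smul_apply, map_add, map_smul, h1, h2, h3, smul_smul]

theorem conjugates_fourier (a₁ a₂ a₃ : ℂ) :
    Conjugates (fourierU N) (a₁ • uInvEnd N b + a₂ • uEnd N b + a₃ • yInvEnd N b)
      (a₁ • yInvEnd N b + a₂ • yEnd N b + a₃ • uEnd N b) := by
  obtain ⟨e, he, hu, hu', hy, hy'⟩ := exists_fourier_lift (N := N)
  refine he.conjugates fun f => ?_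
  simp only [LinearMap.add_apply, LinearMap.smul_apply, map_add, map_smul, hu, hu', hy']

/-- The translation normalizes the coefficient of 𝐲⁻¹ and the phase those of 𝐮 and 𝐮⁻¹. Since σ⁻¹ =
σ, all three become σ, and ℱ then turns the sum into σ𝐋. -/
theorem conjugates_LOp (σ : ℤˣ) (μ₁ μ₂ : ℝ) (m₁ m₂ : ZMod N) {l₁ l₂ : ℂ}
    (h₁ : l₁ = (σ : ℤ) * yFun N b m₁ μ₁) (h₂ : l₂ = (σ : ℤ) * yFun N b m₂ μ₂) :
    Conjugates (fourierU N * (phaseU N μ₂ m₂)⁻¹ * shiftU N μ₁ m₁) (Q₁'' N b l₁ l₂)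
      ((σ : ℤ) • LOp N b) := by
  have hσ : ((σ : ℤ) : ℂ)⁻¹ = (σ : ℤ) := by
    rcases Int.units_eq_one_or σ with rfl | rfl <;> simp
  have e1 : l₁⁻¹ * yFun N b m₁ μ₁ = (σ : ℤ) := by
    rw [h₁, mul_inv, hσ, inv_mul_cancel_right₀ (yFun_ne_zero _ _ _ _)]
  have e2 : l₂⁻¹ * yFun N b m₂ μ₂ = (σ : ℤ) := by
    rw [h₂, mul_inv, hσ, inv_mul_cancel_right₀ (yFun_ne_zero _ _ _ _)]
  have e3 : l₂ * (yFun N b m₂ μ₂)⁻¹ = (σ : ℤ) := by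
    rw [h₂, mul_inv_cancel_right₀ (yFun_ne_zero _ _ _ _)]
  have h := conjugates_shift (b := b) (l₁ := l₁) (l₂ := l₂) μ₁ m₁
  rw [e1, ← Q₁''_eq] at h
  have h' := (conjugates_phase (b := b) (l₂ := l₂) (c := (σ : ℤ)) μ₂ m₂).mul h
  rw [e2, e3] at h'
  have h'' := (conjugates_fourier (b := b) _ _ _).mul h'
  rw [← smul_add, ← smul_add, ← LOp_eq] at h''
  rw [intCast_smul_LOp] at h''
  rwa [mul_assoc]

end

end LevelN

namespace LevelN

open scoped FourierTransform Topology

/-! ### Difference operators tested against linear functionals -/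

/-- Continuous functions on `ℝ` of at most exponential growth. -/
def ExpBdd (g : ℝ → ℂ) : Prop :=
  Continuous g ∧ ∃ C K : ℝ, 0 ≤ C ∧ ∀ x, ‖g x‖ ≤ C * Real.exp (K * |x|)

theorem ExpBdd.mul {g h : ℝ → ℂ} (hg : ExpBdd g) (hh : ExpBdd h) :
    ExpBdd fun x => g x * h x := by
  obtain ⟨gc, C, K, hC, hb⟩ := hg
  obtain ⟨hc, C', K', hC', hb'⟩ := hh
  refine ⟨gc.mul hc, C * C', K + K', by positivity, fun x => ?_⟩
  rw [norm_mul, add_mul, Real.exp_add]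
  calc ‖g x‖ * ‖h x‖ ≤ (C * Real.exp (K * |x|)) * (C' * Real.exp (K' * |x|)) := by
        gcongr
        · exact hb x
        · exact hb' x
    _ = _ := by ring

theorem ExpBdd.add {g h : ℝ → ℂ} (hg : ExpBdd g) (hh : ExpBdd h) :
    ExpBdd fun x => g x + h x := by
  obtain ⟨gc, C, K, hC, hb⟩ := hg
  obtain ⟨hc, C', K', hC', hb'⟩ := hh
  refine ⟨gc.add hc, C + C', max K K', by positivity, fun x => ?_⟩
  calc ‖g x + h x‖ ≤ C * Real.exp (K * |x|) + C' * Real.exp (K' * |x|) :=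
        (norm_add_le _ _).trans (add_le_add (hb x) (hb' x))
    _ ≤ C * Real.exp (max K K' * |x|) + C' * Real.exp (max K K' * |x|) := by
        gcongr <;> simp
    _ = _ := by ring

theorem expBdd_const (c : ℂ) : ExpBdd fun _ => c :=
  ⟨continuous_const, ‖c‖, 0, norm_nonneg _, fun x => by simp⟩

theorem expBdd_exp (s t : ℂ) : ExpBdd fun x : ℝ => exp (s * x + t) := by
  refine ⟨by fun_prop, Real.exp t.re, ‖s‖, (Real.exp_pos _).le, fun x => ?_⟩
  rw [Complex.norm_exp, ← Real.exp_add, Real.exp_le_exp, add_comm, add_re]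
  gcongr
  exact (Complex.re_le_norm _).trans (by simp)

theorem memLp_two_of_gauss {g : ℝ → ℂ} (hg : Continuous g) {C ε : ℝ} (hε : 0 < ε)
    (hb : ∀ x, ‖g x‖ ≤ C * Real.exp (-ε * x ^ 2)) : MemLp g 2 volume := by
  have h1 : MemLp (fun x : ℝ => C * Real.exp (-ε * x ^ 2)) 2 volume := by
    rw [memLp_two_iff_integrable_sq (by fun_prop)]
    refine ((integrable_exp_neg_mul_sq (b := 2 * ε) (by positivity)).const_mul (C ^ 2)).congr
      (Filter.Eventually.of_forall fun x => ?_)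
    simp only
    rw [mul_pow, ← Real.exp_nat_mul]
    congr 2; push_cast; ring
  exact h1.mono' hg.aestronglyMeasurable (Filter.Eventually.of_forall hb)

theorem ExpBdd.gauss_mul {p g : ℝ → ℂ} (hp : ExpBdd p) {C ε : ℝ} (hε : 0 < ε)
    (hb : ∀ x, ‖g x‖ ≤ C * Real.exp (-ε * x ^ 2)) :
    ∃ D ε' : ℝ, 0 ≤ D ∧ 0 < ε' ∧ ∀ x, ‖p x * g x‖ ≤ D * Real.exp (-ε' * x ^ 2) := by
  obtain ⟨-, C', K, hC', hp⟩ := hp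
  have hC : 0 ≤ C := by simpa using (norm_nonneg _).trans (hb 0)
  obtain ⟨D, ε', hD, hε', h⟩ := exists_gauss_bound_of_exp (C := C) (C' := C') (K := K) hε hC hC'
  refine ⟨D, ε', hD, hε', fun x => (le_trans ?_ (h x))⟩
  rw [norm_mul]
  gcongr
  · exact hp x
  · exact hb x

theorem gaussW_shift_bound {f : ℂ → ℂ} (hf : f ∈ gaussW) (β : ℂ) :
    Continuous (fun x : ℝ => f (x + β)) ∧ ∃ C ε : ℝ, 0 < ε ∧
      ∀ x : ℝ, ‖f (x + β)‖ ≤ C * Real.exp (-ε * x ^ 2) := by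
  have h := gaussW_shift hf β
  obtain ⟨C, ε, hC, hε, hb⟩ := gaussW_bound h 0
  exact ⟨(gaussW_differentiable h).continuous.comp Complex.continuous_ofReal, C, ε, hε,
    fun x => by simpa using hb x (by simp)⟩

theorem ExpBdd.memLp_mul_gaussW {p : ℝ → ℂ} (hp : ExpBdd p) {f : ℂ → ℂ} (hf : f ∈ gaussW)
    (β : ℂ) : MemLp (fun x : ℝ => p x * f (x + β)) 2 volume := by
  obtain ⟨hc, C, ε, hε, hb⟩ := gaussW_shift_bound hf β
  obtain ⟨D, ε', -, hε', h⟩ := hp.gauss_mul hε hb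
  exact memLp_two_of_gauss (hp.1.mul hc) hε' h

theorem memLp_conj {N : ℕ} (w : HS N) (m : ZMod N) :
    MemLp (fun x => conj ((w m : L2R) x)) 2 volume := (Lp.memLp (w m)).star

theorem integral_add_four {f₁ f₂ f₃ f₄ : ℝ → ℂ} (h₁ : Integrable f₁) (h₂ : Integrable f₂)
    (h₃ : Integrable f₃) (h₄ : Integrable f₄) :
    (∫ x, f₁ x) + ((∫ x, f₂ x) + (∫ x, f₃ x) + ∫ x, f₄ x) =
      ∫ x, (f₁ x + (f₂ x + f₃ x + f₄ x)) := by
  have h := integral_add h₁ ((h₂.add h₃).add h₄)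
  rw [integral_add' (h₂.add h₃) h₄, integral_add' h₂ h₃] at h
  exact h.symm

section

variable {N : ℕ}

/-- `A` is the difference operator
`f ↦ a₋(m,z) f(m + k, z - β) + a₀(m,z) f(m,z) + a₊(m,z) f(m - k, z + β)`, with coefficients of
at most exponential growth. -/
structure HasCoeffs (k : ZMod N) (β : ℂ) (A : Module.End ℂ (W N))
    (am a0 ap : ZMod N → ℂ → ℂ) : Prop where
  eq : ∀ (f : W N) m z, (A f : ZMod N → ℂ → ℂ) m z = am m z * (f : ZMod N → ℂ → ℂ) (m + k) (z - β) +
    a0 m z * (f : ZMod N → ℂ → ℂ) m z + ap m z * (f : ZMod N → ℂ → ℂ) (m - k) (z + β)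
  bm : ∀ m, ExpBdd fun x : ℝ => am m x
  b0 : ∀ m, ExpBdd fun x : ℝ => a0 m x
  bp : ∀ m, ExpBdd fun x : ℝ => ap m x

/-- Exchanging the two shifts allows the same argument to serve the inverse unitary, whose
multiplier lives in the opposite half plane. -/
theorem HasCoeffs.symm {k : ZMod N} {β : ℂ} {A : Module.End ℂ (W N)} {am a0 ap : ZMod N → ℂ → ℂ}
    (h : HasCoeffs k β A am a0 ap) : HasCoeffs (-k) (-β) A ap a0 am where
  eq f m z := by rw [h.eq, ← sub_eq_add_neg, sub_neg_eq_add, sub_neg_eq_add, ← sub_eq_add_neg]; ring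
  bm := h.bp
  b0 := h.b0
  bp := h.bm

theorem integrable_conj_mul_gauss (w : HS N) (m : ZMod N) {p : ℝ → ℂ} (hp : ExpBdd p) {a : ℝ}
    (ha : 0 < a) :
    Integrable fun x : ℝ => (conj ((w m : L2R) x) * p x) * (Real.exp (-a * x ^ 2) : ℂ) := by
  obtain ⟨D, ε', -, hε', h⟩ := hp.gauss_mul (g := fun x => (Real.exp (-a * x ^ 2) : ℂ)) ha (C := 1)
    (fun x => by rw [Complex.norm_real, Real.norm_eq_abs, Real.abs_exp, one_mul])
  have := (memLp_conj w m).integrable_mul (memLp_two_of_gauss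
    (hp.1.mul (by fun_prop : Continuous fun x : ℝ => (Real.exp (-a * x ^ 2) : ℂ))) hε' h)
  refine this.congr (Filter.Eventually.of_forall fun x => ?_)
  simp [mul_assoc]

variable [NeZero N]

/-- The three sums over ℤ/N are reindexed separately, so that in the application every summand at m
involves the same component of f. -/
theorem inner_eq_sum_three (w y : HS N) {P Q S : ZMod N → ℝ → ℂ}
    (hP : ∀ m, MemLp (P m) 2 volume) (hQ : ∀ m, MemLp (Q m) 2 volume)
    (hS : ∀ m, MemLp (S m) 2 volume)
    (h : ∀ m, (y m : L2R) =ᵐ[volume] fun x => P m x + Q m x + S m x) (k : ZMod N) :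
    inner ℂ w y = ∑ m, ((∫ x : ℝ, conj ((w (m - k) : L2R) x) * P (m - k) x) +
      (∫ x : ℝ, conj ((w m : L2R) x) * Q m x) +
      ∫ x : ℝ, conj ((w (m + k) : L2R) x) * S (m + k) x) := by
  have hi : ∀ (P : ZMod N → ℝ → ℂ), (∀ m, MemLp (P m) 2 volume) → ∀ m,
      Integrable fun x : ℝ => conj ((w m : L2R) x) * P m x := fun P hP m =>
    (memLp_conj w m).integrable_mul (hP m)
  rw [hs_inner]
  have e : ∀ m, ∫ x : ℝ, conj ((w m : L2R) x) * (y m : L2R) x =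
      (∫ x : ℝ, conj ((w m : L2R) x) * P m x) + (∫ x : ℝ, conj ((w m : L2R) x) * Q m x) +
        ∫ x : ℝ, conj ((w m : L2R) x) * S m x := by
    intro m
    rw [← integral_add (hi P hP m) (hi Q hQ m), ← integral_add]
    · refine integral_congr_ae ?_
      filter_upwards [h m] with x hx
      rw [hx]; ring
    · exact (hi P hP m).add (hi Q hQ m)
    · exact hi S hS m
  simp_rw [e, Finset.sum_add_distrib]
  refine congrArg₂ (· + ·) (congrArg₂ (· + ·) ?_ rfl) ?_
  · exact (Equiv.sum_comp (Equiv.subRight k)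
      fun m => ∫ x : ℝ, conj ((w m : L2R) x) * P m x).symm
  · exact (Equiv.sum_comp (Equiv.addRight k)
      fun m => ∫ x : ℝ, conj ((w m : L2R) x) * S m x).symm

variable {k : ZMod N} {β : ℂ} {B : Module.End ℂ (W N)} {bm b0 bp : ZMod N → ℂ → ℂ}

theorem HasCoeffs.inner_eq (hB : HasCoeffs k β B bm b0 bp) (w : HS N) (f : W N) :
    inner ℂ w (toHS N (B f)) = ∑ m,
      ((∫ x : ℝ, conj ((w (m - k) : L2R) x) *
        (bm (m - k) x * (f : ZMod N → ℂ → ℂ) m (x + -β))) +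
      (∫ x : ℝ, conj ((w m : L2R) x) * (b0 m x * (f : ZMod N → ℂ → ℂ) m (x + 0))) +
      ∫ x : ℝ, conj ((w (m + k) : L2R) x) *
        (bp (m + k) x * (f : ZMod N → ℂ → ℂ) m (x + β))) := by
  have h := inner_eq_sum_three w (toHS N (B f))
    (P := fun m x => bm m x * (f : ZMod N → ℂ → ℂ) (m + k) (x + -β))
    (Q := fun m x => b0 m x * (f : ZMod N → ℂ → ℂ) m (x + 0))
    (S := fun m x => bp m x * (f : ZMod N → ℂ → ℂ) (m - k) (x + β))
    (fun m => (hB.bm m).memLp_mul_gaussW (W_mem f _) _)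
    (fun m => (hB.b0 m).memLp_mul_gaussW (W_mem f _) _)
    (fun m => (hB.bp m).memLp_mul_gaussW (W_mem f _) _) (fun m => ?_) k
  · simpa only [sub_add_cancel, add_sub_cancel_right] using h
  · filter_upwards [toHS_ae (B f) m] with x hx
    rw [hx, hB.eq, add_zero, sub_eq_add_neg]

/-- A functional which annihilates the graph of `B` annihilates the pairs `(h, B h)`, where `h` is
holomorphic with Gaussian decay in a strip containing the shifts which occur in `B`. -/
theorem HasCoeffs.annihilates_strip (hB : HasCoeffs k β B bm b0 bp) {v w : HS N}
    (hvw : ∀ f : W N, inner ℂ v (toHS N f) + inner ℂ w (toHS N (B f)) = 0)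
    {h : ℂ → ℂ} {R C ε : ℝ} (hε : 0 < ε) (hC : 0 ≤ C) (hR : |β.im| < R)
    (hd : DifferentiableOn ℂ h {z | |z.im| < R})
    (hb : ∀ z : ℂ, |z.im| < R → ‖h z‖ ≤ C * Real.exp (-ε * z.re ^ 2)) (m : ZMod N) :
    (∫ x : ℝ, (conj ((v m : L2R) x) * 1) * h (x + 0)) +
      ((∫ x : ℝ, (conj ((w (m - k) : L2R) x) * bm (m - k) x) * h (x + -β)) +
      (∫ x : ℝ, (conj ((w m : L2R) x) * b0 m x) * h (x + 0)) +
      ∫ x : ℝ, (conj ((w (m + k) : L2R) x) * bp (m + k) x) * h (x + β)) = 0 := by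
  have hR0 : |(0 : ℂ).im| < R := by simpa using (abs_nonneg _).trans_lt hR
  have hR1 : |(-β).im| < R := by simpa using hR
  -- Any Gaussian parameter below ε would do.
  have hα : 0 < ε / 2 := by positivity
  have hαε : ε / 2 < ε := by linarith
  obtain ⟨i1, e1⟩ := integral_mul_strip hα hαε hd hC hb hR0
    (fun a ha => integrable_conj_mul_gauss v m (expBdd_const 1) ha)
  obtain ⟨i2, e2⟩ := integral_mul_strip hα hαε hd hC hb hR1
    (fun a ha => integrable_conj_mul_gauss w (m - k) (hB.bm (m - k)) ha)
  obtain ⟨i3, e3⟩ := integral_mul_strip hα hαε hd hC hb hR0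
    (fun a ha => integrable_conj_mul_gauss w m (hB.b0 m) ha)
  obtain ⟨i4, e4⟩ := integral_mul_strip hα hαε hd hC hb hR
    (fun a ha => integrable_conj_mul_gauss w (m + k) (hB.bp (m + k)) ha)
  rw [e1, e2, e3, e4, integral_add_four i1 i2 i3 i4]
  -- For each ξ the integrand is a scalar times the pairing of (v, w) with the graph element of the
  -- Gaussian test function placed in component m, which vanishes by hypothesis.
  refine integral_eq_zero_of_ae (Filter.Eventually.of_forall fun ξ => ?_)
  simp only [Pi.zero_apply]
  rw [← mul_add, ← mul_add, ← mul_add]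
  refine mul_eq_zero_of_right _ ?_
  have h1 := hvw (W.single m ⟨gaussTest (ε / 2) ξ, gaussTest_mem hα ξ⟩)
  have h2 : inner ℂ v (toHS N (W.single m ⟨gaussTest (ε / 2) ξ, gaussTest_mem hα ξ⟩)) =
      ∫ x : ℝ, conj ((v m : L2R) x) * gaussTest (ε / 2) ξ x := by
    rw [hs_inner, Finset.sum_eq_single m]
    · refine integral_congr_ae ?_
      filter_upwards [toHS_ae (W.single m ⟨gaussTest (ε / 2) ξ, gaussTest_mem hα ξ⟩) m] with x hx
      rw [hx]
      simp [W.single]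
    · intro j _ hj
      refine integral_eq_zero_of_ae ?_
      filter_upwards [toHS_ae (W.single m ⟨gaussTest (ε / 2) ξ, gaussTest_mem hα ξ⟩) j] with x hx
      rw [hx]
      simp [W.single, Pi.single_eq_of_ne hj]
    · simp
  rw [h2, hB.inner_eq, Finset.sum_eq_single m] at h1
  · simp only [W.single, Pi.single_eq_same] at h1
    simpa only [mul_one, add_zero, mul_assoc] using h1
  · intro j _ hj
    simp [W.single, Pi.single_eq_of_ne hj]
  · simp

end

/-- Dominated convergence for integrals against a square integrable function and a function of
Gaussian decay. -/
theorem tendsto_integral_of_expBdd {c : ℝ → ℂ} (hc : MemLp c 2 volume) {g : ℝ → ℂ}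
    (hg : Continuous g) {C ε : ℝ} (hε : 0 < ε) (hb : ∀ x, ‖g x‖ ≤ C * Real.exp (-ε * x ^ 2))
    {p : ℝ → ℝ → ℂ} {p₀ : ℝ → ℂ} {D K δ₀ : ℝ} (hD : 0 ≤ D) (hδ₀ : 0 < δ₀)
    (hp : ∀ δ, 0 < δ → δ < δ₀ → Continuous (p δ) ∧ ∀ x, ‖p δ x‖ ≤ D * Real.exp (K * |x|))
    (hlim : ∀ᵐ x, Filter.Tendsto (fun δ => p δ x) (𝓝[>] 0) (𝓝 (p₀ x))) :
    Filter.Tendsto (fun δ => ∫ x, c x * (p δ x * g x)) (𝓝[>] 0)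
      (𝓝 (∫ x, c x * (p₀ x * g x))) := by
  have hC : 0 ≤ C := by simpa using (norm_nonneg _).trans (hb 0)
  obtain ⟨D', ε', hD', hε', h⟩ := exists_gauss_bound_of_exp (C := C) (C' := D) (K := K) hε hC hD
  have hev : ∀ᶠ δ : ℝ in 𝓝[>] 0, 0 < δ ∧ δ < δ₀ :=
    Ioo_mem_nhdsGT hδ₀
  refine tendsto_integral_filter_of_dominated_convergence
    (fun x => ‖c x‖ * (D' * Real.exp (-ε' * x ^ 2))) ?_ ?_ ?_ ?_
  · filter_upwards [hev] with δ hδ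
    exact hc.1.mul (((hp δ hδ.1 hδ.2).1.mul hg).aestronglyMeasurable)
  · filter_upwards [hev] with δ hδ
    refine Filter.Eventually.of_forall fun x => ?_
    rw [norm_mul, norm_mul]
    refine mul_le_mul_of_nonneg_left (le_trans ?_ (h x)) (norm_nonneg _)
    exact mul_le_mul ((hp δ hδ.1 hδ.2).2 x) (hb x) (norm_nonneg _) (by positivity)
  · refine (hc.norm).integrable_mul (q := 2) ?_
    have h3 := memLp_two_of_gauss (g := fun x : ℝ => ((D' * Real.exp (-ε' * x ^ 2) : ℝ) : ℂ))
      (by fun_prop) hε' (C := D') (fun x => by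
        rw [Complex.norm_real, Real.norm_of_nonneg (by positivity)])
    refine h3.norm.congr_norm (by fun_prop) (Filter.Eventually.of_forall fun x => ?_)
    rw [norm_norm, Complex.norm_real]
  · filter_upwards [hlim] with x hx
    exact (hx.mul_const _).const_mul _

end LevelN

/-! ### Unitary multipliers with a holomorphic continuation to a half plane. -/

namespace LevelN

open scoped Topology

theorem exp_abs_add_le {C K x c : ℝ} (hC : 0 ≤ C) :
    C * Real.exp (K * |x + c|) ≤ C * Real.exp (|K| * |c|) * Real.exp (|K| * |x|) := by
  rw [mul_assoc, ← Real.exp_add]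
  gcongr
  calc K * |x + c| ≤ |K| * |x + c| := by gcongr; exact le_abs_self K
    _ ≤ |K| * (|x| + |c|) := by gcongr; exact abs_add_le x c
    _ = _ := by ring

/-- A multiplier which is holomorphic and of exponential growth in the half plane
`-ρ < e Im z`, uniformly on closed substrips. -/
structure HalfPlaneMult {N : ℕ} (e ρ : ℝ) (Φ : ZMod N → ℂ → ℂ) : Prop where
  diff : ∀ m z, -ρ < e * z.im → DifferentiableAt ℂ (Φ m) z
  growth : ∀ s t : ℝ, -ρ < s → ∃ C K : ℝ, 0 ≤ C ∧ ∀ m z, s ≤ e * z.im → e * z.im ≤ t →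
    ‖Φ m z‖ ≤ C * Real.exp (K * |z.re|)

section

variable {N : ℕ} {e ρ : ℝ} {Φ : ZMod N → ℂ → ℂ}

theorem HalfPlaneMult.line_continuous (h : HalfPlaneMult e ρ Φ) (m : ZMod N) {w : ℂ}
    (hw : -ρ < e * w.im) : Continuous fun x : ℝ => Φ m (x + w) := by
  refine continuous_iff_continuousAt.2 fun x => ?_
  have h1 : ContinuousAt (Φ m) (x + w) := (h.diff m _ (by simpa using hw)).continuousAt
  exact h1.comp (f := fun x : ℝ => (x : ℂ) + w) (by fun_prop)

/-- The constants are uniform in m and in the height of the line; this gives a dominating function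
independent of the regularization δ. -/
theorem HalfPlaneMult.line_bound (h : HalfPlaneMult e ρ Φ) {s : ℝ} (hs : -ρ < s) (t c : ℝ) :
    ∃ C K : ℝ, 0 ≤ C ∧ ∀ m (w : ℂ), w.re = c → s ≤ e * w.im → e * w.im ≤ t → ∀ x : ℝ,
      ‖Φ m (x + w)‖ ≤ C * Real.exp (K * |x|) := by
  obtain ⟨C, K, hC, hb⟩ := h.growth s t hs
  refine ⟨C * Real.exp (|K| * |c|), |K|, by positivity, fun m w hw h1 h2 x => ?_⟩
  refine (hb m (x + w) (by simpa using h1) (by simpa using h2)).trans ?_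
  simp only [add_re, ofReal_re, hw]
  exact exp_abs_add_le hC

theorem HalfPlaneMult.expBdd (h : HalfPlaneMult e ρ Φ) (hρ : 0 < ρ) (m : ZMod N) :
    ExpBdd fun x : ℝ => Φ m x := by
  obtain ⟨C, K, hC, hb⟩ := h.line_bound (s := 0) (by linarith) 0 0
  refine ⟨?_, C, K, hC, fun x => ?_⟩
  · simpa using h.line_continuous m (w := 0) (by simpa using hρ)
  · simpa using hb m 0 rfl (by simp) (by simp) x

variable [NeZero N]

/-- A unitary multiplication operator maps the graph of `A` on `𝒲` into the closed graph of the
formally conjugated operator `B`; a zero of the coefficient of the backward shift in `B`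
compensates the poles of the multiplier on the boundary of its domain of holomorphy. -/
theorem HalfPlaneMult.mem_graphCl (h : HalfPlaneMult e ρ Φ) (he : e * e = 1) (hρ : 0 < ρ)
    {k : ZMod N} {β : ℂ} (hβ : β.im = e * ρ) {A B : Module.End ℂ (W N)}
    {am a0 ap bm b0 bp : ZMod N → ℂ → ℂ} (hA : HasCoeffs k β A am a0 ap)
    (hB : HasCoeffs k β B bm b0 bp) {V : HS N → HS N}
    (hV : ∀ x m, (V x m : L2R) =ᵐ[volume] fun t : ℝ => Φ m t * (x m : L2R) t)
    (h0 : ∀ m (x : ℝ), b0 m x = a0 m x)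
    (hp : ∀ m (x : ℝ), bp m x * Φ (m - k) (x + β) = Φ m x * ap m x) {r : ZMod N → ℂ → ℂ}
    (hm : ∀ m (x : ℝ), bm m x = am m x * r m x)
    (hr : ∀ m z, 0 < e * z.im → r m z * Φ (m + k) (z - β) = Φ m z)
    (hrc : ∀ m, Continuous (r m)) (hr0 : ∀ m, ∀ᵐ x : ℝ, r m x ≠ 0)
    (hrb : ∀ m, ∃ C δ₀ : ℝ, 0 ≤ C ∧ 0 < δ₀ ∧ ∀ x δ : ℝ, 0 < δ → δ < δ₀ →
      ‖r m x‖ ≤ C * ‖r m (x + (e * δ : ℝ) * I)‖) (f : W N) :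
    (V (toHS N f), V (toHS N (A f))) ∈ graphCl B := by
  refine LevelN.mem_graphCl fun v w hvw => ?_
  have hΦR := h.expBdd hρ
  have him : ∀ δ : ℝ, e * ((e * δ : ℝ) * I : ℂ).im = δ := fun δ => by
    simp [← mul_assoc, he]
  have hre : ∀ δ : ℝ, ((e * δ : ℝ) * I : ℂ).re = 0 := fun δ => by simp
  have hββ : e * β.im = ρ := by rw [hβ, ← mul_assoc, he, one_mul]
  have habs : |β.im| = ρ := by
    have : |e| = 1 := by
      have := congrArg abs he
      rw [abs_mul, abs_one] at this
      nlinarith [abs_nonneg e]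
    rw [hβ, abs_mul, this, one_mul, abs_of_pos hρ]
  -- the annihilation property along the regularization
  have ann : ∀ m δ, 0 < δ →
      (∫ x : ℝ, conj ((v m : L2R) x) * (Φ m (x + (e * δ : ℝ) * I) *
        (f : ZMod N → ℂ → ℂ) m (x + 0))) +
      ((∫ x : ℝ, conj ((w (m - k) : L2R) x) * ((bm (m - k) x * Φ m (x + (-β + (e * δ : ℝ) * I))) *
        (f : ZMod N → ℂ → ℂ) m (x + -β))) +
      (∫ x : ℝ, conj ((w m : L2R) x) * ((b0 m x * Φ m (x + (e * δ : ℝ) * I)) *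
        (f : ZMod N → ℂ → ℂ) m (x + 0))) +
      ∫ x : ℝ, conj ((w (m + k) : L2R) x) * ((bp (m + k) x * Φ m (x + (β + (e * δ : ℝ) * I))) *
        (f : ZMod N → ℂ → ℂ) m (x + β))) = 0 := by
    intro m δ hδ
    -- The strip of half-width ρ + δ/2 contains the shifts by ±β. After displacement by δ it still
    -- stays δ/2 away from the boundary line of the half plane.
    have hstrip : ∀ z : ℂ, |z.im| < ρ + δ / 2 →
        -ρ + δ / 2 ≤ e * (z + (e * δ : ℝ) * I).im ∧ e * (z + (e * δ : ℝ) * I).im ≤ ρ + 2 * δ := by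
      intro z hz
      have h1 : |e * z.im| < ρ + δ / 2 := by
        have h2 : |e * z.im| = |z.im| := by
          rw [← abs_abs z.im, ← Real.sqrt_sq_eq_abs (e * z.im), mul_pow, pow_two e, he, one_mul,
            Real.sqrt_sq_eq_abs, abs_abs]
        rwa [h2]
      rw [abs_lt] at h1
      rw [add_im, mul_add, him]
      constructor <;> linarith [h1.1, h1.2]
    obtain ⟨C, K, hC, hΦb⟩ := h.growth (-ρ + δ / 2) (ρ + 2 * δ) (by linarith)
    obtain ⟨C', ε, hC', hε, hfb⟩ := gaussW_bound (W_mem f m) (ρ + δ / 2)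
    obtain ⟨D, ε', hD, hε', hDb⟩ := exists_gauss_bound_of_exp (C := C') (C' := C) (K := K) hε hC' hC
    have key := hB.annihilates_strip hvw
      (h := fun z => Φ m (z + (e * δ : ℝ) * I) * (f : ZMod N → ℂ → ℂ) m z)
      (R := ρ + δ / 2) hε' hD (by linarith) (fun z hz => ?_) (fun z hz => ?_) m
    · refine Eq.trans ?_ key
      refine congrArg₂ (· + ·) ?_ (congrArg₂ (· + ·) (congrArg₂ (· + ·) ?_ ?_) ?_) <;>
      · refine integral_congr_ae (Filter.Eventually.of_forall fun x => ?_)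
        simp only [add_zero, mul_one, mul_assoc, add_assoc]
    · obtain ⟨h1, -⟩ := hstrip z hz
      have h2 : DifferentiableAt ℂ (Φ m) (z + (e * δ : ℝ) * I) := h.diff m _ (by linarith)
      have h3 : DifferentiableAt ℂ (fun z => Φ m (z + (e * δ : ℝ) * I)) z :=
        h2.comp z (f := fun z => z + ((e * δ : ℝ) : ℂ) * I) (by fun_prop)
      exact (h3.mul (gaussW_differentiable (W_mem f m) z)).differentiableWithinAt
    · obtain ⟨h1, h2⟩ := hstrip z hz
      rw [norm_mul]
      refine le_trans ?_ (hDb z.re)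
      have h3 := hΦb m _ h1 h2
      rw [add_re, hre, add_zero] at h3
      exact mul_le_mul h3 (hfb z (le_of_lt hz)) (norm_nonneg _) (by positivity)
  -- passage to the limit
  have hcont : ∀ m (z : ℂ), -ρ < e * z.im →
      Filter.Tendsto (fun δ : ℝ => Φ m (z + (e * δ : ℝ) * I)) (𝓝[>] 0) (𝓝 (Φ m z)) := by
    intro m z hz
    have h1 : ContinuousAt (Φ m) z := (h.diff m z hz).continuousAt
    have h2 : Filter.Tendsto (fun δ : ℝ => z + ((e * δ : ℝ) : ℂ) * I) (𝓝[>] 0) (𝓝 z) := by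
      have : Continuous fun δ : ℝ => z + ((e * δ : ℝ) : ℂ) * I := by fun_prop
      simpa using (this.tendsto 0).mono_left nhdsWithin_le_nhds
    exact h1.tendsto.comp h2
  have lim : ∀ m,
      (∫ x : ℝ, conj ((v m : L2R) x) * (Φ m x * (f : ZMod N → ℂ → ℂ) m (x + 0))) +
      ((∫ x : ℝ, conj ((w (m - k) : L2R) x) * ((am (m - k) x * Φ (m - k) x) *
        (f : ZMod N → ℂ → ℂ) m (x + -β))) +
      (∫ x : ℝ, conj ((w m : L2R) x) * ((b0 m x * Φ m x) *
        (f : ZMod N → ℂ → ℂ) m (x + 0))) +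
      ∫ x : ℝ, conj ((w (m + k) : L2R) x) * ((bp (m + k) x * Φ m (x + β)) *
        (f : ZMod N → ℂ → ℂ) m (x + β))) = 0 := by
    intro m
    obtain ⟨C, K, hC, hΦb⟩ := h.line_bound (s := 0) (by linarith) (ρ + 1) 0
    obtain ⟨C₁, K₁, hC₁, hΦb₁⟩ := h.line_bound (s := 0) (by linarith) (ρ + 1) β.re
    -- The range from 0 to ρ + 1 covers the lines of heights δ and ρ + δ for δ < 1. Only the
    -- backward shift, at height -ρ + δ, falls below it.
    have hδim : ∀ δ : ℝ, 0 < δ → δ < 1 →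
        0 ≤ e * ((e * δ : ℝ) * I : ℂ).im ∧ e * ((e * δ : ℝ) * I : ℂ).im ≤ ρ + 1 := by
      intro δ h1 h2; rw [him]; constructor <;> linarith
    have t1 : Filter.Tendsto (fun δ : ℝ => ∫ x : ℝ, conj ((v m : L2R) x) *
        (Φ m (x + (e * δ : ℝ) * I) * (f : ZMod N → ℂ → ℂ) m (x + 0))) (𝓝[>] 0)
        (𝓝 (∫ x : ℝ, conj ((v m : L2R) x) * (Φ m x * (f : ZMod N → ℂ → ℂ) m (x + 0)))) := by
      obtain ⟨fc, F, ε, hε, fb⟩ := gaussW_shift_bound (W_mem f m) 0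
      refine tendsto_integral_of_expBdd (memLp_conj v m) fc hε fb hC one_pos
        (fun δ h1 h2 => ⟨h.line_continuous m (by rw [him]; linarith), fun x =>
          hΦb m _ (hre δ) (hδim δ h1 h2).1 (hδim δ h1 h2).2 x⟩)
        (Filter.Eventually.of_forall fun x => hcont m x (by simpa using hρ))
    have t3 : Filter.Tendsto (fun δ : ℝ => ∫ x : ℝ, conj ((w m : L2R) x) *
        ((b0 m x * Φ m (x + (e * δ : ℝ) * I)) * (f : ZMod N → ℂ → ℂ) m (x + 0))) (𝓝[>] 0)
        (𝓝 (∫ x : ℝ, conj ((w m : L2R) x) * ((b0 m x * Φ m x) *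
          (f : ZMod N → ℂ → ℂ) m (x + 0)))) := by
      obtain ⟨fc, F, ε, hε, fb⟩ := gaussW_shift_bound (W_mem f m) 0
      obtain ⟨bc, C₂, K₂, hC₂, hb⟩ := hB.b0 m
      refine tendsto_integral_of_expBdd (memLp_conj w m) fc hε fb (D := C₂ * C) (K := K₂ + K)
        (by positivity) one_pos
        (fun δ h1 h2 => ⟨bc.mul (h.line_continuous m (by rw [him]; linarith)), fun x => ?_⟩)
        (Filter.Eventually.of_forall fun x => (hcont m x (by simpa using hρ)).const_mul _)
      rw [norm_mul, add_mul, Real.exp_add, mul_mul_mul_comm]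
      exact mul_le_mul (hb x) (hΦb m _ (hre δ) (hδim δ h1 h2).1 (hδim δ h1 h2).2 x)
        (norm_nonneg _) (by positivity)
    have t4 : Filter.Tendsto (fun δ : ℝ => ∫ x : ℝ, conj ((w (m + k) : L2R) x) *
        ((bp (m + k) x * Φ m (x + (β + (e * δ : ℝ) * I))) *
          (f : ZMod N → ℂ → ℂ) m (x + β))) (𝓝[>] 0)
        (𝓝 (∫ x : ℝ, conj ((w (m + k) : L2R) x) * ((bp (m + k) x * Φ m (x + β)) *
          (f : ZMod N → ℂ → ℂ) m (x + β)))) := by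
      obtain ⟨fc, F, ε, hε, fb⟩ := gaussW_shift_bound (W_mem f m) β
      obtain ⟨bc, C₂, K₂, hC₂, hb⟩ := hB.bp (m + k)
      have hi : ∀ δ : ℝ, e * (β + (e * δ : ℝ) * I : ℂ).im = ρ + δ := fun δ => by
        rw [add_im, mul_add, him, hββ]
      refine tendsto_integral_of_expBdd (memLp_conj w (m + k)) fc hε fb (D := C₂ * C₁)
        (K := K₂ + K₁) (by positivity) one_pos
        (fun δ h1 h2 => ⟨bc.mul (h.line_continuous m (by rw [hi]; linarith)), fun x => ?_⟩)
        (Filter.Eventually.of_forall fun x => ?_)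
      · rw [norm_mul, add_mul, Real.exp_add, mul_mul_mul_comm]
        exact mul_le_mul (hb x) (hΦb₁ m _ (by rw [add_re, hre, add_zero])
          (by rw [hi]; linarith) (by rw [hi]; linarith) x) (norm_nonneg _) (by positivity)
      · have := hcont m (x + β) (by simp only [add_im, ofReal_im, zero_add, hββ]; linarith)
        simp only [add_assoc] at this
        exact this.const_mul _
    -- The critical term, as x - β lies on the boundary line. With bm = am · r, the bound |r(x)| ≤
    -- C|r(x + ieδ)| and r(z)Φ(z - β) = Φ(z) at z = x + ieδ dominate it by |Φ(x + ieδ)|, a value at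
    -- height δ.
    have t2 : Filter.Tendsto (fun δ : ℝ => ∫ x : ℝ, conj ((w (m - k) : L2R) x) *
        ((bm (m - k) x * Φ m (x + (-β + (e * δ : ℝ) * I))) *
          (f : ZMod N → ℂ → ℂ) m (x + -β))) (𝓝[>] 0)
        (𝓝 (∫ x : ℝ, conj ((w (m - k) : L2R) x) * ((am (m - k) x * Φ (m - k) x) *
          (f : ZMod N → ℂ → ℂ) m (x + -β)))) := by
      obtain ⟨fc, F, ε, hε, fb⟩ := gaussW_shift_bound (W_mem f m) (-β)
      obtain ⟨-, C₂, K₂, hC₂, hb⟩ := hA.bm (m - k)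
      obtain ⟨Cr, δ₀, hCr, hδ₀, hrb⟩ := hrb (m - k)
      have hi : ∀ δ : ℝ, e * (-β + (e * δ : ℝ) * I : ℂ).im = -ρ + δ := fun δ => by
        rw [add_im, mul_add, him, neg_im, mul_neg, hββ]
      have hz : ∀ x δ : ℝ, (x : ℂ) + (-β + (e * δ : ℝ) * I) = (x + (e * δ : ℝ) * I) - β :=
        fun x δ => by ring
      have hzi : ∀ x δ : ℝ, e * ((x : ℂ) + (e * δ : ℝ) * I).im = δ := fun x δ => by
        rw [add_im, ofReal_im, zero_add, him]
      refine tendsto_integral_of_expBdd (memLp_conj w (m - k)) fc hε fb (D := C₂ * (Cr * C))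
        (K := K₂ + K) (δ₀ := min δ₀ 1) (by positivity) (lt_min hδ₀ one_pos)
        (fun δ h1 h2 => ⟨(hB.bm (m - k)).1.mul (h.line_continuous m (by rw [hi]; linarith)),
          fun x => ?_⟩) ?_
      · have e1 := hr (m - k) (x + (e * δ : ℝ) * I) (by rw [hzi]; exact h1)
        rw [sub_add_cancel] at e1
        have e2 := hrb x δ h1 (h2.trans_le (min_le_left _ _))
        have e3 := hΦb (m - k) ((e * δ : ℝ) * I) (hre δ)
          (hδim δ h1 (h2.trans_le (min_le_right _ _))).1
          (hδim δ h1 (h2.trans_le (min_le_right _ _))).2 x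
        rw [hm, hz, mul_assoc, norm_mul, add_mul, Real.exp_add, mul_mul_mul_comm]
        refine mul_le_mul (hb x) ?_ (norm_nonneg _) (by positivity)
        calc ‖r (m - k) x * Φ m ((x + (e * δ : ℝ) * I) - β)‖
            ≤ Cr * ‖r (m - k) (x + (e * δ : ℝ) * I)‖ *
              ‖Φ m ((x + (e * δ : ℝ) * I) - β)‖ := by
              rw [norm_mul]; gcongr
          _ = Cr * ‖Φ (m - k) (x + (e * δ : ℝ) * I)‖ := by rw [mul_assoc, ← norm_mul, e1]
          _ ≤ _ := by rw [mul_assoc]; gcongr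
      -- Off the zeros of r, Φ(x - β + ieδ) is the quotient Φ/r at x + ieδ, whose limit multiplied
      -- by bm is am · Φ.
      · filter_upwards [hr0 (m - k)] with x hx
        have c1 : Filter.Tendsto (fun δ : ℝ => r (m - k) (x + (e * δ : ℝ) * I)) (𝓝[>] 0)
            (𝓝 (r (m - k) x)) := by
          have : Continuous fun δ : ℝ => r (m - k) (x + (e * δ : ℝ) * I) :=
            (hrc (m - k)).comp (by fun_prop)
          simpa using (this.tendsto 0).mono_left nhdsWithin_le_nhds
        have c2 := ((hcont (m - k) x (by simpa using hρ)).div c1 hx).const_mul (bm (m - k) x)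
        have c3 : bm (m - k) x * (Φ (m - k) x / r (m - k) x) = am (m - k) x * Φ (m - k) x := by
          rw [hm]; field_simp
        rw [c3] at c2
        refine c2.congr' ?_
        have hne : ∀ᶠ δ : ℝ in 𝓝[>] 0, r (m - k) (x + (e * δ : ℝ) * I) ≠ 0 := c1.eventually_ne hx
        filter_upwards [hne, self_mem_nhdsWithin] with δ h1 h2
        have e1 := hr (m - k) (x + (e * δ : ℝ) * I) (by rw [hzi]; exact h2)
        rw [sub_add_cancel] at e1
        simp only [Pi.div_apply]
        rw [hz, ← e1]
        field_simp
    refine tendsto_nhds_unique (t1.add ((t2.add t3).add t4)) ?_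
    refine Filter.Tendsto.congr' ?_ tendsto_const_nhds
    filter_upwards [self_mem_nhdsWithin] with δ hδ
    exact (ann m δ hδ).symm
  -- summation over the components
  have s1 : inner ℂ v (V (toHS N f)) =
      ∑ m, ∫ x : ℝ, conj ((v m : L2R) x) * (Φ m x * (f : ZMod N → ℂ → ℂ) m (x + 0)) := by
    rw [hs_inner]
    refine Finset.sum_congr rfl fun m _ => integral_congr_ae ?_
    filter_upwards [hV (toHS N f) m, toHS_ae f m] with x h1 h2
    rw [h1, h2, add_zero]
  have s2 := inner_eq_sum_three w (V (toHS N (A f)))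
    (P := fun m x => (am m x * Φ m x) * (f : ZMod N → ℂ → ℂ) (m + k) (x + -β))
    (Q := fun m x => (b0 m x * Φ m x) * (f : ZMod N → ℂ → ℂ) m (x + 0))
    (S := fun m x => (bp m x * Φ (m - k) (x + β)) * (f : ZMod N → ℂ → ℂ) (m - k) (x + β))
    (fun m => ((hA.bm m).mul (hΦR m)).memLp_mul_gaussW (W_mem f _) _)
    (fun m => ((hB.b0 m).mul (hΦR m)).memLp_mul_gaussW (W_mem f _) _)
    (fun m => by
      simp only [hp]
      exact ((hΦR m).mul (hA.bp m)).memLp_mul_gaussW (W_mem f _) _) (fun m => ?_) k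
  · rw [s1, s2, ← Finset.sum_add_distrib]
    refine Finset.sum_eq_zero fun m _ => ?_
    simpa only [sub_add_cancel, add_sub_cancel_right] using lim m
  · filter_upwards [hV (toHS N (A f)) m, toHS_ae (A f) m] with x h1 h2
    rw [h1, h2, hA.eq, h0, hp, add_zero, sub_eq_add_neg (x : ℂ) β]
    ring

end

end LevelN

/-! ### Estimates near the zeros of 1 + κe^{τz}, and conjugation by multipliers of dilogarithm type.
-/

namespace LevelN

open scoped Topology

/-- At a real zero |κ|e^{(Re τ)x} = 1, which determines x. -/
theorem ae_one_add_exp_ne_zero (κ : ℂ) {τ : ℂ} (hτ : τ.re ≠ 0) :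
    ∀ᵐ x : ℝ, 1 + κ * exp (τ * x) ≠ 0 := by
  have hs : {x : ℝ | 1 + κ * exp (τ * x) = 0}.Subsingleton := by
    have hn : ∀ x : ℝ, 1 + κ * exp (τ * x) = 0 → ‖κ‖ * Real.exp (τ.re * x) = 1 := by
      intro x hx
      have h1 : ‖κ * exp (τ * x)‖ = 1 := by rw [eq_neg_of_add_eq_zero_right hx]; simp
      rwa [norm_mul, norm_exp, re_mul_ofReal] at h1
    intro x hx y hy
    have h1 := hn x hx
    have h2 := hn y hy
    have hk : ‖κ‖ ≠ 0 := fun h => by rw [h, zero_mul] at h1; exact zero_ne_one h1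
    exact mul_left_cancel₀ hτ (Real.exp_injective (mul_left_cancel₀ hk (h1.trans h2.symm)))
  filter_upwards [hs.countable.ae_notMem volume] with x hx using hx

/-- By compactness |g| stays above half its minimum on a complex neighbourhood of the segment, while
on the segment it is bounded. -/
theorem exists_norm_le_mul_norm_translate {g : ℂ → ℂ} (hg : Continuous g) {X : ℝ}
    (h0 : ∀ x : ℝ, |x| ≤ X → g x ≠ 0) :
    ∃ C δ₀ : ℝ, 0 ≤ C ∧ 0 < δ₀ ∧ ∀ (x : ℝ) (w : ℂ), |x| ≤ X → ‖w‖ < δ₀ →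
      ‖g x‖ ≤ C * ‖g (x + w)‖ := by
  rcases lt_or_ge X 0 with hX | hX
  · exact ⟨0, 1, le_rfl, one_pos, fun x w hx _ => absurd hx (by linarith [abs_nonneg x])⟩
  set K : Set ℂ := (fun x : ℝ => (x : ℂ)) '' Set.Icc (-X) X with hK
  have hKc : IsCompact K := isCompact_Icc.image continuous_ofReal
  have hKn : K.Nonempty := ⟨0, 0, ⟨by linarith, hX⟩, by simp⟩
  obtain ⟨a, ⟨xa, hxa, rfl⟩, ha⟩ := hKc.exists_isMinOn hKn hg.norm.continuousOn
  obtain ⟨d, -, hd⟩ := hKc.exists_isMaxOn hKn hg.norm.continuousOn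
  have hc : 0 < ‖g (xa : ℂ)‖ := norm_pos_iff.2 (h0 xa (abs_le.2 hxa))
  obtain ⟨δ, hδ, hsub⟩ := hKc.exists_thickening_subset_open
    (t := {z | ‖g (xa : ℂ)‖ / 2 < ‖g z‖}) (isOpen_lt continuous_const hg.norm) (fun z hz => by
      have := ha hz
      simp only [Set.mem_ofPred_eq] at this ⊢
      linarith)
  refine ⟨2 * ‖g d‖ / ‖g (xa : ℂ)‖, δ, by positivity, hδ, fun x w hx hw => ?_⟩
  have hxK : (x : ℂ) ∈ K := ⟨x, abs_le.1 hx, rfl⟩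
  have h1 : ‖g (xa : ℂ)‖ / 2 < ‖g (x + w)‖ :=
    hsub (Metric.mem_thickening_iff.2 ⟨x, hxK, by simpa [dist_eq_norm] using hw⟩)
  have h2 : ‖g x‖ ≤ ‖g d‖ := hd hxK
  rw [div_mul_eq_mul_div, le_div_iff₀ hc]
  nlinarith [norm_nonneg (g d), norm_nonneg (g x)]

/-- There is at most one real zero x₀ and it is simple. Moving x vertically only increases |x - x₀|,
and the cofactor has no zero on the segment. For large |x| one of the terms 1 and κe^{τx} dominates,
and a small vertical shift changes the second by at most a factor 2. -/
theorem exists_norm_one_add_exp_le (κ : ℂ) {τ : ℂ} (hτ : τ.re ≠ 0) {e : ℝ} (he : e * e = 1) :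
    ∃ C δ₀ : ℝ, 0 ≤ C ∧ 0 < δ₀ ∧ ∀ x δ : ℝ, 0 < δ → δ < δ₀ →
      ‖1 + κ * exp (τ * x)‖ ≤ C * ‖1 + κ * exp (τ * (x + (e * δ : ℝ) * I))‖ := by
  have habs : |e| = 1 := by
    have := congrArg abs he
    rw [abs_mul, abs_one] at this
    nlinarith [abs_nonneg e]
  by_cases hκ : κ = 0
  · exact ⟨1, 1, zero_le_one, one_pos, fun x δ _ _ => by simp [hκ]⟩
  have hκ' : 0 < ‖κ‖ := norm_pos_iff.2 hκ
  set r : ℂ → ℂ := fun z => 1 + κ * exp (τ * z) with hr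
  have hrd : Differentiable ℂ r := by fun_prop
  -- Beyond X the modulus of κe^{τx} is at least 4 or at most 1/4.
  set X : ℝ := (Real.log 4 + |Real.log ‖κ‖|) / |τ.re| with hX
  have hτ' : 0 < |τ.re| := abs_pos.2 hτ
  -- the estimate on compact sets
  have hmid : ∃ C δ₀ : ℝ, 0 ≤ C ∧ 0 < δ₀ ∧ ∀ x δ : ℝ, |x| ≤ X → 0 < δ → δ < δ₀ →
      ‖r x‖ ≤ C * ‖r (x + (e * δ : ℝ) * I)‖ := by
    have hw : ∀ δ : ℝ, 0 < δ → ‖((e * δ : ℝ) : ℂ) * I‖ = δ := fun δ hδ => by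
      rw [norm_mul, norm_I, mul_one, norm_real, Real.norm_eq_abs, abs_mul, habs, one_mul,
        abs_of_pos hδ]
    by_cases hz : ∃ x₀ : ℝ, r x₀ = 0
    · obtain ⟨x₀, hx₀⟩ := hz
      have hder : HasDerivAt r (κ * (exp (τ * x₀) * τ)) x₀ := by
        have h1 : HasDerivAt (fun z : ℂ => τ * z) τ x₀ := by
          simpa using (hasDerivAt_id (x₀ : ℂ)).const_mul τ
        exact ((h1.cexp).const_mul κ).const_add 1
      have hgc : Continuous (dslope r x₀) := by
        refine continuous_iff_continuousAt.2 fun z => ?_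
        by_cases hzx : z = x₀
        · rw [hzx, continuousAt_dslope_same]; exact hrd _
        · rw [continuousAt_dslope_of_ne hzx]; exact hrd.continuous.continuousAt
      have hfac : ∀ z, r z = (z - x₀) * dslope r x₀ z := fun z => by
        have := sub_smul_dslope r (x₀ : ℂ) z
        rw [hx₀, sub_zero, smul_eq_mul] at this
        exact this.symm
      have hn : ∀ x : ℝ, r x = 0 → ‖κ‖ * Real.exp (τ.re * x) = 1 := by
        intro x hx
        have h1 : ‖κ * exp (τ * x)‖ = 1 := by rw [eq_neg_of_add_eq_zero_right hx]; simp
        rwa [norm_mul, norm_exp, re_mul_ofReal] at h1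
      obtain ⟨C, δ₀, hC, hδ₀, hb⟩ := exists_norm_le_mul_norm_translate hgc (X := X)
        (fun x _ => by
          by_cases hxx : x = x₀
          · rw [hxx, dslope_same, hder.deriv]
            have : τ ≠ 0 := fun h => hτ (by rw [h, zero_re])
            exact mul_ne_zero hκ (mul_ne_zero (exp_ne_zero _) this)
          · intro h0
            have h1 : r x = 0 := by rw [hfac, h0, mul_zero]
            exact hxx (mul_left_cancel₀ hτ (Real.exp_injective
              (mul_left_cancel₀ hκ'.ne' ((hn x h1).trans (hn x₀ hx₀).symm)))))
      refine ⟨C, δ₀, hC, hδ₀, fun x δ hx h1 h2 => ?_⟩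
      have h3 := hb x ((e * δ : ℝ) * I) hx (by rwa [hw δ h1])
      rw [hfac, hfac (x + _), norm_mul, norm_mul]
      have h4 : ‖(x : ℂ) - x₀‖ ≤ ‖(x : ℂ) + (e * δ : ℝ) * I - x₀‖ := by
        rw [← ofReal_sub, norm_real, Real.norm_eq_abs]
        have h5 := abs_re_le_norm ((x : ℂ) + (e * δ : ℝ) * I - x₀)
        simpa using h5
      calc _ ≤ ‖(x : ℂ) + (e * δ : ℝ) * I - x₀‖ *
            (C * ‖dslope r x₀ (x + (e * δ : ℝ) * I)‖) := by gcongr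
        _ = _ := by ring
    · push Not at hz
      obtain ⟨C, δ₀, hC, hδ₀, hb⟩ := exists_norm_le_mul_norm_translate hrd.continuous (X := X)
        (fun x _ => hz x)
      exact ⟨C, δ₀, hC, hδ₀, fun x δ hx h1 h2 => hb x _ hx (by rwa [hw δ h1])⟩
  obtain ⟨C, δ₀, hC, hδ₀, hb⟩ := hmid
  have hlog2 : 0 < Real.log 2 := Real.log_pos one_lt_two
  -- The bound on δ keeps the change of modulus between 1/2 and 2. The constant 5 is forced by
  -- modulus 4, where 1 + 4 is compared with 4/2 - 1.
  refine ⟨max C 5, min δ₀ (Real.log 2 / (|τ.im| + 1)), le_max_of_le_left hC,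
    lt_min hδ₀ (by positivity), fun x δ h1 h2 => ?_⟩
  rcases le_or_gt |x| X with hx | hx
  · exact (hb x δ hx h1 (h2.trans_le (min_le_left _ _))).trans
      (mul_le_mul_of_nonneg_right (le_max_left _ _) (norm_nonneg _))
  · refine le_trans ?_ (mul_le_mul_of_nonneg_right (le_max_right C 5) (norm_nonneg _))
    have h3 : δ * (|τ.im| + 1) ≤ Real.log 2 := by
      rw [← le_div_iff₀ (by positivity)]
      exact (h2.trans_le (min_le_right _ _)).le
    set t : ℝ := -(e * δ) * τ.im with ht
    have ht2 : |t| ≤ Real.log 2 := by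
      rw [ht, abs_mul, abs_neg, abs_mul, habs, one_mul, abs_of_pos h1]
      nlinarith
    set W₀ : ℝ := ‖κ * exp (τ * x)‖ with hW₀
    have hW : W₀ = Real.exp (Real.log ‖κ‖ + τ.re * x) := by
      rw [hW₀, norm_mul, norm_exp, re_mul_ofReal, Real.exp_add, Real.exp_log hκ']
    have hW' : ‖κ * exp (τ * (x + (e * δ : ℝ) * I))‖ = W₀ * Real.exp t := by
      rw [hW, ← Real.exp_add, norm_mul, norm_exp, ← Real.exp_log hκ', ← Real.exp_add,
        Real.log_exp]
      congr 1
      simp [ht]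
      ring
    have e1 : Real.exp t ≤ 2 := by
      rw [← Real.exp_log two_pos]
      exact Real.exp_le_exp.2 ((le_abs_self _).trans ht2)
    have e2 : 1 / 2 ≤ Real.exp t := by
      have : (1 / 2 : ℝ) = Real.exp (-Real.log 2) := by
        rw [Real.exp_neg, Real.exp_log two_pos]; norm_num
      rw [this]
      exact Real.exp_le_exp.2 (by linarith [neg_abs_le t])
    have hW0 : 0 ≤ W₀ := norm_nonneg _
    have n1 : ‖1 + κ * exp (τ * x)‖ ≤ 1 + W₀ := (norm_add_le _ _).trans (by simp [hW₀])
    have n2 : 1 - W₀ * Real.exp t ≤ ‖1 + κ * exp (τ * (x + (e * δ : ℝ) * I))‖ := by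
      have := norm_sub_norm_le (1 : ℂ) (-(κ * exp (τ * (x + (e * δ : ℝ) * I))))
      rw [norm_neg, sub_neg_eq_add, hW', norm_one] at this
      exact this
    have n3 : W₀ * Real.exp t - 1 ≤ ‖1 + κ * exp (τ * (x + (e * δ : ℝ) * I))‖ := by
      have := norm_sub_norm_le (κ * exp (τ * (x + (e * δ : ℝ) * I))) (-1 : ℂ)
      rw [norm_neg, sub_neg_eq_add, hW', norm_one, add_comm _ (1 : ℂ)] at this
      exact this
    have hfar : Real.log 4 ≤ |Real.log ‖κ‖ + τ.re * x| := by
      have h5 : Real.log 4 + |Real.log ‖κ‖| < |τ.re * x| := by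
        rw [abs_mul, mul_comm]
        exact (div_lt_iff₀ hτ').1 hx
      have h6 := abs_sub_abs_le_abs_sub (τ.re * x) (-Real.log ‖κ‖)
      rw [abs_neg, sub_neg_eq_add, add_comm (τ.re * x)] at h6
      linarith
    have hexp4 : Real.exp (Real.log 4) = 4 := Real.exp_log (by norm_num)
    rcases le_abs.1 hfar with h7 | h7
    · have h8 : 4 ≤ W₀ := by rw [hW, ← hexp4]; exact Real.exp_le_exp.2 h7
      nlinarith
    · have h8 : W₀ * 4 ≤ 1 := by
        rw [hW, ← hexp4, ← Real.exp_add]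
        exact Real.exp_le_one_iff.2 (by linarith)
      nlinarith

/-- The analytic properties of the multiplication operator `φ` with `φ(q² y) = p φ(y)`. -/
structure DilogMult (N : ℕ) (b : ℂ) (p Φ : ZMod N → ℂ → ℂ) : Prop where
  mult : HalfPlaneMult 1 b.re Φ
  shift : ∀ m z, -b.re < z.im → Φ (m - 1) (z + I * b) = p m z * Φ m z
  shift_dual : ∀ m z, 0 < z.im → Φ m z = conj (p m (conj z)) * Φ (m - 1) (z - I * b⁻¹)
  norm_eq : ∀ m (x : ℝ), ‖Φ m x‖ = 1
  factor : ∀ m, ∃ κ τ : ℂ, τ.re ≠ 0 ∧ ∀ z, p m z = 1 + κ * exp (τ * z)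

/-- On ℝ this is the inverse of a unimodular multiplier, continued to the opposite half plane; it
represents the inverse unitary. -/
theorem HalfPlaneMult.conj {N : ℕ} {e ρ : ℝ} {Φ : ZMod N → ℂ → ℂ} (h : HalfPlaneMult e ρ Φ) :
    HalfPlaneMult (-e) ρ fun m z => conj (Φ m (conj z)) where
  diff m z hz := by
    have h1 : DifferentiableAt ℂ (Φ m) (starRingEnd ℂ z) := h.diff m _ (by simpa using hz)
    simpa [Function.comp_def] using h1.conj_conj
  growth s t hs := by
    obtain ⟨C, K, hC, hb⟩ := h.growth s t hs
    refine ⟨C, K, hC, fun m z h1 h2 => ?_⟩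
    rw [RCLike.norm_conj]
    simpa using hb m (starRingEnd ℂ z) (by simpa using h1) (by simpa using h2)

variable {N : ℕ} [NeZero N]

/-- `HalfPlaneMult.mem_graphCl` is used twice. For V the factor in `bm` compensates the poles at Im
z = -Re b. For V⁻¹, with the shifts exchanged, the factor in `ap` compensates the conjugate poles at
Im z = Re b, and `shift_dual` takes the place of `shift`. -/
theorem DilogMult.conjugates {b : ℂ} (hb : IsParam b) {p Φ : ZMod N → ℂ → ℂ}
    (h : DilogMult N b p Φ) {A B : Module.End ℂ (W N)} {am a0 ap bm b0 bp : ZMod N → ℂ → ℂ}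
    (hA : HasCoeffs 1 (I * b) A am a0 ap) (hB : HasCoeffs 1 (I * b) B bm b0 bp)
    {V : HS N ≃ₗᵢ[ℂ] HS N}
    (hV : ∀ x m, (V x m : L2R) =ᵐ[volume] fun t : ℝ => Φ m t * (x m : L2R) t)
    (h0 : ∀ m (x : ℝ), b0 m x = a0 m x)
    (hm : ∀ m (x : ℝ), bm m x = am m x * p (m + 1) (x - I * b))
    (hp : ∀ m (x : ℝ), ap m x = bp m x * p m x) : Conjugates V A B := by
  have hconj : ∀ z : ℂ, conj (z + I * b) = conj z - I * b⁻¹ := fun z => by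
    simp [hb.conj_eq, sub_eq_add_neg]
  have hpc : ∀ m, Continuous (p m) := fun m => by
    obtain ⟨κ, τ, -, hz⟩ := h.factor m
    have : p m = fun z => 1 + κ * exp (τ * z) := funext hz
    rw [this]; fun_prop
  refine conjugates_of_mem (fun f => ?_) fun f => ?_
  · refine h.mult.mem_graphCl (by norm_num) hb.re_pos (by simp) hA hB hV h0 (fun m x => ?_)
      (r := fun m z => p (m + 1) (z - I * b)) hm (fun m z hz => ?_)
      (fun m => (hpc _).comp (by fun_prop)) (fun m => ?_) (fun m => ?_) f
    · rw [h.shift m x (by simpa using hb.re_pos), hp]; ring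
    · have := h.shift (m + 1) (z - I * b) (by simpa using hz)
      rw [add_sub_cancel_right, sub_add_cancel] at this
      exact this.symm
    · obtain ⟨κ, τ, hτ, hz⟩ := h.factor (m + 1)
      filter_upwards [ae_one_add_exp_ne_zero (κ * exp (-(τ * (I * b)))) hτ] with x hx
      rw [hz, mul_sub, sub_eq_neg_add, exp_add, ← mul_assoc]
      exact hx
    · obtain ⟨κ, τ, hτ, hz⟩ := h.factor (m + 1)
      obtain ⟨C, δ₀, hC, hδ₀, hb'⟩ :=
        exists_norm_one_add_exp_le (κ * exp (-(τ * (I * b)))) hτ (e := 1) (by norm_num)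
      refine ⟨C, δ₀, hC, hδ₀, fun x δ h1 h2 => ?_⟩
      have := hb' x δ h1 h2
      simp only [hz, mul_sub, sub_eq_neg_add (τ * _), exp_add, ← mul_assoc κ]
      simpa only [exp_add, mul_add] using this
  · have hV' : ∀ x m, (V⁻¹ x m : L2R) =ᵐ[volume]
        fun t : ℝ => conj (Φ m (conj (t : ℂ))) * (x m : L2R) t := by
      intro x m
      have h1 := hV (V⁻¹ x) m
      have h2 : V (V⁻¹ x) = x := V.apply_symm_apply x
      rw [h2] at h1
      filter_upwards [h1] with t ht
      rw [ht, conj_ofReal, ← mul_assoc, mul_comm (starRingEnd ℂ _), mul_conj,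
        normSq_eq_norm_sq, h.norm_eq]
      simp
    refine h.mult.conj.mem_graphCl (by norm_num) hb.re_pos (by simp) hB.symm hA.symm hV'
      (fun m x => (h0 m x).symm) (fun m x => ?_) (r := p) hp (fun m z hz => ?_)
      hpc (fun m => ?_) (fun m => ?_) f
    · have h1 := h.shift_dual (m + 1) (conj ((x : ℂ) + -(I * b))) (by simpa using hb.re_pos)
      rw [hm, sub_neg_eq_add, h1, add_sub_cancel_right, map_mul, conj_conj, conj_conj,
        ← hconj, neg_add_cancel_right, ← sub_eq_add_neg]
      ring
    · have h1 := h.shift_dual m (conj z) (by simpa using hz)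
      rw [h1, conj_conj, map_mul, conj_conj, ← hconj, ← sub_eq_add_neg, sub_neg_eq_add]
    · obtain ⟨κ, τ, hτ, hz⟩ := h.factor m
      filter_upwards [ae_one_add_exp_ne_zero κ hτ] with x hx
      rwa [hz]
    · obtain ⟨κ, τ, hτ, hz⟩ := h.factor m
      simp only [hz]
      exact exists_norm_one_add_exp_le κ hτ (by norm_num)

end LevelN

namespace LevelN

open scoped Topology

/-! ### The infinite product -/

/-- The entire function `∏_{j ≥ 0} (1 + q^{2j+1} w)`. -/
noncomputable def qProd (q w : ℂ) : ℂ := ∏' j : ℕ, (1 + q ^ (2 * j + 1) * w)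

section

variable {q : ℂ}

theorem summable_qProd (hq : ‖q‖ < 1) (w : ℂ) :
    Summable fun j : ℕ => ‖q ^ (2 * j + 1) * w‖ := by
  have h1 : ‖q‖ ^ 2 < 1 := pow_lt_one₀ (norm_nonneg _) hq two_ne_zero
  refine ((summable_geometric_of_lt_one (by positivity) h1).mul_left (‖q‖ * ‖w‖)).congr
    fun j => ?_
  rw [norm_mul, norm_pow, pow_succ _ (2 * j), pow_mul]
  ring

theorem qProd_ne_zero (hq : ‖q‖ < 1) {w : ℂ} (h : ∀ j : ℕ, 1 + q ^ (2 * j + 1) * w ≠ 0) :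
    qProd q w ≠ 0 :=
  tprod_one_add_ne_zero_of_summable h (summable_qProd hq w)

theorem qProd_eq_mul (hq : ‖q‖ < 1) (w : ℂ) :
    qProd q w = (1 + q * w) * qProd q (q ^ 2 * w) := by
  have h : ∀ j : ℕ, 1 + q ^ (2 * (j + 1) + 1) * w = 1 + q ^ (2 * j + 1) * (q ^ 2 * w) :=
    fun j => by ring
  rw [qProd, tprod_eq_zero_mul', qProd]
  · simp only [h, mul_zero, zero_add, pow_one]
  · simp only [h]
    exact multipliable_one_add_of_summable (summable_qProd hq _)

theorem qProd_eq_zero {w : ℂ} (j : ℕ) (h : 1 + q ^ (2 * j + 1) * w = 0) :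
    qProd q w = 0 := tprod_of_exists_eq_zero ⟨j, h⟩

theorem exists_of_qProd_eq_zero (hq : ‖q‖ < 1) {w : ℂ} (h : qProd q w = 0) :
    ∃ j : ℕ, 1 + q ^ (2 * j + 1) * w = 0 := by
  by_contra! h0
  exact qProd_ne_zero hq h0 h

theorem differentiable_qProd (hq : ‖q‖ < 1) : Differentiable ℂ (qProd q) := by
  intro w
  have hopen : IsOpen (Metric.ball (0 : ℂ) (‖w‖ + 1)) := Metric.isOpen_ball
  have h1 : HasProdLocallyUniformlyOn (fun (j : ℕ) (z : ℂ) => 1 + q ^ (2 * j + 1) * z)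
      (fun z => ∏' j : ℕ, (1 + q ^ (2 * j + 1) * z)) (Metric.ball (0 : ℂ) (‖w‖ + 1)) := by
    refine Summable.hasProdLocallyUniformlyOn_nat_one_add hopen
      (summable_qProd hq ((‖w‖ + 1 : ℝ) : ℂ)) (Filter.Eventually.of_forall fun n z hz => ?_)
      fun n => by fun_prop
    rw [norm_mul, norm_mul, norm_real, Real.norm_eq_abs, abs_of_pos (by positivity)]
    gcongr
    simpa using (mem_ball_zero_iff.1 hz).le
  have h2 : DifferentiableOn ℂ (qProd q) (Metric.ball (0 : ℂ) (‖w‖ + 1)) :=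
    h1.differentiableOn (.of_forall fun _ => by
      simpa [Finset.prod_fn] using DifferentiableOn.finsetProd (fun _ _ => by fun_prop)) hopen
  exact h2.differentiableAt (hopen.mem_nhds (by simp))

theorem pow_ne_one_of_norm_lt (hq : ‖q‖ < 1) {n : ℕ} (hn : n ≠ 0) : q ^ n ≠ 1 := fun h => by
  have := pow_lt_one₀ (norm_nonneg q) hq hn
  rw [← norm_pow, h, norm_one] at this
  exact lt_irrefl _ this

/-- The zeros are simple because |q| < 1 prevents a positive power of q from being 1, so two factors
never vanish together. The functional equation reduces the zero of index j + 1 to that of index j.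
-/
theorem deriv_qProd_ne_zero (hq : ‖q‖ < 1) (hq0 : q ≠ 0) {w : ℂ} (h : qProd q w = 0) :
    deriv (qProd q) w ≠ 0 := by
  obtain ⟨j, hj⟩ := exists_of_qProd_eq_zero hq h
  have hder : ∀ w, deriv (qProd q) w =
      q * qProd q (q ^ 2 * w) + (1 + q * w) * (deriv (qProd q) (q ^ 2 * w) * q ^ 2) := by
    intro w
    have h1 : HasDerivAt (fun w => (1 + q * w) * qProd q (q ^ 2 * w))
        (q * qProd q (q ^ 2 * w) + (1 + q * w) * (deriv (qProd q) (q ^ 2 * w) * q ^ 2)) w := by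
      have h2 : HasDerivAt (fun w : ℂ => 1 + q * w) q w := by
        simpa using ((hasDerivAt_id w).const_mul q).const_add 1
      have h3 : HasDerivAt (fun w : ℂ => q ^ 2 * w) (q ^ 2) w := by
        simpa using (hasDerivAt_id w).const_mul (q ^ 2)
      exact h2.mul ((differentiable_qProd hq _).hasDerivAt.comp w h3)
    exact (h1.congr_of_eventuallyEq (Filter.Eventually.of_forall (qProd_eq_mul hq))).deriv
  induction j generalizing w with
  | zero =>
    rw [mul_zero, zero_add, pow_one] at hj
    rw [hder, hj, zero_mul, add_zero]
    refine mul_ne_zero hq0 (qProd_ne_zero hq fun j h0 => ?_)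
    refine pow_ne_one_of_norm_lt hq (n := 2 * j + 2) (by omega) ?_
    linear_combination q ^ (2 * j + 2) * hj - h0
  | succ j ih =>
    have h1 : 1 + q ^ (2 * j + 1) * (q ^ 2 * w) = 0 := by rw [← hj]; ring
    have h2 := qProd_eq_zero j h1
    rw [hder, h2, mul_zero, zero_add]
    refine mul_ne_zero (fun h0 => ?_) (mul_ne_zero (ih h2 h1) (pow_ne_zero 2 hq0))
    refine pow_ne_one_of_norm_lt hq (n := 2 * j + 2) (by omega) ?_
    linear_combination q ^ (2 * j + 2) * h0 - hj

end

/-! ### Quotients with removable singularities -/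

open scoped Classical in
/-- The quotient `f / g`, extended to common simple zeros. -/
noncomputable def divExt (f g : ℂ → ℂ) (z : ℂ) : ℂ :=
  if g z = 0 then deriv f z / deriv g z else f z / g z

theorem divExt_of_ne {f g : ℂ → ℂ} {z : ℂ} (h : g z ≠ 0) : divExt f g z = f z / g z := if_neg h

/-- At a common zero z₀ both functions are divided by z - z₀ through `dslope`. The quotient of the
results is holomorphic and takes at z₀ the ratio of derivatives prescribed by `divExt`. -/
theorem differentiableAt_divExt {f g : ℂ → ℂ} (hf : Differentiable ℂ f) (hg : Differentiable ℂ g)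
    {z : ℂ} (h : g z = 0 → f z = 0 ∧ deriv g z ≠ 0) : DifferentiableAt ℂ (divExt f g) z := by
  by_cases hz : g z = 0
  · obtain ⟨hfz, hg'⟩ := h hz
    have hd : ∀ k : ℂ → ℂ, Differentiable ℂ k → DifferentiableAt ℂ (dslope k z) z := fun k hk =>
      ((differentiableOn_dslope Filter.univ_mem).2 hk.differentiableOn).differentiableAt
        Filter.univ_mem
    have hne : dslope g z z ≠ 0 := by rwa [dslope_same]
    refine ((hd f hf).div (hd g hg) hne).congr_of_eventuallyEq ?_
    filter_upwards [(hd g hg).continuousAt.eventually_ne hne] with w hw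
    by_cases hwz : w = z
    · subst hwz
      rw [divExt, if_pos hz, Pi.div_apply, dslope_same, dslope_same]
    · have e : ∀ k : ℂ → ℂ, k z = 0 → k w = (w - z) * dslope k z w := fun k hk => by
        have := sub_smul_dslope k z w
        rw [hk, sub_zero, smul_eq_mul] at this
        exact this.symm
      have hgw : g w ≠ 0 := by rw [e g hz]; exact mul_ne_zero (sub_ne_zero.2 hwz) hw
      rw [divExt_of_ne hgw, e g hz, e f hfz, mul_div_mul_left _ _ (sub_ne_zero.2 hwz),
        Pi.div_apply]
  · refine ((hf z).div (hg z) hz).congr_of_eventuallyEq ?_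
    filter_upwards [hg.continuous.continuousAt.eventually_ne hz] with w hw
    rw [divExt_of_ne hw, Pi.div_apply]

/-- An identity between continuous functions holds at `z` if it holds off the zeros of an analytic
function with simple zeros. -/
theorem eq_of_forall_ne_zero {f g k : ℂ → ℂ} {z : ℂ} (hf : ContinuousAt f z)
    (hg : ContinuousAt g z) (hk : Differentiable ℂ k) (hk' : k z = 0 → deriv k z ≠ 0)
    (h : ∀ w, k w ≠ 0 → f w = g w) : f z = g z := by
  have h1 : ∀ᶠ w in 𝓝[≠] z, k w ≠ 0 := by
    by_cases hz : k z = 0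
    · rcases (hk.analyticAt z).eventually_eq_zero_or_eventually_ne_zero with h0 | h0
      · exact absurd ((Filter.EventuallyEq.deriv_eq h0).trans (deriv_const z 0)) (hk' hz)
      · exact h0
    · exact (hk.continuous.continuousAt.eventually_ne hz).filter_mono nhdsWithin_le_nhds
  refine tendsto_nhds_unique_of_eventuallyEq (hf.tendsto.mono_left nhdsWithin_le_nhds)
    (hg.tendsto.mono_left nhdsWithin_le_nhds) (h1.mono h)

/-! ### Exponential growth from a functional equation -/

/-- On a compact rectangle F is bounded, and each step of length h towards it costs a factor K.
About |Re z|/h steps are needed, whence the rate (log K)/h. -/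
theorem exp_growth_of_shift {N : ℕ} [NeZero N] {F : ZMod N → ℂ → ℂ} {s t h K X : ℝ} {k : ZMod N}
    (hh : 0 < h) (hK : 1 ≤ K)
    (hc : ∀ m, ContinuousOn (F m) {z | s ≤ z.im ∧ z.im ≤ t})
    (hr : ∀ m z, s ≤ z.im → z.im ≤ t → X ≤ z.re → ‖F m z‖ ≤ K * ‖F (m - k) (z - (h : ℂ))‖)
    (hl : ∀ m z, s ≤ z.im → z.im ≤ t → z.re ≤ -X → ‖F m z‖ ≤ K * ‖F (m + k) (z + (h : ℂ))‖) :
    ∃ C K' : ℝ, 0 ≤ C ∧ ∀ m z, s ≤ z.im → z.im ≤ t → ‖F m z‖ ≤ C * Real.exp (K' * |z.re|) := by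
  -- Y ≥ h ensures that an inward step of length h does not cross to the other side.
  set Y : ℝ := max X h with hY
  have hYh : h ≤ Y := le_max_right _ _
  have hYX : X ≤ Y := le_max_left _ _
  have hcomp : ∃ C₀ : ℝ, 0 ≤ C₀ ∧ ∀ m z, s ≤ z.im → z.im ≤ t → |z.re| ≤ Y → ‖F m z‖ ≤ C₀ := by
    have hK : IsCompact (Set.Icc (-Y) Y ×ℂ Set.Icc s t) := isCompact_Icc.reProdIm isCompact_Icc
    have h1 : ∀ m, ∃ C, ∀ z ∈ Set.Icc (-Y) Y ×ℂ Set.Icc s t, ‖F m z‖ ≤ C := fun m =>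
      hK.exists_bound_of_continuousOn ((hc m).mono fun z hz => (mem_reProdIm.1 hz).2)
    choose C hC using h1
    refine ⟨∑ m, |C m|, Finset.sum_nonneg fun _ _ => abs_nonneg _, fun m z h1 h2 h3 => ?_⟩
    calc ‖F m z‖ ≤ C m := hC m z (mem_reProdIm.2 ⟨abs_le.1 h3, h1, h2⟩)
      _ ≤ |C m| := le_abs_self _
      _ ≤ _ := Finset.single_le_sum (f := fun m => |C m|) (fun _ _ => abs_nonneg _)
        (Finset.mem_univ m)
  obtain ⟨C₀, hC₀, hb⟩ := hcomp
  have hind : ∀ n : ℕ, ∀ m z, s ≤ z.im → z.im ≤ t → |z.re| ≤ Y + n * h →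
      ‖F m z‖ ≤ C₀ * K ^ n := by
    intro n
    induction n with
    | zero => intro m z h1 h2 h3; simpa using hb m z h1 h2 (by simpa using h3)
    | succ n ih =>
      intro m z h1 h2 h3
      push_cast at h3
      have hn : 0 ≤ (n : ℝ) * h := by positivity
      rcases le_or_gt |z.re| (Y + n * h) with h4 | h4
      · refine (ih m z h1 h2 h4).trans ?_
        gcongr
        omega
      · have step : ∀ m' w, s ≤ w.im → w.im ≤ t → |w.re| ≤ Y + n * h →
            ‖F m z‖ ≤ K * ‖F m' w‖ → ‖F m z‖ ≤ C₀ * K ^ (n + 1) := by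
          intro m' w e1 e2 e3 e4
          refine e4.trans ?_
          rw [pow_succ', mul_left_comm]
          exact mul_le_mul_of_nonneg_left (ih m' w e1 e2 e3) (by linarith)
        rcases abs_cases z.re with ⟨ha, h0⟩ | ⟨ha, h0⟩
        · rw [ha] at h3 h4
          exact step (m - k) (z - (h : ℂ)) (by simpa using h1) (by simpa using h2)
            (by rw [sub_re, ofReal_re, abs_le]; constructor <;> linarith)
            (hr m z h1 h2 (by linarith))
        · rw [ha] at h3 h4
          exact step (m + k) (z + (h : ℂ)) (by simpa using h1) (by simpa using h2)
            (by rw [add_re, ofReal_re, abs_le]; constructor <;> linarith)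
            (hl m z h1 h2 (by linarith))
  have hKpos : 0 < K := by linarith
  refine ⟨C₀ * K, Real.log K / h, by positivity, fun m z h1 h2 => ?_⟩
  have h3 := hind ⌈|z.re| / h⌉₊ m z h1 h2 (by
    have := Nat.le_ceil (|z.re| / h)
    rw [div_le_iff₀ hh] at this
    linarith)
  refine h3.trans ?_
  rw [mul_assoc]
  refine mul_le_mul_of_nonneg_left ?_ hC₀
  have h4 : (⌈|z.re| / h⌉₊ : ℝ) ≤ |z.re| / h + 1 := (Nat.ceil_lt_add_one (by positivity)).le
  have hlog : 0 ≤ Real.log K := Real.log_nonneg hK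
  calc K ^ ⌈|z.re| / h⌉₊ = Real.exp (⌈|z.re| / h⌉₊ * Real.log K) := by
        rw [Real.exp_nat_mul, Real.exp_log hKpos]
    _ ≤ Real.exp ((|z.re| / h + 1) * Real.log K) := by gcongr
    _ = Real.exp (Real.log K + Real.log K / h * |z.re|) := by congr 1; ring
    _ = K * Real.exp (Real.log K / h * |z.re|) := by rw [Real.exp_add, Real.exp_log hKpos]

end LevelN

namespace LevelN

open scoped Topology

/-! ### The quantum dilogarithm as a holomorphic function -/

variable {N : ℕ} [NeZero N] {b : ℂ}

variable (N b) in
/-- The product `∏_{j ≥ 0} (1 + (-1)^N q^{2j+1} y(z, m))`. -/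
noncomputable def dilogDen (m : ZMod N) (z : ℂ) : ℂ := qProd (q N b) ((-1) ^ N * yFun N b m z)

variable (N b) in
/-- The product `∏_{j ≥ 0} (1 + (-1)^N q̃^{-2j-1} ỹ(z, m))`, as the conjugate of `dilogDen`. -/
noncomputable def dilogNum (m : ZMod N) (z : ℂ) : ℂ := conj (dilogDen N b m (conj z))

variable (N b) in
/-- The holomorphic function whose boundary values are `φ((-1)^N y, (-1)^N ỹ)`. -/
noncomputable def dilogFun (m : ZMod N) (z : ℂ) : ℂ := divExt (dilogNum N b m) (dilogDen N b m) z

variable (N b) in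
/-- The factor `1 + (-1)^N q y(z, m)` in the functional equation. -/
noncomputable def dilogFactor (m : ZMod N) (z : ℂ) : ℂ := 1 + q N b * ((-1) ^ N * yFun N b m z)

/-- The dual torus commutes with y. This invariance gives the dilogarithm its second functional
equation. -/
theorem yFun_shift_dual (m : ZMod N) (z : ℂ) (hb0 : b ≠ 0) :
    yFun N b (m - 1) (z - I * b⁻¹) = yFun N b m z := by
  have h : yFun N b (-1) (-(I * b⁻¹)) = 1 := by
    have h1 := ZMod.stdAddChar_coe (N := N) 1
    rw [Int.cast_one] at h1
    rw [yFun_eq, neg_neg, h1, ← Complex.exp_add, ← Complex.exp_zero]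
    congr 1
    push_cast
    field_simp
    ring
  rw [sub_eq_add_neg, sub_eq_add_neg z, yFun_add, h, mul_one]

theorem hasDerivAt_yFun (m : ZMod N) (z : ℂ) :
    HasDerivAt (yFun N b m) (yFun N b m z * (2 * Real.pi / N * b)) z := by
  have h1 : yFun N b m = fun z => ZMod.stdAddChar (-m) * exp (2 * Real.pi / N * b * z) :=
    funext (yFun_eq b m)
  have h2 : HasDerivAt (fun z : ℂ => 2 * Real.pi / N * b * z) (2 * Real.pi / N * b) z := by
    simpa using (hasDerivAt_id z).const_mul (2 * Real.pi / N * b)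
  rw [yFun_eq, mul_assoc]
  exact (h2.cexp.const_mul _).congr_of_eventuallyEq (.of_forall fun w => congrFun h1 w)

theorem norm_yFun_complex (m : ZMod N) (z : ℂ) :
    ‖yFun N b m z‖ = Real.exp (2 * Real.pi / N * (b * z).re) := by
  have h : 2 * Real.pi * I / N * (-I * b * z - (m.val : ℂ)) =
      ((2 * Real.pi / N : ℝ) : ℂ) * (b * z - I * ((m.val : ℝ) : ℂ)) := by
    push_cast
    linear_combination (-(2 * Real.pi / N * b * z) : ℂ) * I_sq
  rw [yFun, Complex.norm_exp, h, Complex.re_ofReal_mul]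
  simp

/-- Everything is written as one exponential of πi/N times a number; (-1)^N = e^{πiN} contributes
the term N². -/
theorem one_add_pow_mul_yFun_eq_zero_iff (n : ℕ) (m : ZMod N) (z : ℂ) :
    1 + q N b ^ n * ((-1) ^ N * yFun N b m z) = 0 ↔
      ∃ k : ℤ, (N : ℂ) ^ 2 + n * (1 + b ^ 2) - 2 * I * b * z - 2 * m.val = N * (1 + 2 * k) := by
  have hN : (N : ℂ) ≠ 0 := Nat.cast_ne_zero.2 (NeZero.ne N)
  have hπ : (Real.pi : ℂ) ≠ 0 := ofReal_ne_zero.2 Real.pi_ne_zero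
  have h1 : q N b ^ n * ((-1) ^ N * yFun N b m z) =
      exp (Real.pi * I / N * ((N : ℂ) ^ 2 + n * (1 + b ^ 2) - 2 * I * b * z - 2 * m.val)) := by
    rw [← Complex.exp_pi_mul_I, q, yFun, ← Complex.exp_nat_mul, ← Complex.exp_nat_mul,
      ← Complex.exp_add, ← Complex.exp_add]
    congr 1
    field_simp
    ring
  have h2 : ∀ w : ℂ, 1 + w = 0 ↔ w = -1 := fun w =>
    ⟨fun h => by linear_combination h, fun h => by rw [h]; ring⟩
  rw [h1, h2, ← Complex.exp_pi_mul_I, Complex.exp_eq_exp_iff_exists_int]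
  refine exists_congr fun k => ?_
  have hπI : (Real.pi : ℂ) * I ≠ 0 := mul_ne_zero hπ I_ne_zero
  rw [div_mul_eq_mul_div, div_eq_iff hN]
  constructor
  · intro h
    refine mul_left_cancel₀ hπI ?_
    rw [h]; ring
  · intro h
    rw [h]; ring

/-- The zeros of the denominator in the half plane `Im z > -Re b` are zeros of the numerator. -/
theorem dilogNum_eq_zero (hb : IsParam b) {m : ZMod N} {z : ℂ} (hz : -b.re < z.im)
    (h : dilogDen N b m z = 0) : dilogNum N b m z = 0 := by
  obtain ⟨j, hj⟩ := exists_of_qProd_eq_zero (hb.norm_q_lt N) h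
  obtain ⟨k, hk⟩ := (one_add_pow_mul_yFun_eq_zero_iff _ _ _).1 hj
  have hbb : b * conj b = 1 := by
    rw [mul_conj, normSq_eq_norm_sq, hb.norm_eq]; simp
  -- The sign (-1)^N enters here: with it, the parity of N(N - 1) makes the index `l` of the
  -- vanishing numerator factor an integer.
  obtain ⟨r, hr⟩ : Even ((N : ℤ) * (N - 1)) := Int.even_mul_pred_self _
  set l : ℤ := -r + N * k + m.val - j - 1 with hl
  have hr' : (N : ℂ) * (N - 1) = r + r := by exact_mod_cast hr
  have hlc : (l : ℂ) = -r + N * k + m.val - j - 1 := by rw [hl]; push_cast; ring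
  have e1 : (2 * (l : ℂ) + 1) * conj b = (2 * j + 1) * b - 2 * I * z := by
    push_cast at hk
    linear_combination conj b * (2 * hlc + hr' - hk) + ((2 * j + 1) * b - 2 * I * z) * hbb
  have e2 : (2 * (l : ℝ) + 1) * b.re = (2 * j + 1) * b.re + 2 * z.im := by
    have := congrArg Complex.re e1
    simpa using this
  -- The half plane condition enters here: (2l + 1) Re b = (2j + 1) Re b + 2 Im z > (2j - 1) Re b
  -- forces l ≥ j.
  have hl0 : 0 ≤ l := by
    have h1 : (2 * (j : ℝ) - 1) * b.re < (2 * (l : ℝ) + 1) * b.re := by rw [e2]; linarith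
    have h2 : (2 * (j : ℝ) - 1) < 2 * (l : ℝ) + 1 := lt_of_mul_lt_mul_right h1 hb.re_pos.le
    have h3 : (2 * (j : ℤ) - 1) < 2 * l + 1 := by exact_mod_cast h2
    omega
  obtain ⟨n, hn⟩ := Int.eq_ofNat_of_zero_le hl0
  have e3 : (2 * (l : ℂ) + 1) * b = (2 * j + 1) * conj b + 2 * I * conj z := by
    have := congrArg (starRingEnd ℂ) e1
    have h2 : conj (2 : ℂ) = 2 := Complex.conj_ofNat 2
    simpa [h2] using this
  have e4 : (l : ℂ) = n := by rw [hn]; simp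
  have h0 : 1 + q N b ^ (2 * n + 1) * ((-1) ^ N * yFun N b m (conj z)) = 0 := by
    refine (one_add_pow_mul_yFun_eq_zero_iff _ _ _).2 ⟨k, ?_⟩
    push_cast
    rw [e4] at e3 hlc
    linear_combination b * e3 + 2 * hlc + hr' + (2 * j + 1) * hbb
  rw [dilogNum, dilogDen, qProd_eq_zero n h0, map_zero]

theorem differentiable_dilogDen (hb : IsParam b) (m : ZMod N) :
    Differentiable ℂ (dilogDen N b m) := fun z =>
  (differentiable_qProd (hb.norm_q_lt N) _).comp z
    ((hasDerivAt_yFun m z).differentiableAt.const_mul _)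

theorem differentiable_dilogNum (hb : IsParam b) (m : ZMod N) :
    Differentiable ℂ (dilogNum N b m) := fun z => by
  have h := (differentiable_dilogDen hb m (conj z)).conj_conj
  simp only [Function.comp_def, conj_conj] at h
  exact h

theorem deriv_dilogDen_ne_zero (hb : IsParam b) {m : ZMod N} {z : ℂ} (h : dilogDen N b m z = 0) :
    deriv (dilogDen N b m) z ≠ 0 := by
  have hN : (N : ℂ) ≠ 0 := Nat.cast_ne_zero.2 (NeZero.ne N)
  have hπ : (Real.pi : ℂ) ≠ 0 := ofReal_ne_zero.2 Real.pi_ne_zero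
  have hb0 : b ≠ 0 := norm_ne_zero_iff.1 (by rw [hb.norm_eq]; exact one_ne_zero)
  have h1 : HasDerivAt (dilogDen N b m) _ z :=
    (differentiable_qProd (hb.norm_q_lt N) _).hasDerivAt.comp z
      ((hasDerivAt_yFun m z).const_mul ((-1) ^ N))
  rw [h1.deriv]
  refine mul_ne_zero (deriv_qProd_ne_zero (hb.norm_q_lt N) (q_ne_zero N b) h)
    (mul_ne_zero (pow_ne_zero _ (by norm_num)) (mul_ne_zero (yFun_ne_zero _ _ _ _)
      (mul_ne_zero (div_ne_zero (mul_ne_zero two_ne_zero hπ) hN) hb0)))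

theorem differentiableAt_dilogFun (hb : IsParam b) (m : ZMod N) {z : ℂ} (hz : -b.re < z.im) :
    DifferentiableAt ℂ (dilogFun N b m) z :=
  differentiableAt_divExt (differentiable_dilogNum hb m) (differentiable_dilogDen hb m) fun h =>
    ⟨dilogNum_eq_zero hb hz h, deriv_dilogDen_ne_zero hb h⟩

theorem dilogDen_shift (hb : IsParam b) (m : ZMod N) (z : ℂ) :
    dilogDen N b m z = dilogFactor N b m z * dilogDen N b (m - 1) (z + I * b) := by
  rw [dilogDen, qProd_eq_mul (hb.norm_q_lt N), dilogDen, yFun_shift, dilogFactor]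
  congr 2
  ring

theorem IsParam.ne_zero (hb : IsParam b) : b ≠ 0 :=
  norm_ne_zero_iff.1 (by rw [hb.norm_eq]; exact one_ne_zero)

theorem dilogDen_shift_dual (hb : IsParam b) (m : ZMod N) (z : ℂ) :
    dilogDen N b (m - 1) (z - I * b⁻¹) = dilogDen N b m z := by
  rw [dilogDen, yFun_shift_dual m z hb.ne_zero, dilogDen]

theorem IsParam.conj_add (hb : IsParam b) (z : ℂ) : conj (z + I * b) = conj z - I * b⁻¹ := by
  simp [hb.conj_eq, sub_eq_add_neg]

theorem IsParam.conj_sub (hb : IsParam b) (z : ℂ) : conj (z - I * b⁻¹) = conj z + I * b := by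
  simp [← hb.conj_eq, sub_eq_add_neg]

theorem continuous_dilogFactor (m : ZMod N) : Continuous (dilogFactor N b m) :=
  continuous_const.add (continuous_const.mul (continuous_const.mul
    (continuous_iff_continuousAt.2 fun z => (hasDerivAt_yFun (b := b) m z).continuousAt)))

/-- Under this shift the denominator loses its first factor while the numerator is invariant, by the
conjugate of `dilogDen_shift_dual`. Removable singularities are filled by continuity. -/
theorem dilogFun_shift (hb : IsParam b) (m : ZMod N) {z : ℂ} (hz : -b.re < z.im) :
    dilogFun N b (m - 1) (z + I * b) = dilogFactor N b m z * dilogFun N b m z := by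
  refine eq_of_forall_ne_zero (f := fun z => dilogFun N b (m - 1) (z + I * b))
    (g := fun z => dilogFactor N b m z * dilogFun N b m z)
    (k := dilogDen N b m) ?_ ((continuous_dilogFactor m).continuousAt.mul
      (differentiableAt_dilogFun hb m hz).continuousAt)
    (differentiable_dilogDen hb m) (fun h => deriv_dilogDen_ne_zero hb h) fun w hw => ?_
  · have h1 : ContinuousAt (dilogFun N b (m - 1)) (z + I * b) :=
      (differentiableAt_dilogFun hb _ (by simp; linarith [hb.re_pos])).continuousAt
    exact h1.comp (f := fun z => z + I * b) (by fun_prop)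
  · have e1 := dilogDen_shift hb m w
    have hw' := hw
    rw [e1] at hw'
    have h1 := left_ne_zero_of_mul hw'
    have h2 := right_ne_zero_of_mul hw'
    simp only [dilogFun]
    rw [divExt_of_ne h2, divExt_of_ne hw, e1, dilogNum, hb.conj_add, dilogDen_shift_dual hb,
      dilogNum]
    field_simp

/-- The roles are exchanged: the denominator is invariant, and the factor splits off from the
numerator. -/
theorem dilogFun_shift_dual (hb : IsParam b) (m : ZMod N) {z : ℂ} (hz : 0 < z.im) :
    dilogFun N b m z = conj (dilogFactor N b m (conj z)) * dilogFun N b (m - 1) (z - I * b⁻¹) := by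
  have hc : Continuous fun z => conj (dilogFactor N b m (conj z)) :=
    continuous_conj.comp ((continuous_dilogFactor m).comp continuous_conj)
  refine eq_of_forall_ne_zero (f := dilogFun N b m)
    (g := fun z => conj (dilogFactor N b m (conj z)) * dilogFun N b (m - 1) (z - I * b⁻¹))
    (k := dilogDen N b m)
    (differentiableAt_dilogFun hb m (by linarith [hb.re_pos])).continuousAt
    (hc.continuousAt.mul ?_)
    (differentiable_dilogDen hb m) (fun h => deriv_dilogDen_ne_zero hb h) fun w hw => ?_
  · have h1 : ContinuousAt (dilogFun N b (m - 1)) (z - I * b⁻¹) :=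
      (differentiableAt_dilogFun hb _ (by simpa [← hb.conj_eq] using hz)).continuousAt
    exact h1.comp (f := fun z => z - I * b⁻¹) (by fun_prop)
  · have h2 : dilogDen N b (m - 1) (w - I * b⁻¹) ≠ 0 := by rwa [dilogDen_shift_dual hb]
    simp only [dilogFun]
    rw [divExt_of_ne h2, divExt_of_ne hw, dilogDen_shift_dual hb, dilogNum,
      dilogDen_shift hb m (conj w), dilogNum, hb.conj_sub, map_mul, mul_div_assoc]

/-- The two functional equations compose to a real translation, since ib - ib⁻¹ = -2 Im b when |b| =
1. -/
theorem dilogFun_real_shift (hb : IsParam b) (m : ZMod N) {z : ℂ} (hz : -b.re < z.im) :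
    dilogFactor N b m z * dilogFun N b m z =
      conj (dilogFactor N b m (conj z)) * dilogFun N b (m - 2) (z - (2 * b.im : ℝ)) := by
  rw [← dilogFun_shift hb m hz, dilogFun_shift_dual hb (m - 1) (by simp; linarith)]
  congr 2
  · rw [dilogFactor, dilogFactor, hb.conj_add, yFun_shift_dual _ _ hb.ne_zero]
  · ring_nf
  · rw [← hb.conj_eq]
    apply Complex.ext <;> simp
    ring

theorem norm_one_add_le {a a' : ℂ} {g D : ℝ} (hD : 1 ≤ D) (ha : g ≤ ‖a‖ * D) (ha' : ‖a‖ ≤ g * D)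
    (h' : ‖a'‖ ≤ g * D) (hg : 2 * D ≤ g ∨ g * D ≤ 1 / 2) :
    0 < ‖1 + a‖ ∧ ‖1 + a'‖ ≤ 4 * D ^ 2 * ‖1 + a‖ := by
  have n1 : ‖1 + a'‖ ≤ 1 + ‖a'‖ := (norm_add_le _ _).trans (by simp)
  have n2 : ‖a‖ - 1 ≤ ‖1 + a‖ := by
    have := norm_sub_norm_le a (-1)
    rwa [norm_neg, norm_one, sub_neg_eq_add, add_comm] at this
  have n3 : 1 - ‖a‖ ≤ ‖1 + a‖ := by
    have := norm_sub_norm_le 1 (-a)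
    rwa [norm_neg, norm_one, sub_neg_eq_add] at this
  rcases hg with hg | hg
  · have h1 : g ≤ 2 * D * ‖1 + a‖ := by nlinarith
    refine ⟨by nlinarith, ?_⟩
    nlinarith
  · have h2 : 1 / 2 ≤ ‖1 + a‖ := by linarith
    refine ⟨by linarith, ?_⟩
    nlinarith [one_le_pow₀ hD (n := 2)]

/-- The modulus of qy(z) is |q|e^{λ(Re b Re z - Im b Im z)} with λ = 2π/N; conjugating z affects
only the second term, which is bounded on the strip. For large |Re z| the factor is therefore away
from its zeros and comparable with its value at the conjugate point. -/
theorem exists_dilogFactor_ratio (hb : IsParam b) {T : ℝ} (hT0 : 0 ≤ T) :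
    ∃ K X : ℝ, 1 ≤ K ∧ ∀ (m : ZMod N) z, |z.im| ≤ T → X ≤ |z.re| →
      0 < ‖dilogFactor N b m z‖ ∧
        ‖dilogFactor N b m (conj z)‖ ≤ K * ‖dilogFactor N b m z‖ := by
  have hN : (0 : ℝ) < N := Nat.cast_pos.2 (NeZero.pos N)
  have hq : 0 < ‖q N b‖ := norm_pos_iff.2 (q_ne_zero N b)
  set lam : ℝ := 2 * Real.pi / N with hlam
  have hlam0 : 0 < lam := by positivity
  set D : ℝ := Real.exp (lam * (b.im * T)) with hD
  have hD1 : 1 ≤ D := Real.one_le_exp (mul_nonneg hlam0.le (mul_nonneg hb.im_pos.le hT0))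
  have hc : 0 < lam * b.re := mul_pos hlam0 hb.re_pos
  refine ⟨4 * D ^ 2, (Real.log (2 * D) + |Real.log ‖q N b‖|) / (lam * b.re),
    by nlinarith [one_le_pow₀ hD1 (n := 2)], fun m z hy h3 => ?_⟩
  set g : ℝ := Real.exp (Real.log ‖q N b‖ + lam * b.re * z.re) with hg
  have hn : ∀ w : ℂ, w.re = z.re → |w.im| ≤ T →
      g ≤ ‖q N b * ((-1) ^ N * yFun N b m w)‖ * D ∧
        ‖q N b * ((-1) ^ N * yFun N b m w)‖ ≤ g * D := by
    intro w hw hw'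
    have e1 : ‖q N b * ((-1) ^ N * yFun N b m w)‖ =
        Real.exp (Real.log ‖q N b‖ + lam * b.re * z.re - lam * (b.im * w.im)) := by
      rw [norm_mul, norm_mul, norm_pow, norm_neg, norm_one, one_pow, one_mul, norm_yFun_complex,
        ← Real.exp_log hq, ← Real.exp_add, Real.log_exp, mul_re, hw]
      congr 1; ring
    have e2 : |lam * (b.im * w.im)| ≤ lam * (b.im * T) := by
      rw [abs_mul, abs_mul, abs_of_pos hlam0, abs_of_pos hb.im_pos]
      have := hb.im_pos
      gcongr
    have e3 := abs_le.1 e2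
    rw [e1, hg, hD, ← Real.exp_add, ← Real.exp_add, Real.exp_le_exp, Real.exp_le_exp]
    constructor <;> linarith [e3.1, e3.2]
  obtain ⟨p1, p2⟩ := hn z rfl hy
  obtain ⟨-, p3⟩ := hn (conj z) (by simp) (by simpa using hy)
  refine norm_one_add_le hD1 p1 p2 p3 ?_
  have hX : Real.log (2 * D) + |Real.log ‖q N b‖| ≤ lam * b.re * |z.re| := by
    rw [mul_comm (lam * b.re)]; exact (div_le_iff₀ hc).1 h3
  have h2D : (0 : ℝ) < 2 * D := by positivity
  rcases abs_cases z.re with ⟨ha, -⟩ | ⟨ha, -⟩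
  · left
    rw [ha] at hX
    rw [← Real.exp_log h2D, hg]
    exact Real.exp_le_exp.2 (by linarith [neg_abs_le (Real.log ‖q N b‖)])
  · right
    rw [ha] at hX
    have h4 : g ≤ (2 * D)⁻¹ := by
      rw [← Real.exp_log h2D, ← Real.exp_neg, hg]
      exact Real.exp_le_exp.2 (by linarith [le_abs_self (Real.log ‖q N b‖)])
    calc g * D ≤ (2 * D)⁻¹ * D := by gcongr
      _ = 1 / 2 := by field_simp

theorem halfPlaneMult_dilogFun (hb : IsParam b) : HalfPlaneMult 1 b.re (dilogFun N b) where
  diff m z hz := differentiableAt_dilogFun hb m (by simpa using hz)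
  growth s t hs := by
    obtain ⟨K, X, hK, hb'⟩ := exists_dilogFactor_ratio (N := N) hb (T := max |s| |t|)
      ((abs_nonneg s).trans (le_max_left _ _))
    simp only [one_mul]
    have hh : 0 < 2 * b.im := by linarith [hb.im_pos]
    -- The extra 2 Im b in X is for the left side, where the relation is applied at z + 2 Im b,
    -- which must still have |Re| ≥ X.
    refine exp_growth_of_shift (h := 2 * b.im) (K := K) (X := X + 2 * b.im) (k := 2) hh hK
      (fun m z hz => (differentiableAt_dilogFun hb m
        (lt_of_lt_of_le hs hz.1)).continuousAt.continuousWithinAt) (fun m z h1 h2 h3 => ?_)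
      fun m z h1 h2 h3 => ?_
    · obtain ⟨e1, e2⟩ := hb' m z (abs_le_max_abs_abs h1 h2) (by linarith [le_abs_self z.re])
      have e3 := congrArg norm (dilogFun_real_shift hb m (lt_of_lt_of_le hs h1))
      rw [norm_mul, norm_mul, RCLike.norm_conj] at e3
      refine le_of_mul_le_mul_left ?_ e1
      rw [e3, ← mul_assoc, mul_comm _ K]
      exact mul_le_mul_of_nonneg_right e2 (norm_nonneg _)
    · have hw : (z + ((2 * b.im : ℝ) : ℂ)).im = z.im := by
        rw [add_im, ofReal_im, add_zero]
      obtain ⟨e1, e2⟩ := hb' (m + 2) (conj (z + ((2 * b.im : ℝ) : ℂ)))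
        (by rw [conj_im, hw, abs_neg]; exact abs_le_max_abs_abs h1 h2)
        (by rw [conj_re, add_re, ofReal_re]; linarith [neg_le_abs (z.re + 2 * b.im)])
      have e3 := congrArg norm (dilogFun_real_shift hb (m + 2)
        (z := z + ((2 * b.im : ℝ) : ℂ)) (by rw [hw]; exact lt_of_lt_of_le hs h1))
      rw [norm_mul, norm_mul, RCLike.norm_conj, add_sub_cancel_right, add_sub_cancel_right] at e3
      rw [conj_conj] at e2
      refine le_of_mul_le_mul_left ?_ e1
      rw [← e3, ← mul_assoc, mul_comm _ K]
      exact mul_le_mul_of_nonneg_right e2 (norm_nonneg _)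

end LevelN

namespace LevelN

/-! ### The multiplication operators `φ(c y^σ)` -/

/-- Because λ = (-1)^N y(μ, n) and y is multiplicative, φ(λy) is a real translate of the basic
multiplier. -/
theorem DilogMult.translate {N : ℕ} {b : ℂ} {p Φ : ZMod N → ℂ → ℂ} (h : DilogMult N b p Φ)
    (μ : ℝ) (n : ZMod N) :
    DilogMult N b (fun m z => p (m + n) (z + μ)) fun m z => Φ (m + n) (z + μ) where
  mult :=
    { diff := fun m z hz => by
        have h1 : DifferentiableAt ℂ (Φ (m + n)) (z + μ) := h.mult.diff _ _ (by simpa using hz)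
        exact h1.comp z (f := fun z => z + (μ : ℂ)) (by fun_prop)
      growth := fun s t hs => by
        obtain ⟨C, K, hC, hb⟩ := h.mult.growth s t hs
        refine ⟨C * Real.exp (|K| * |μ|), |K|, by positivity, fun m z h1 h2 => ?_⟩
        refine (hb (m + n) (z + μ) (by simpa using h1) (by simpa using h2)).trans ?_
        rw [add_re, ofReal_re]
        exact exp_abs_add_le hC }
  shift m z hz := by
    have := h.shift (m + n) (z + μ) (by simpa using hz)
    rw [← this, sub_add_eq_add_sub, add_right_comm]
  shift_dual m z hz := by
    have := h.shift_dual (m + n) (z + μ) (by simpa using hz)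
    rw [this, sub_add_eq_add_sub, sub_add_eq_add_sub, map_add, conj_ofReal]
  norm_eq m x := by
    have := h.norm_eq (m + n) (x + μ)
    rwa [ofReal_add] at this
  factor m := by
    obtain ⟨κ, τ, hτ, hz⟩ := h.factor (m + n)
    refine ⟨κ * exp (τ * μ), τ, hτ, fun z => ?_⟩
    rw [hz, mul_add, exp_add]
    ring

/-- The reflection z ↦ μ - z needed for y⁻¹ reverses the half plane, and conjugation restores it. On
ℝ conjugation inverts, so this multiplier represents φ(λy⁻¹)⁻¹. -/
theorem DilogMult.reflect {N : ℕ} {b : ℂ} (hb : IsParam b) {p Φ : ZMod N → ℂ → ℂ} (h : DilogMult N b p Φ)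
    (μ : ℝ) (n : ZMod N) :
    DilogMult N b (fun m z => p (n - m + 1) (μ - z - I * b))
      fun m z => conj (Φ (n - m) (conj (μ - z))) where
  mult :=
    { diff := fun m z hz => by
        have h1 : DifferentiableAt ℂ (Φ (n - m)) (starRingEnd ℂ (μ - z)) :=
          h.mult.diff _ _ (by simpa using hz)
        have h2 := h1.conj_conj
        rw [conj_conj] at h2
        exact h2.comp z (f := fun z => (μ : ℂ) - z) (by fun_prop)
      growth := fun s t hs => by
        obtain ⟨C, K, hC, hb⟩ := h.mult.growth s t hs
        refine ⟨C * Real.exp (|K| * |μ|), |K|, by positivity, fun m z h1 h2 => ?_⟩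
        rw [RCLike.norm_conj]
        refine (hb (n - m) (conj (μ - z)) (by simpa using h1) (by simpa using h2)).trans ?_
        rw [conj_re, sub_re, ofReal_re, abs_sub_comm, sub_eq_add_neg, ← abs_neg μ]
        exact exp_abs_add_le hC }
  shift m z hz := by
    have e : conj ((μ : ℂ) - (z + I * b)) = conj (μ - z) + I * b⁻¹ := by
      rw [← hb.conj_eq]; simp; ring
    have h1 := h.shift_dual (n - m + 1) (conj ((μ : ℂ) - (z + I * b)))
      (by simp; linarith)
    rw [conj_conj] at h1
    rw [show n - (m - 1) = n - m + 1 by ring, h1, e, add_sub_cancel_right, add_sub_cancel_right,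
      map_mul, conj_conj, sub_add_eq_sub_sub]
  shift_dual m z hz := by
    have e : conj ((μ : ℂ) - (z - I * b⁻¹)) = conj (μ - z) - I * b := by
      rw [← hb.conj_eq]; simp; ring
    have h1 := h.shift (n - m + 1) (conj ((μ : ℂ) - z) - I * b) (by simp; linarith)
    rw [add_sub_cancel_right, sub_add_cancel] at h1
    rw [show n - (m - 1) = n - m + 1 by ring, h1, e, map_mul, map_sub, conj_ofReal]
  norm_eq m x := by
    have := h.norm_eq (n - m) (μ - x)
    rw [RCLike.norm_conj, ← ofReal_sub, conj_ofReal, this]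
  factor m := by
    obtain ⟨κ, τ, hτ, hz⟩ := h.factor (n - m + 1)
    refine ⟨κ * exp (τ * (μ - I * b)), -τ, by simpa using hτ, fun z => ?_⟩
    rw [hz, mul_assoc, ← exp_add]
    ring_nf

variable {N : ℕ} [NeZero N] {b : ℂ}

theorem qdilog_conj (hb : IsParam b) (w : ℂ) :
    qdilog N b w (conj w) = conj (qProd (q N b) w) / qProd (q N b) w := by
  have hm : Multipliable fun j : ℕ => (1 + q N b ^ (2 * j + 1) * w) :=
    multipliable_one_add_of_summable (summable_qProd (hb.norm_q_lt N) w)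
  have hc : (∏' j : ℕ, (1 + (qt N b)⁻¹ ^ (2 * j + 1) * conj w)) = conj (qProd (q N b) w) := by
    rw [qProd, hm.map_tprod (starRingEnd ℂ) Complex.continuous_conj]
    refine tprod_congr fun j => ?_
    simp [← hb.conj_q]
  rw [qdilog, hc, inv_div, qProd]

/-- Only almost everywhere: at a real zero of the denominator `qdilog` is 0 by the convention for
division, while `dilogFun` takes the value of the continuation. -/
theorem ae_qdilog_eq (hb : IsParam b) {l : ℂ} {σ : ℤˣ} {m n : ZMod N} {w : ℝ → ℝ}
    (h : ∀ x : ℝ, l * yFun N b m x ^ (σ : ℤ) = (-1) ^ N * yFun N b n (w x)) :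
    ∀ᵐ x : ℝ, qdilog N b (l * yFun N b m x ^ (σ : ℤ)) (conj l * ytFun N b m x ^ (σ : ℤ)) =
      dilogFun N b n (w x) ∧ ‖dilogFun N b n (w x)‖ = 1 := by
  filter_upwards [ae_norm_qdilog hb N l σ m] with x hx
  rw [conj_arg hb, h, qdilog_conj hb] at *
  have h0 : dilogDen N b n (w x) ≠ 0 := by
    intro h0
    rw [dilogDen] at h0
    rw [h0, div_zero, norm_zero] at hx
    exact zero_ne_one hx
  have h1 : dilogFun N b n (w x) = conj (dilogDen N b n (w x)) / dilogDen N b n (w x) := by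
    rw [dilogFun, divExt_of_ne h0, dilogNum, conj_ofReal]
  rw [h1]
  exact ⟨rfl, hx⟩

/-- Continuity on ℝ upgrades the almost everywhere statement, covering the removable singularities.
-/
theorem norm_dilogFun (hb : IsParam b) (m : ZMod N) (x : ℝ) : ‖dilogFun N b m x‖ = 1 := by
  have hc : Continuous fun x : ℝ => ‖dilogFun N b m x‖ := by
    refine continuous_iff_continuousAt.2 fun x => ?_
    have h1 : ContinuousAt (dilogFun N b m) x :=
      (differentiableAt_dilogFun hb m (by simpa using hb.re_pos)).continuousAt
    exact (h1.comp (f := fun x : ℝ => (x : ℂ)) continuous_ofReal.continuousAt).norm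
  have h := (hc.ae_eq_iff_eq volume continuous_const (g := fun _ => (1 : ℝ))).1 (by
    filter_upwards [ae_qdilog_eq hb (l := (-1) ^ N) (σ := 1) (m := m) (n := m) (w := id)
      (by simp)] with y hy using hy.2)
  exact congrFun h x

theorem dilogY_ae (hb : IsParam b) (l : ℂ) (σ : ℤˣ) (x : HS N) (m : ZMod N) :
    (dilogY hb N l σ x m : L2R) =ᵐ[volume] fun t : ℝ =>
      qdilog N b (l * yFun N b m t ^ (σ : ℤ)) (conj l * ytFun N b m t ^ (σ : ℤ)) *
        (x m : L2R) t :=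
  mulIso_ae _ (measurable_qdilog N l σ m).aestronglyMeasurable (ae_norm_qdilog hb N l σ m) (x m)

theorem dilogMult_dilogFun (hb : IsParam b) :
    DilogMult N b (dilogFactor N b) (dilogFun N b) where
  mult := halfPlaneMult_dilogFun hb
  shift m _ hz := dilogFun_shift hb m hz
  shift_dual m _ hz := dilogFun_shift_dual hb m hz
  norm_eq := norm_dilogFun hb
  factor m := by
    refine ⟨q N b * ((-1) ^ N * ZMod.stdAddChar (-m)), 2 * Real.pi / N * b, ?_, fun z => ?_⟩
    · have h : (2 * Real.pi / N * b : ℂ) = ((2 * Real.pi / N : ℝ) : ℂ) * b := by push_cast; rfl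
      have hN : (0 : ℝ) < N := Nat.cast_pos.2 (NeZero.pos N)
      rw [h, re_ofReal_mul]
      exact (mul_pos (by positivity) hb.re_pos).ne'
    · rw [dilogFactor, yFun_eq]
      ring

/-! ### Conjugation of second order difference operators -/

theorem dilogFactor_translate {l : ℂ} {μ : ℝ} {n : ZMod N} (hl : l = (-1) ^ N * yFun N b n μ)
    (m : ZMod N) (z : ℂ) : dilogFactor N b (m + n) (z + μ) = 1 + q N b * l * yFun N b m z := by
  rw [dilogFactor, yFun_add, hl]
  ring

theorem dilogFactor_reflect {l : ℂ} {μ : ℝ} {n : ZMod N} (hl : l = (-1) ^ N * yFun N b n μ)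
    (m : ZMod N) (z : ℂ) : dilogFactor N b (n - m + 1) (μ - z - I * b) =
      1 + (q N b)⁻¹ * l * (yFun N b m z)⁻¹ := by
  have hq := q_ne_zero N b
  rw [dilogFactor, yFun_shift_inv, sub_eq_add_neg n, sub_eq_add_neg (μ : ℂ), yFun_add, yFun_neg, hl]
  field_simp

theorem conjugates_dilogY (hb : IsParam b) {l : ℂ} {μ : ℝ} {n : ZMod N}
    (hl : l = (-1) ^ N * yFun N b n μ) {A B : Module.End ℂ (W N)}
    {am a0 ap bm bp : ZMod N → ℂ → ℂ}
    (hA : HasCoeffs 1 (I * b) A am a0 ap) (hB : HasCoeffs 1 (I * b) B bm a0 bp)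
    (hm : ∀ m (x : ℝ), bm m x = am m x * (1 + (q N b)⁻¹ * l * yFun N b m x))
    (hp : ∀ m (x : ℝ), ap m x = bp m x * (1 + q N b * l * yFun N b m x)) :
    Conjugates (dilogY hb N l 1) A B := by
  have hq := q_ne_zero N b
  refine ((dilogMult_dilogFun hb).translate μ n).conjugates hb hA hB (fun x m => ?_)
    (fun _ _ => rfl) (fun m x => ?_) fun m x => ?_
  · filter_upwards [dilogY_ae hb l 1 x m, ae_qdilog_eq hb (l := l) (σ := 1) (m := m) (n := m + n)
      (w := fun t => t + μ) (fun t => by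
        rw [Units.val_one, zpow_one, ofReal_add, yFun_add, hl]; ring)] with t h1 h2
    rw [h1, h2.1, ofReal_add]
  · rw [dilogFactor_translate hl, yFun_shift_inv, hm]
    field_simp
  · rw [dilogFactor_translate hl, hp]

/-- Stated without a backward shift, the only case in which y⁻¹ occurs; the condition on that
coefficient is then trivial. -/
theorem conjugates_dilogY_neg (hb : IsParam b) {l : ℂ} {μ : ℝ} {n : ZMod N}
    (hl : l = (-1) ^ N * yFun N b n μ) {A B : Module.End ℂ (W N)} {a0 ap bp : ZMod N → ℂ → ℂ}
    (hA : HasCoeffs 1 (I * b) A (fun _ _ => 0) a0 ap)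
    (hB : HasCoeffs 1 (I * b) B (fun _ _ => 0) a0 bp)
    (hp : ∀ m (x : ℝ), ap m x = bp m x * (1 + (q N b)⁻¹ * l * (yFun N b m x)⁻¹)) :
    Conjugates (dilogY hb N l (-1))⁻¹ A B := by
  refine ((dilogMult_dilogFun hb).reflect hb μ n).conjugates hb hA hB (fun x m => ?_)
    (fun _ _ => rfl) (fun m x => by rw [zero_mul]) fun m x => ?_
  · have h0 := dilogY_ae hb l (-1) ((dilogY hb N l (-1))⁻¹ x) m
    have e : dilogY hb N l (-1) ((dilogY hb N l (-1))⁻¹ x) = x :=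
      (dilogY hb N l (-1)).apply_symm_apply x
    rw [e] at h0
    filter_upwards [h0, ae_qdilog_eq hb (l := l) (σ := -1) (m := m) (n := n - m)
      (w := fun t => μ - t) (fun t => by
        rw [Units.val_neg, Units.val_one, zpow_neg_one, ofReal_sub, sub_eq_add_neg n,
          sub_eq_add_neg (μ : ℂ), yFun_add, yFun_neg, hl]; ring)] with t h1 h2
    rw [h1, h2.1, ← ofReal_sub, conj_ofReal, ← mul_assoc, mul_comm (starRingEnd ℂ _), mul_conj,
      normSq_eq_norm_sq, h2.2]
    simp
  · rw [dilogFactor_reflect hl, hp]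

theorem expBdd_yFun (m : ZMod N) : ExpBdd fun x : ℝ => yFun N b m x := by
  simp only [yFun_eq]
  simpa using (expBdd_const (ZMod.stdAddChar (-m))).mul (expBdd_exp (2 * Real.pi / N * b) 0)

theorem expBdd_yFun_inv (m : ZMod N) : ExpBdd fun x : ℝ => (yFun N b m x)⁻¹ := by
  simp only [yFun_eq, mul_inv, ← Complex.exp_neg]
  simpa using (expBdd_const (ZMod.stdAddChar (-m))⁻¹).mul (expBdd_exp (-(2 * Real.pi / N * b)) 0)

/-! ### Coefficients of the operators between Q₁'' and Q₁'. -/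

section

variable (l₁ l₂ : ℂ)

theorem hasCoeffs_y_add_u : HasCoeffs 1 (I * b)
    (l₂ • yInvEnd N b + l₂⁻¹ • yEnd N b + l₁⁻¹ • uEnd N b) (fun _ _ => 0)
    (fun m z => l₂ * (yFun N b m z)⁻¹ + l₂⁻¹ * yFun N b m z) (fun _ _ => l₁⁻¹) where
  eq f m z := by
    change l₂ * ((yFun N b m z)⁻¹ * (f : ZMod N → ℂ → ℂ) m z) +
      l₂⁻¹ * (yFun N b m z * (f : ZMod N → ℂ → ℂ) m z) +
      l₁⁻¹ * (f : ZMod N → ℂ → ℂ) (m - 1) (z + I * b) = _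
    ring
  bm _ := expBdd_const 0
  b0 m := ((expBdd_const _).mul (expBdd_yFun_inv m)).add ((expBdd_const _).mul (expBdd_yFun m))
  bp _ := expBdd_const _

theorem hasCoeffs_y_add_u_linear : HasCoeffs 1 (I * b)
    (l₂ • yInvEnd N b + l₂⁻¹ • yEnd N b + l₁⁻¹ • uEnd N b + q N b • (yEnd N b * uEnd N b))
    (fun _ _ => 0) (fun m z => l₂ * (yFun N b m z)⁻¹ + l₂⁻¹ * yFun N b m z)
    (fun m z => l₁⁻¹ + q N b * yFun N b m z) where
  eq f m z := by
    change l₂ * ((yFun N b m z)⁻¹ * (f : ZMod N → ℂ → ℂ) m z) +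
      l₂⁻¹ * (yFun N b m z * (f : ZMod N → ℂ → ℂ) m z) +
      l₁⁻¹ * (f : ZMod N → ℂ → ℂ) (m - 1) (z + I * b) +
      q N b * (yFun N b m z * (f : ZMod N → ℂ → ℂ) (m - 1) (z + I * b)) = _
    ring
  bm _ := expBdd_const 0
  b0 m := ((expBdd_const _).mul (expBdd_yFun_inv m)).add ((expBdd_const _).mul (expBdd_yFun m))
  bp m := (expBdd_const _).add ((expBdd_const _).mul (expBdd_yFun m))

theorem hasCoeffs_y_add_u_quadratic : HasCoeffs 1 (I * b)
    (l₂ • yInvEnd N b + l₂⁻¹ • yEnd N b + (l₁ + l₁⁻¹) • uEnd N b +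
      q N b • (yEnd N b * uEnd N b) + (q N b)⁻¹ • (yInvEnd N b * uEnd N b))
    (fun _ _ => 0) (fun m z => l₂ * (yFun N b m z)⁻¹ + l₂⁻¹ * yFun N b m z)
    (fun m z => l₁ + l₁⁻¹ + q N b * yFun N b m z + (q N b)⁻¹ * (yFun N b m z)⁻¹) where
  eq f m z := by
    change l₂ * ((yFun N b m z)⁻¹ * (f : ZMod N → ℂ → ℂ) m z) +
      l₂⁻¹ * (yFun N b m z * (f : ZMod N → ℂ → ℂ) m z) +
      (l₁ + l₁⁻¹) * (f : ZMod N → ℂ → ℂ) (m - 1) (z + I * b) +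
      q N b * (yFun N b m z * (f : ZMod N → ℂ → ℂ) (m - 1) (z + I * b)) +
      (q N b)⁻¹ * ((yFun N b m z)⁻¹ * (f : ZMod N → ℂ → ℂ) (m - 1) (z + I * b)) = _
    ring
  bm _ := expBdd_const 0
  b0 m := ((expBdd_const _).mul (expBdd_yFun_inv m)).add ((expBdd_const _).mul (expBdd_yFun m))
  bp m := ((expBdd_const _).add ((expBdd_const _).mul (expBdd_yFun m))).add
    ((expBdd_const _).mul (expBdd_yFun_inv m))

theorem hasCoeffs_u_add_y_inv : HasCoeffs 1 (I * b)
    (l₂ • uInvEnd N b + l₂⁻¹ • uEnd N b + (l₁ + l₁⁻¹) • yInvEnd N b +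
      q N b • (uEnd N b * yInvEnd N b) + (q N b)⁻¹ • (uInvEnd N b * yInvEnd N b))
    (fun m z => l₂ + q N b * (yFun N b m z)⁻¹) (fun m z => (l₁ + l₁⁻¹) * (yFun N b m z)⁻¹)
    (fun m z => l₂⁻¹ + (q N b)⁻¹ * (yFun N b m z)⁻¹) where
  eq f m z := by
    change l₂ * (f : ZMod N → ℂ → ℂ) (m + 1) (z + -(I * b)) +
      l₂⁻¹ * (f : ZMod N → ℂ → ℂ) (m - 1) (z + I * b) +
      (l₁ + l₁⁻¹) * ((yFun N b m z)⁻¹ * (f : ZMod N → ℂ → ℂ) m z) +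
      q N b * ((yFun N b (m - 1) (z + I * b))⁻¹ * (f : ZMod N → ℂ → ℂ) (m - 1) (z + I * b)) +
      (q N b)⁻¹ * ((yFun N b (m + 1) (z + -(I * b)))⁻¹ *
        (f : ZMod N → ℂ → ℂ) (m + 1) (z + -(I * b))) = _
    have hq := q_ne_zero N b
    have hy := yFun_ne_zero N b m z
    rw [← sub_eq_add_neg, yFun_shift, yFun_shift_inv]
    -- No nonvanishing of l₁, l₂ is assumed, so their inverses are treated as independent symbols.
    generalize l₂⁻¹ = k₂
    generalize l₁⁻¹ = k₁
    field_simp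
    ring
  bm m := (expBdd_const _).add ((expBdd_const _).mul (expBdd_yFun_inv m))
  b0 m := (expBdd_const _).mul (expBdd_yFun_inv m)
  bp m := (expBdd_const _).add ((expBdd_const _).mul (expBdd_yFun_inv m))

theorem hasCoeffs_Q₁' : HasCoeffs 1 (I * b) (Q₁' N b l₁ l₂)
    (fun m z => (q N b)⁻¹ * yFun N b m z + (l₂ + l₂⁻¹) + q N b * (yFun N b m z)⁻¹)
    (fun m z => (l₁ + l₁⁻¹) * (yFun N b m z)⁻¹)
    (fun m z => (q N b)⁻¹ * (yFun N b m z)⁻¹) where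
  eq f m z := by
    rw [Q₁'_eq]
    change q N b * (yFun N b (m + 1) (z + -(I * b)) *
        (f : ZMod N → ℂ → ℂ) (m + 1) (z + -(I * b))) +
      q N b * ((yFun N b (m - 1) (z + I * b))⁻¹ * (f : ZMod N → ℂ → ℂ) (m - 1) (z + I * b)) +
      (l₁ + l₁⁻¹) * ((yFun N b m z)⁻¹ * (f : ZMod N → ℂ → ℂ) m z) +
      (l₂ + l₂⁻¹) * (f : ZMod N → ℂ → ℂ) (m + 1) (z + -(I * b)) +
      (q N b)⁻¹ * ((yFun N b (m + 1) (z + -(I * b)))⁻¹ *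
        (f : ZMod N → ℂ → ℂ) (m + 1) (z + -(I * b))) = _
    have hq := q_ne_zero N b
    have hy := yFun_ne_zero N b m z
    rw [← sub_eq_add_neg, yFun_shift, yFun_shift_inv]
    field_simp
    ring
  bm m := (((expBdd_const _).mul (expBdd_yFun m)).add (expBdd_const _)).add
    ((expBdd_const _).mul (expBdd_yFun_inv m))
  b0 m := (expBdd_const _).mul (expBdd_yFun_inv m)
  bp m := (expBdd_const _).mul (expBdd_yFun_inv m)

theorem conjugates_fourier_quadratic : Conjugates (fourierU N)
    (l₂ • uInvEnd N b + l₂⁻¹ • uEnd N b + (l₁ + l₁⁻¹) • yInvEnd N b +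
      q N b • (uEnd N b * yInvEnd N b) + (q N b)⁻¹ • (uInvEnd N b * yInvEnd N b))
    (l₂ • yInvEnd N b + l₂⁻¹ • yEnd N b + (l₁ + l₁⁻¹) • uEnd N b +
      q N b • (yEnd N b * uEnd N b) + (q N b)⁻¹ • (yInvEnd N b * uEnd N b)) := by
  obtain ⟨e, he, hu, hu', -, hy'⟩ := exists_fourier_lift (N := N)
  refine he.conjugates fun f => ?_
  simp only [LinearMap.add_apply, LinearMap.smul_apply, Module.End.mul_apply, map_add, map_smul,
    hu, hu', hy']

end

/-- The chain runs from Q₁'' to Q₁' and is inverted at the end. Its algebra is (λ₁⁻¹ + qy)(1 +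
q⁻¹λ₁y⁻¹) = λ₁ + λ₁⁻¹ + qy + q⁻¹y⁻¹ for the middle steps and (λ₂ + qy⁻¹)(1 + q⁻¹λ₂⁻¹y) = q⁻¹y + λ₂ +
λ₂⁻¹ + qy⁻¹ for the last. -/
theorem conjugates_C₁ (hb : IsParam b) {l₁ l₂ : ℂ} {μ₁ μ₂ : ℝ} {m₁ m₂ : ZMod N}
    (h₁ : l₁ = (-1) ^ N * yFun N b m₁ μ₁) (h₂ : l₂ = (-1) ^ N * yFun N b m₂ μ₂) :
    Conjugates (C₁ hb N l₁ l₂) (Q₁' N b l₁ l₂) (Q₁'' N b l₁ l₂) := by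
  have hq := q_ne_zero N b
  have hy : ∀ m (x : ℝ), yFun N b m x ≠ 0 := fun m x => yFun_ne_zero N b m x
  have hl₁ : l₁ ≠ 0 := by
    rw [h₁]; exact mul_ne_zero (pow_ne_zero _ (by norm_num)) (yFun_ne_zero _ _ _ _)
  have hl₂ : l₂ ≠ 0 := by
    rw [h₂]; exact mul_ne_zero (pow_ne_zero _ (by norm_num)) (yFun_ne_zero _ _ _ _)
  -- The inverse of λ₂ has the admissible form again, with opposite parameters, since (-1)^N is its
  -- own inverse.
  have h₂' : l₂⁻¹ = (-1) ^ N * yFun N b (-m₂) ((-μ₂ : ℝ) : ℂ) := by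
    rw [h₂, ofReal_neg, yFun_neg, mul_inv, ← inv_pow, inv_neg_one]
  have s0 := conjugates_fourier (N := N) (b := b) l₂ l₂⁻¹ l₁⁻¹
  rw [← Q₁''_eq] at s0
  have s1 := (conjugates_dilogY hb h₁ (hasCoeffs_y_add_u_linear l₁ l₂) (hasCoeffs_y_add_u l₁ l₂)
    (fun m x => by rw [zero_mul]) (fun m x => by field_simp)).inv
  have s2 := (conjugates_dilogY_neg hb h₁ (hasCoeffs_y_add_u_quadratic l₁ l₂) (hasCoeffs_y_add_u_linear l₁ l₂)
    (fun m x => by have := hy m x; field_simp; ring)).inv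
  have s3 := (conjugates_fourier_quadratic (N := N) (b := b) l₁ l₂).inv
  have s4 := conjugates_dilogY hb h₂' (hasCoeffs_u_add_y_inv l₁ l₂) (hasCoeffs_Q₁' l₁ l₂)
    (fun m x => by have := hy m x; field_simp; ring)
    (fun m x => by have := hy m x; field_simp; ring)
  have s := (s4.mul (s3.mul (s2.mul (s1.mul s0)))).inv
  convert s using 1
  simp only [C₁, dilogU, mul_inv_rev, inv_inv, mul_assoc, mul_inv_cancel_left]

end LevelN

theorem mainTheorem6 (N : ℕ) [NeZero N] (b : ℂ) (hb : IsParam b)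
    (μ₁ μ₂ : ℝ) (m₁ m₂ : ZMod N) :
    (∀ l₁ l₂ : ℂ, l₁ = (-1) ^ N * yFun N b m₁ μ₁ → l₂ = (-1) ^ N * yFun N b m₂ μ₂ →
      (toPMap (Q₁' N b l₁ l₂)).IsClosable ∧ (toPMap (Q₁'' N b l₁ l₂)).IsClosable ∧
      conjPMap (C₁ hb N l₁ l₂) (toPMap (Q₁' N b l₁ l₂)).closure =
        (toPMap (Q₁'' N b l₁ l₂)).closure) ∧
    (∀ (σ : ℤˣ) (l₁ l₂ : ℂ), l₁ = (σ : ℤ) * yFun N b m₁ μ₁ → l₂ = (σ : ℤ) * yFun N b m₂ μ₂ →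
      (toPMap (Q₁'' N b l₁ l₂)).IsClosable ∧ (toPMap (LOp N b)).IsClosable ∧
      conjPMap (fourierU N * (phaseU N μ₂ m₂)⁻¹ * shiftU N μ₁ m₁)
          (toPMap (Q₁'' N b l₁ l₂)).closure =
        (toPMap ((σ : ℤ) • LOp N b)).closure) := by
  refine ⟨fun l₁ l₂ h₁ h₂ => ?_, fun σ l₁ l₂ h₁ h₂ => ?_⟩
  · have hA := isClosable_Q₁' (N := N) hb l₁ l₂
    have hB := isClosable_Q₁'' (N := N) hb l₁ l₂
    exact ⟨hA, hB, (conjugates_C₁ hb h₁ h₂).conjPMap_eq hA hB⟩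
  · have hA := isClosable_Q₁'' (N := N) hb l₁ l₂
    have hL := hasFormalAdjoint_LOp (N := N) hb
    have hB : (toPMap ((σ : ℤ) • LOp N b)).IsClosable := by
      rw [← intCast_smul_LOp]
      exact (hL.smul _).isClosable
    exact ⟨hA, hL.isClosable, (conjugates_LOp σ μ₁ μ₂ m₁ m₂ h₁ h₂).conjPMap_eq hA hB⟩
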